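/- Let $N\ge 2$, let $k$ be a commutative ring and let $q\in k$ be a primitive $N$-th root of $1$, i.e. $q^N=1$ and $q^l-1$ is a non-zero-divisor for $1\le l\le N-1$. An $N$-differential graded (NDG) $k$-module is a $\mathbb Z$-graded $k$-module with an endomorphism $d$ of degree $1$ with $d^N=0$. Let $\mathcal A$ be an $N_qDG$ category: a $k$-linear category with NDG $k$-modules $\mathcal A(A,B)$ as morphism sets, whose composition is homogeneous of degree $0$ and satisfies $d(fg)=d(f)g+q^r f\,d(g)$ for $f$ of degree $r$. A right NDG $\mathcal A$-module $X$ is a collection of NDG $k$-modules $X(A)$, $A\in\mathcal A$, with bilinear, associative and unital scalar multiplications $X(A)\times\mathcal A(B,A)\to X(B)$ of degree $0$ satisfying $d(xf)=d(x)f+q^r x\,d(f)$ for $x$ of degree $r$. Let $\mathsf C_{Ndg}(\mathcal A)$ be the category of right NDG $\mathcal A$-modules, whose morphisms are the collections of degree-$0$ maps $X(A)\to Y(A)$ that commute with the differentials and with the scalar multiplications. For right NDG $\mathcal A$-modules $X,Y$ let $\operatorname{Hom}^r_{\mathcal A}(X,Y)$ be the set of collections of degree-$r$ maps $F_A:X(A)\to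 Y(A)$ with $F(xf)=F(x)f$, and put $d(F)=d_Y F-q^rF d_X\in\operatorname{Hom}^{r+1}_{\mathcal A}(X,Y)$. The homotopy category $\mathsf K_{Ndg}(\mathcal A)$ has the same objects as $\mathsf C_{Ndg}(\mathcal A)$, and $\operatorname{Hom}_{\mathsf K_{Ndg}(\mathcal A)}(X,Y)$ is the quotient of $\operatorname{Hom}_{\mathsf C_{Ndg}(\mathcal A)}(X,Y)=\{F\in \operatorname{Hom}^0_{\mathcal A}(X,Y): d(F)=0\}$ by $d^{N-1}\bigl(\operatorname{Hom}^{1-N}_{\mathcal A}(X,Y)\bigr)$. Define endofunctors of $\mathsf C_{Ndg}(\mathcal A)$ as follows. The functor $\theta_q$ is the shift $(\theta_qX)(A)^m=X(A)^{m+1}$ with the same scalar multiplication and with differential $q^{-1}d_X$. The functors $\Sigma$ and $\Sigma^{-1}$ are given by $$(\Sigma X)^m=\coprod_{i=m+1}^{m+N-1}X^i,\qquad (\Sigma^{-1}X)^m=\coprod_{i=m-N+1}^{m-1}X^i,$$ both with the differential $$d(x_1,\dots,x_{N-1})=\Bigl(x_2,\dots,x_{N-1},\,-\sum_{i=1}^{N-1}d^{N-i}(x_i)\Bigr)$$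 and, for $x=(x_1,\dots,x_{N-1})$ of degree $m$ and $a$ a morphism of $\mathcal A$, with the scalar multiplication $$(xa)_t=\sum_{s=1}^{t}\begin{bmatrix}t-1\\ s-1\end{bmatrix}_q q^{m(t-s)}\,x_s\,d^{\,t-s}(a),\qquad 1\le t\le N-1,$$ where the coefficients are Gaussian binomial coefficients; on morphisms they act entrywise. Then there are isomorphisms of functors $$\Sigma\;\simeq\;\Sigma^{-1}\theta_q^N\;\simeq\;\theta_q^N\Sigma^{-1}\quad\text{on } \mathsf C_{Ndg}(\mathcal A).$$ Moreover $\Sigma$ and $\theta_q$ induce endofunctors of $\mathsf K_{Ndg}(\mathcal A)$ (denoted in the same way), and there is an isomorphism of functors $$\Sigma^2\;\simeq\;\theta_q^N\quad\text{on } \mathsf K_{Ndg}(\mathcal A).$$ -/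

import Mathlib

open CategoryTheory

universe u v w w'

namespace NDG

noncomputable section

/-- `q` is a primitive `N`-th root of `1` in `k` (such a `q` is a unit): `q ^ N = 1`, and `q ^ l - 1` is a
non-zero-divisor for `1 ≤ l ≤ N - 1`. -/
structure IsPrimitiveNthRoot {k : Type u} [CommRing k] (N : ℕ) (q : kˣ) : Prop where
  pow_eq_one : q ^ N = 1
  sub_one_mem : ∀ l : ℕ, 1 ≤ l → l ≤ N - 1 → (q : k) ^ l - 1 ∈ nonZeroDivisors k

/-! ### `q`-numbers -/

section qnumbers

variable {k : Type u} [CommRing k]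

/-- The `q`-number `[m] = 1 + q + ⋯ + q ^ (m - 1)`. -/
def qNumber (q : k) (m : ℕ) : k := ∑ i ∈ Finset.range m, q ^ i

/-- The `q`-factorial `[m]! = [m] [m - 1] ⋯ [1]`. -/
def qFactorial (q : k) : ℕ → k
  | 0 => 1
  | m + 1 => qNumber q (m + 1) * qFactorial q m

/-- The Gaussian binomial coefficient `[m, l]`, defined by the `q`-Pascal rule. It is characterised by
`[m, l] [l]! [m - l]! = [m]!` whenever `[l]!` and `[m - l]!` are non-zero-divisors, see
`qBinom_mul_qFactorial`. -/
def qBinom (q : k) : ℕ → ℕ → k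
  | _, 0 => 1
  | 0, _ + 1 => 0
  | m + 1, l + 1 => qBinom q m l + q ^ (l + 1) * qBinom q m (l + 1)

variable (q : k)

@[simp] lemma qBinom_zero_right (m : ℕ) : qBinom q m 0 = 1 := by cases m <;> rfl

lemma qBinom_succ_succ (m l : ℕ) :
    qBinom q (m + 1) (l + 1) = qBinom q m l + q ^ (l + 1) * qBinom q m (l + 1) := rfl

lemma qBinom_eq_zero : ∀ (m l : ℕ), m < l → qBinom q m l = 0
  | 0, l + 1, _ => rfl
  | m + 1, l + 1, h => by
    rw [qBinom_succ_succ, qBinom_eq_zero m l (by omega), qBinom_eq_zero m (l + 1) (by omega)]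
    simp

@[simp] lemma qBinom_self : ∀ m : ℕ, qBinom q m m = 1
  | 0 => rfl
  | m + 1 => by
    rw [qBinom_succ_succ, qBinom_self m, qBinom_eq_zero q m (m + 1) (by omega)]
    simp

lemma qNumber_add (a b : ℕ) : qNumber q (a + b) = qNumber q a + q ^ a * qNumber q b := by
  simp [qNumber, Finset.sum_range_add, Finset.mul_sum, pow_add]

lemma qNumber_succ (m : ℕ) : qNumber q (m + 1) = qNumber q m + q ^ m := by
  simp [qNumber, Finset.sum_range_succ]

lemma qBinom_mul_qFactorial : ∀ a b : ℕ,
    qBinom q (a + b) a * (qFactorial q a * qFactorial q b) = qFactorial q (a + b)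
  | 0, b => by simp [qFactorial]
  | a + 1, 0 => by simp [qFactorial]
  | a + 1, b + 1 => by
    have h1 := qBinom_mul_qFactorial a (b + 1)
    have h2 := qBinom_mul_qFactorial (a + 1) b
    have e1 : a + 1 + (b + 1) = (a + b + 1) + 1 := by ring
    have e2 : a + (b + 1) = a + b + 1 := by ring
    have e3 : a + 1 + b = a + b + 1 := by ring
    rw [e2] at h1
    rw [e3] at h2
    rw [e1, qBinom_succ_succ]
    have h3 : qNumber q (a + b + 1 + 1) = qNumber q (a + 1) + q ^ (a + 1) * qNumber q (b + 1) := by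
      rw [← qNumber_add, e1]
    have f1 : qFactorial q (a + 1) = qNumber q (a + 1) * qFactorial q a := rfl
    have f2 : qFactorial q (b + 1) = qNumber q (b + 1) * qFactorial q b := rfl
    have f3 : qFactorial q (a + b + 1 + 1)
      = qNumber q (a + b + 1 + 1) * qFactorial q (a + b + 1) := rfl
    rw [f3, h3, f1, f2]
    rw [f2] at h1
    rw [f1] at h2
    linear_combination qNumber q (a + 1) * h1 + q ^ (a + 1) * qNumber q (b + 1) * h2

/-- The second `q`-Pascal rule. -/
lemma qBinom_succ_succ' : ∀ (m l : ℕ), l ≤ m →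
    qBinom q (m + 1) (l + 1) = q ^ (m - l) * qBinom q m l + qBinom q m (l + 1)
  | 0, 0, _ => by simp [qBinom]
  | 0, l + 1, h => by omega
  | m + 1, 0, _ => by
    have h1 := qBinom_succ_succ' m 0 (by omega)
    have h2 := qBinom_succ_succ q m 0
    rw [qBinom_succ_succ]
    simp only [qBinom_zero_right, zero_add, pow_one, Nat.sub_zero, mul_one] at h1 h2 ⊢
    rw [pow_succ]
    linear_combination q * h1 - h2
  | m + 1, l + 1, h => by
    rcases Nat.lt_or_ge l m with h' | h'
    · obtain ⟨c, rfl⟩ : ∃ c, m = l + 1 + c := ⟨m - (l + 1), by omega⟩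
      have h1 := qBinom_succ_succ' (l + 1 + c) l (by omega)
      have h2 := qBinom_succ_succ' (l + 1 + c) (l + 1) (by omega)
      have g1 := qBinom_succ_succ q (l + 1 + c) l
      have g2 := qBinom_succ_succ q (l + 1 + c) (l + 1)
      have e1 : l + 1 + c - l = c + 1 := by omega
      have e2 : l + 1 + c - (l + 1) = c := by omega
      have e3 : l + 1 + c + 1 - (l + 1) = c + 1 := by omega
      rw [e1] at h1
      rw [e2] at h2
      rw [e3, qBinom_succ_succ]
      linear_combination h1 + q ^ (l + 2) * h2 - q ^ (c + 1) * g1 - g2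
    · obtain rfl : l = m := by omega
      rw [qBinom_self, qBinom_self, qBinom_eq_zero q (l + 1) (l + 1 + 1) (by omega)]
      simp

variable {q}

lemma qNumber_mem {N : ℕ} {q : kˣ} (hq : IsPrimitiveNthRoot N q) (m : ℕ) (h1 : 1 ≤ m)
    (h2 : m ≤ N - 1) : qNumber (q : k) m ∈ nonZeroDivisors k := by
  have h := hq.sub_one_mem m h1 h2
  rw [← geom_sum_mul] at h
  exact (mul_mem_nonZeroDivisors.1 h).1

lemma qNumber_eq_zero {N : ℕ} {q : kˣ} (hN : 2 ≤ N) (hq : IsPrimitiveNthRoot N q) :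
    qNumber (q : k) N = 0 := by
  have h := hq.sub_one_mem 1 le_rfl (by omega)
  rw [pow_one] at h
  refine (mem_nonZeroDivisors_iff.1 h).2 _ ?_
  rw [qNumber, geom_sum_mul, ← Units.val_pow_eq_pow_val, hq.pow_eq_one]
  simp

lemma qFactorial_mem {N : ℕ} {q : kˣ} (hq : IsPrimitiveNthRoot N q) : ∀ m : ℕ, m ≤ N - 1 →
    qFactorial (q : k) m ∈ nonZeroDivisors k
  | 0, _ => one_mem _
  | m + 1, h => mul_mem (qNumber_mem hq (m + 1) (by omega) h) (qFactorial_mem hq m (by omega))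

lemma qBinom_top {N : ℕ} {q : kˣ} (hN : 2 ≤ N) (hq : IsPrimitiveNthRoot N q) (l : ℕ) (h1 : 1 ≤ l)
    (h2 : l ≤ N - 1) : qBinom (q : k) N l = 0 := by
  obtain ⟨b, rfl⟩ : ∃ b, N = l + b := ⟨N - l, by omega⟩
  have h := qBinom_mul_qFactorial (q : k) l b
  have h0 : qFactorial (q : k) (l + b) = 0 := by
    obtain ⟨c, hc⟩ : ∃ c, l + b = c + 1 := ⟨l + b - 1, by omega⟩
    rw [hc, qFactorial, ← hc, qNumber_eq_zero hN hq, zero_mul]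
  rw [h0] at h
  exact (mem_nonZeroDivisors_iff.1
    (mul_mem (qFactorial_mem hq l h2) (qFactorial_mem hq b (by omega)))).2 _ h

lemma qBinom_mul_qBinom {N : ℕ} {q : kˣ} (hq : IsPrimitiveNthRoot N q) (s b c : ℕ)
    (h : s + b + c ≤ N - 1) :
    qBinom (q : k) (s + b + c) (s + b) * qBinom (q : k) (s + b) s
      = qBinom (q : k) (s + b + c) s * qBinom (q : k) (b + c) b := by
  have h1 := qBinom_mul_qFactorial (q : k) (s + b) c
  have h2 := qBinom_mul_qFactorial (q : k) s b
  have h3 := qBinom_mul_qFactorial (q : k) s (b + c)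
  have h4 := qBinom_mul_qFactorial (q : k) b c
  rw [← add_assoc] at h3
  have hm := mul_mem (qFactorial_mem hq s (by omega))
    (mul_mem (qFactorial_mem hq b (by omega)) (qFactorial_mem hq c (by omega)))
  refine mul_cancel_right_mem_nonZeroDivisors hm |>.1 ?_
  linear_combination h1 - h3
    + qBinom (q : k) (s + b + c) (s + b) * qFactorial (q : k) c * h2
    - qBinom (q : k) (s + b + c) s * qFactorial (q : k) s * h4

end qnumbers

/-! ### Graded modules with an endomorphism of degree one -/

/-- A `ℤ`-graded `k`-module `X = ∐ X i` with a homogeneous endomorphism `d` of degree `1`. -/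
structure GSeq (k : Type u) [CommRing k] where
  X : ℤ → Type w
  [addCommGroup : ∀ i, AddCommGroup (X i)]
  [module : ∀ i, Module k (X i)]
  /-- the component `X i → X j` of `d`, where `j = i + 1` -/
  d : ∀ i j : ℤ, i + 1 = j → (X i →ₗ[k] X j)

attribute [instance] GSeq.addCommGroup GSeq.module

namespace GSeq

variable {k : Type u} [CommRing k] (V : GSeq.{u, w} k)

/-- The component `X i → X j` of the power `d ^ n`, where `j = i + n`. -/
def dpow : ∀ (n : ℕ) (i j : ℤ), i + n = j → (V.X i →ₗ[k] V.X j)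
  | 0, i, j, h => (show i = j by simpa using h) ▸ LinearMap.id
  | n + 1, i, j, h => V.d (i + n) j (by rw [← h]; push_cast; ring) ∘ₗ dpow n i (i + n) rfl

/-- `D i j : X i → X j` is the component of the power `d ^ (j - i)` if `i ≤ j`, and `0` otherwise. -/
def D (i j : ℤ) : V.X i →ₗ[k] V.X j :=
  if h : i ≤ j then V.dpow (j - i).toNat i j (by omega) else 0

@[simp] lemma dpow_zero (i : ℤ) (h : i + (0 : ℕ) = i) (x : V.X i) : V.dpow 0 i i h x = x := rfl

lemma dpow_succ (n : ℕ) (i j l : ℤ) (h : i + n = j) (h' : j + 1 = l) (x : V.X i)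
    (h'' : i + (n + 1 : ℕ) = l) : V.dpow (n + 1) i l h'' x = V.d j l h' (V.dpow n i j h x) := by
  subst h
  rfl

@[simp] lemma D_self (i : ℤ) (x : V.X i) : V.D i i x = x := by
  have : ∀ (n : ℕ) (h : i + (n : ℤ) = i), n = 0 → V.dpow n i i h x = x := by
    rintro n h rfl; simp
  rw [D, dif_pos le_rfl]
  exact this _ _ (by simp)

lemma D_eq_zero (i j : ℤ) (h : j < i) : V.D i j = 0 := dif_neg (by omega)

lemma D_eq_dpow (n : ℕ) (i j : ℤ) (h : i + n = j) (x : V.X i) : V.D i j x = V.dpow n i j h x := by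
  have : ∀ (m : ℕ) (h' : i + (m : ℤ) = j), V.dpow m i j h' x = V.dpow n i j h x := by
    intro m h'
    obtain rfl : m = n := by omega
    rfl
  rw [D, dif_pos (by omega)]
  exact this _ _

lemma d_D (i j l : ℤ) (h : i ≤ j) (h' : j + 1 = l) (x : V.X i) :
    V.d j l h' (V.D i j x) = V.D i l x := by
  obtain ⟨n, rfl⟩ : ∃ n : ℕ, j = i + n := ⟨(j - i).toNat, by omega⟩
  rw [V.D_eq_dpow n _ _ rfl, V.D_eq_dpow (n + 1) i l (by push_cast; omega),
    V.dpow_succ n i _ l rfl h']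

lemma D_D (i j l : ℤ) (h : i ≤ j) (h' : j ≤ l) (x : V.X i) :
    V.D j l (V.D i j x) = V.D i l x := by
  obtain ⟨n, rfl⟩ : ∃ n : ℕ, l = j + n := ⟨(l - j).toNat, by omega⟩
  clear h'
  induction n with
  | zero =>
    have : ∀ l, l = j → V.D j l (V.D i j x) = V.D i l x := by rintro _ rfl; simp
    exact this _ (by simp)
  | succ n ih =>
    rw [← V.d_D j (j + n) _ (by omega) (by push_cast; ring), ih,
      V.d_D _ _ _ (by omega)]

lemma D_succ (i j : ℤ) (h : i + 1 = j) (x : V.X i) : V.D i j x = V.d i j h x := by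
  rw [← V.d_D i i j le_rfl h, D_self]

lemma D_d (i j l : ℤ) (h : i + 1 = j) (h' : j ≤ l) (x : V.X i) :
    V.D j l (V.d i j h x) = V.D i l x := by
  rw [← V.D_succ, V.D_D _ _ _ (by omega) h']

end GSeq

/-- An `N`-differential graded `k`-module: a graded `k`-module with `d` of degree `1`, `d ^ N = 0`. -/
structure NDGMod (k : Type u) [CommRing k] (N : ℕ) extends GSeq.{u, w} k where
  dpow_eq_zero : ∀ (i j : ℤ) (h : i + N = j), toGSeq.dpow N i j h = 0

lemma NDGMod.D_eq_zero' {k : Type u} [CommRing k] {N : ℕ} (V : NDGMod.{u, w} k N) (i j : ℤ)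
    (h : i + N ≤ j) (x : V.X i) : V.D i j x = 0 := by
  rw [← V.D_D i (i + N) j (by omega) h, V.D_eq_dpow N _ _ rfl, V.dpow_eq_zero]
  simp

/-- An `N_qDG` category: its morphism sets `A(A, B)` are `N`-differential graded `k`-modules, and its
composition is bilinear, homogeneous of degree `0`, associative, unital, and satisfies
`d (f g) = d (f) g + q ^ r f d (g)` for `f` of degree `r`. -/
structure NDGCat (k : Type u) [CommRing k] (N : ℕ) (q : kˣ) where
  Obj : Type v
  hom : Obj → Obj → NDGMod.{u, w} k N
  /-- the composition `A(B, C) i × A(A, B) j → A(A, C) l`, where `l = i + j` -/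
  comp : ∀ {A B C : Obj} (i j l : ℤ), i + j = l →
    ((hom B C).X i →ₗ[k] (hom A B).X j →ₗ[k] (hom A C).X l)
  one : ∀ A : Obj, (hom A A).X 0
  one_comp : ∀ {A B : Obj} (i : ℤ) (f : (hom A B).X i), comp 0 i i (zero_add i) (one B) f = f
  comp_one : ∀ {A B : Obj} (i : ℤ) (f : (hom A B).X i), comp i 0 i (add_zero i) f (one A) = f
  comp_assoc : ∀ {A B C E : Obj} (i j l ij jl ijl : ℤ) (h₁ : i + j = ij) (h₂ : j + l = jl)
    (h₃ : ij + l = ijl) (h₄ : i + jl = ijl)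
    (f : (hom C E).X i) (g : (hom B C).X j) (e : (hom A B).X l),
    comp ij l ijl h₃ (comp i j ij h₁ f g) e = comp i jl ijl h₄ f (comp j l jl h₂ g e)
  leibniz : ∀ {A B C : Obj} (i i' j j' l l' : ℤ) (h : i + j = l) (hi : i + 1 = i') (hj : j + 1 = j')
    (hl : l + 1 = l') (f : (hom B C).X i) (g : (hom A B).X j),
    (hom A C).d l l' hl (comp i j l h f g)
      = comp i' j l' (by omega) ((hom B C).d i i' hi f) g
        + ((q ^ i : kˣ) : k) • comp i j' l' (by omega) f ((hom A B).d j j' hj g)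

/-- A right `N`-differential graded module over an `N_qDG` category: a collection of `N`-differential
graded `k`-modules `X(A)` with a bilinear scalar multiplication `X(A) × 𝒜(B, A) → X(B)`, homogeneous
of degree `0`, associative, unital, with `d (x f) = d (x) f + q ^ r x d (f)` for `x` of degree `r`. -/
structure NDGModule {k : Type u} [CommRing k] {N : ℕ} {q : kˣ} (𝒜 : NDGCat.{u, v, w} k N q) where
  obj : 𝒜.Obj → NDGMod.{u, w'} k N
  /-- the scalar multiplication `X(A) i × 𝒜(B, A) j → X(B) l`, where `l = i + j` -/
  act : ∀ {A B : 𝒜.Obj} (i j l : ℤ), i + j = l →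
    ((obj A).X i →ₗ[k] (𝒜.hom B A).X j →ₗ[k] (obj B).X l)
  act_one : ∀ (A : 𝒜.Obj) (i : ℤ) (x : (obj A).X i), act i 0 i (add_zero i) x (𝒜.one A) = x
  act_comp : ∀ {A B C : 𝒜.Obj} (i j l ij jl ijl : ℤ) (h₁ : i + j = ij) (h₂ : j + l = jl)
    (h₃ : ij + l = ijl) (h₄ : i + jl = ijl)
    (x : (obj A).X i) (f : (𝒜.hom B A).X j) (g : (𝒜.hom C B).X l),
    act i jl ijl h₄ x (𝒜.comp j l jl h₂ f g) = act ij l ijl h₃ (act i j ij h₁ x f) g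
  leibniz : ∀ {A B : 𝒜.Obj} (i i' j j' l l' : ℤ) (h : i + j = l) (hi : i + 1 = i') (hj : j + 1 = j')
    (hl : l + 1 = l') (x : (obj A).X i) (f : (𝒜.hom B A).X j),
    (obj B).d l l' hl (act i j l h x f)
      = act i' j l' (by omega) ((obj A).d i i' hi x) f
        + ((q ^ i : kˣ) : k) • act i j' l' (by omega) x ((𝒜.hom B A).d j j' hj f)


lemma sum_pascal {k : Type u} [CommRing k] {M : Type w} [AddCommGroup M] [Module k M]
    (T : ℕ → M) (c e c' : ℕ → k) (t : ℕ) (h0 : c' 0 = e 0) (hs : ∀ b ≤ t, c' (b + 1) = c b + e (b + 1))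
    (he : e (t + 1) = 0) :
    ∑ b ∈ Finset.range (t + 1), c b • T (b + 1) + ∑ b ∈ Finset.range (t + 1), e b • T b
      = ∑ b ∈ Finset.range (t + 1 + 1), c' b • T b := by
  have h1 : ∑ b ∈ Finset.range (t + 1), e b • T b = ∑ b ∈ Finset.range (t + 1 + 1), e b • T b := by
    rw [Finset.sum_range_succ _ (t + 1), he, zero_smul, add_zero]
  rw [h1, Finset.sum_range_succ' _ (t + 1), Finset.sum_range_succ' _ (t + 1), ← add_assoc,
    ← Finset.sum_add_distrib, h0]
  congr 1
  refine Finset.sum_congr rfl fun b hb => ?_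
  rw [hs b (by simpa [Nat.lt_succ_iff] using hb), add_smul]

lemma NDGCat.d_one {k : Type u} [CommRing k] {N : ℕ} {q : kˣ} (𝒜 : NDGCat.{u, v, w} k N q)
    (A : 𝒜.Obj) (i : ℤ) (h : 0 + 1 = i) : (𝒜.hom A A).d 0 i h (𝒜.one A) = 0 := by
  obtain rfl : i = 1 := by omega
  have e := 𝒜.leibniz 0 1 0 1 0 1 rfl rfl rfl rfl (𝒜.one A) (𝒜.one A)
  rw [𝒜.one_comp, 𝒜.comp_one, 𝒜.one_comp] at e
  simpa using e

lemma NDGCat.D_one {k : Type u} [CommRing k] {N : ℕ} {q : kˣ} (𝒜 : NDGCat.{u, v, w} k N q)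
    (A : 𝒜.Obj) (i : ℤ) (h : i ≠ 0) : (𝒜.hom A A).D 0 i (𝒜.one A) = 0 := by
  rcases lt_or_gt_of_ne h with h | h
  · rw [GSeq.D_eq_zero _ _ _ h]; rfl
  · rw [← GSeq.D_d _ 0 1 i (by omega) (by omega), 𝒜.d_one, map_zero]

lemma NDGCat.D_comp {k : Type u} [CommRing k] {N : ℕ} {q : kˣ} (𝒜 : NDGCat.{u, v, w} k N q)
    {A B C : 𝒜.Obj} (n p l : ℤ) (h : n + p = l) (f : (𝒜.hom B C).X n) (g : (𝒜.hom A B).X p)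
    (t : ℕ) : ∀ L : ℤ, l + t = L → (𝒜.hom A C).D l L (𝒜.comp n p l h f g)
      = ∑ b ∈ Finset.range (t + 1), (((q ^ ((t - b) * n : ℤ) : kˣ) : k) * qBinom (q : k) t b) •
        𝒜.comp (n + b) (L - (n + b)) L (by omega) ((𝒜.hom B C).D n (n + b) f)
          ((𝒜.hom A B).D p (L - (n + b)) g) := by
  have key : ∀ (L i i' j j' : ℤ) (h : i + j = L) (h' : i' + j' = L), i = i' →
      𝒜.comp i j L h ((𝒜.hom B C).D n i f) ((𝒜.hom A B).D p j g)
      = 𝒜.comp i' j' L h' ((𝒜.hom B C).D n i' f) ((𝒜.hom A B).D p j' g) := by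
    rintro L i i' j j' h h' rfl
    obtain rfl : j = j' := by omega
    rfl
  induction t with
  | zero =>
    intro L hL
    obtain rfl : l = L := by simpa using hL
    rw [GSeq.D_self]
    simp only [zero_add, Finset.range_one, Finset.sum_singleton, qBinom_zero_right, Nat.cast_zero,
      sub_zero, zero_mul, zpow_zero, Units.val_one, mul_one, one_smul]
    rw [key l (n + (0 : ℕ)) n (l - (n + (0 : ℕ))) p (by omega) h (by simp), GSeq.D_self, GSeq.D_self]
  | succ t ih =>
    intro L hL
    push_cast at hL
    rw [← GSeq.d_D _ l (l + t) L (by omega) (by omega), ih _ rfl, map_sum]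
    have step : ∀ b ∈ Finset.range (t + 1),
        (𝒜.hom A C).d (l + t) L (by omega)
          ((((q ^ ((t - b) * n : ℤ) : kˣ) : k) * qBinom (q : k) t b) •
            𝒜.comp (n + b) (l + t - (n + b)) (l + t) (by omega) ((𝒜.hom B C).D n (n + b) f)
            ((𝒜.hom A B).D p (l + t - (n + b)) g))
        = (((q ^ ((t - b) * n : ℤ) : kˣ) : k) * qBinom (q : k) t b) •
            𝒜.comp (n + (b + 1 : ℕ)) (L - (n + (b + 1 : ℕ))) L (by omega)
              ((𝒜.hom B C).D n (n + (b + 1 : ℕ)) f)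
              ((𝒜.hom A B).D p (L - (n + (b + 1 : ℕ))) g)
          + (((q ^ ((t + 1 - b) * n : ℤ) : kˣ) : k) * ((q : k) ^ b * qBinom (q : k) t b)) •
            𝒜.comp (n + b) (L - (n + b)) L (by omega)
              ((𝒜.hom B C).D n (n + b) f) ((𝒜.hom A B).D p (L - (n + b)) g) := by
      intro b hb
      have hb' : b ≤ t := by simpa [Nat.lt_succ_iff] using hb
      rw [map_smul, 𝒜.leibniz (n + b) (n + (b + 1 : ℕ)) (l + t - (n + b)) (L - (n + b)) (l + t) L
        (by omega) (by push_cast; omega) (by omega) (by omega),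
        GSeq.d_D _ _ _ _ (by omega), GSeq.d_D _ _ _ _ (by omega), smul_add, smul_smul]
      congr 1
      · congr 1
        exact key _ _ _ _ _ _ _ rfl
      · congr 1
        have : (q ^ ((t + 1 - b) * n : ℤ) : kˣ) * q ^ b
          = q ^ ((t - b) * n : ℤ) * q ^ (n + b : ℤ) := by
          rw [← zpow_natCast, ← zpow_add, ← zpow_add]; congr 1; ring
        have := congrArg (Units.val) this
        simp only [Units.val_mul, Units.val_pow_eq_pow_val] at this
        linear_combination (-qBinom (q : k) t b) * this
    rw [Finset.sum_congr rfl step, Finset.sum_add_distrib]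
    refine sum_pascal (fun b : ℕ => 𝒜.comp (n + b) (L - (n + b)) L (by omega)
      ((𝒜.hom B C).D n (n + b) f) ((𝒜.hom A B).D p (L - (n + b)) g))
      (fun b => ((q ^ ((t - b) * n : ℤ) : kˣ) : k) * qBinom (q : k) t b)
      (fun b => ((q ^ ((t + 1 - b) * n : ℤ) : kˣ) : k) * ((q : k) ^ b * qBinom (q : k) t b))
      (fun b => ((q ^ (((t + 1 : ℕ) - b) * n : ℤ) : kˣ) : k) * qBinom (q : k) (t + 1) b)
      t ?_ ?_ ?_
    · simp
    · intro b _
      have e1 : ((t + 1 : ℕ) - (b + 1 : ℕ) : ℤ) = t - b := by push_cast; ring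
      have e2 : (t + 1 - (b + 1 : ℕ) : ℤ) = t - b := by push_cast; ring
      simp only [e1, e2, qBinom_succ_succ]
      ring
    · simp only [qBinom_eq_zero (q : k) t (t + 1) (by omega), mul_zero]

variable {k : Type u} [CommRing k] {N : ℕ} {q : kˣ} {𝒜 : NDGCat.{u, v, w} k N q}

namespace NDGModule

lemma act_congr (X : NDGModule.{u, v, w, w'} 𝒜) {A B : 𝒜.Obj} {i i' j j' l : ℤ} (h : i + j = l)
    (h' : i' + j' = l) (hi : i = i') (x : ∀ i, (X.obj A).X i) (f : ∀ j, (𝒜.hom B A).X j) :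
    X.act i j l h (x i) (f j) = X.act i' j' l h' (x i') (f j') := by
  obtain rfl := hi
  obtain rfl : j = j' := by omega
  rfl

/-- The expansion of `d ^ r (x) a`, where `r = N - 1 - s`. -/
lemma act_D_aux (hN : 2 ≤ N) (hq : IsPrimitiveNthRoot N q) (X : NDGModule.{u, v, w, w'} 𝒜)
    {A B : 𝒜.Obj} (m n : ℤ) (a : (𝒜.hom B A).X n) (r : ℕ) : ∀ (s : ℕ) (_ : s + r + 1 = N) (e : ℤ)
    (_ : q ^ e = q ^ (m + s + 1)) (x : (X.obj A).X e) (i l : ℤ) (_ : e + r = i) (hl : i + n = l),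
    X.act i n l hl ((X.obj A).D e i x) a
      = ∑ b ∈ Finset.range (r + 1), (qBinom (q : k) (s + b) s * ((q ^ (m * b) : kˣ) : k)) •
          (X.obj B).D (e + (n + b)) l
            (X.act e (n + b) (e + (n + b)) rfl x ((𝒜.hom B A).D n (n + b) a)) := by
  induction r with
  | zero =>
    intro s hs e he x i l hi hl
    obtain rfl : e = i := by simpa using hi
    subst hl
    have : ∀ j, j = n → (X.obj B).D (e + j) (e + n) (X.act e j (e + j) rfl x ((𝒜.hom B A).D n j a))
      = X.act e n (e + n) rfl x a := by
      rintro _ rfl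
      rw [GSeq.D_self, GSeq.D_self]
    simp [this]
  | succ r ih =>
    intro s hs e he x i l hi hl
    push_cast at hi
    rw [← GSeq.D_d _ e (e + 1) i rfl (by omega),
      ih (s + 1) (by omega) (e + 1) (by
        rw [zpow_add, he, ← zpow_add]; congr 1; push_cast; ring) _ i l (by omega) hl]
    have step : ∀ b ∈ Finset.range (r + 1),
        (X.obj B).D (e + 1 + (n + b)) l (X.act (e + 1) (n + b) (e + 1 + (n + b)) rfl
          ((X.obj A).d e (e + 1) rfl x) ((𝒜.hom B A).D n (n + b) a))
        = (X.obj B).D (e + (n + b)) l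
            (X.act e (n + b) (e + (n + b)) rfl x ((𝒜.hom B A).D n (n + b) a))
          - ((q ^ e : kˣ) : k) • (X.obj B).D (e + (n + (b + 1 : ℕ))) l
            (X.act e (n + (b + 1 : ℕ)) (e + (n + (b + 1 : ℕ))) rfl x
              ((𝒜.hom B A).D n (n + (b + 1 : ℕ)) a)) := by
      intro b hb
      have hb' : b ≤ r := by simpa [Nat.lt_succ_iff] using hb
      have hL := X.leibniz e (e + 1) (n + b) (n + (b + 1 : ℕ)) (e + (n + b)) (e + 1 + (n + b)) rfl rfl
        (by push_cast; ring) (by ring) x ((𝒜.hom B A).D n (n + b) a)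
      rw [GSeq.d_D _ _ _ _ (by omega)] at hL
      rw [← GSeq.D_d _ (e + (n + b)) (e + 1 + (n + b)) l (by ring) (by omega), hL, map_add, map_smul]
      have : ∀ z (hz : e + (n + (b + 1 : ℕ)) = z), (X.obj B).D z l
          (X.act e (n + (b + 1 : ℕ)) z hz x ((𝒜.hom B A).D n (n + (b + 1 : ℕ)) a))
          = (X.obj B).D (e + (n + (b + 1 : ℕ))) l
            (X.act e (n + (b + 1 : ℕ)) (e + (n + (b + 1 : ℕ))) rfl x
              ((𝒜.hom B A).D n (n + (b + 1 : ℕ)) a)) := by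
        rintro _ rfl; rfl
      rw [this]
      simp
    have e0 : ((q ^ e : kˣ) : k) = ((q ^ m : kˣ) : k) * (q : k) ^ (s + 1) := by
      rw [he, add_assoc, zpow_add]
      push_cast
      congr 1
    rw [Finset.sum_congr rfl fun b hb => by rw [step b hb, smul_sub, smul_smul],
      Finset.sum_sub_distrib, sub_eq_neg_add, ← Finset.sum_neg_distrib]
    simp only [← neg_smul]
    have top := qBinom_top hN hq (s + 1) (by omega) (by omega)
    refine sum_pascal (fun b : ℕ => (X.obj B).D (e + (n + b)) l
            (X.act e (n + b) (e + (n + b)) rfl x ((𝒜.hom B A).D n (n + b) a)))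
      (fun b => -(qBinom (q : k) (s + 1 + b) (s + 1) * ((q ^ (m * b) : kˣ) : k) * ((q ^ e : kˣ) : k)))
      (fun b => qBinom (q : k) (s + 1 + b) (s + 1) * ((q ^ (m * b) : kˣ) : k))
      (fun b => qBinom (q : k) (s + b) s * ((q ^ (m * b) : kˣ) : k))
      r ?_ ?_ ?_
    · simp
    · intro b hb
      have e1 : m * (b + 1 : ℕ) = m + m * b := by push_cast; ring
      have e2 : s + 1 + (b + 1) = s + b + 1 + 1 := by ring
      have e3 : s + 1 + b = s + b + 1 := by ring
      simp only [e1, e2, e3, zpow_add, e0, qBinom_succ_succ (q : k) (s + b + 1) s, Units.val_mul,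
        ← add_assoc]
      ring
    · have : s + 1 + (r + 1) = N := by omega
      simp only [this, top, zero_mul]

end NDGModule


/-! ### The underlying `N`-differential graded modules of `Σ X` and `Σ⁻¹ X` -/

section sums

lemma sum_Ioo (M : Type w) [AddCommMonoid M] (P : ℤ) (hN : 2 ≤ N) (f : ℤ → M) :
    ∑ i ∈ Finset.Ioo P (P + N), f i = ∑ s ∈ Finset.range (N - 1), f (P + 1 + s) := by
  symm
  refine Finset.sum_bij (fun s _ => P + 1 + (s : ℤ)) ?_ ?_ ?_ ?_
  · intro s hs
    simp only [Finset.mem_range, Finset.mem_Ioo] at *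
    omega
  · intro a _ b _ h
    omega
  · intro b hb
    simp only [Finset.mem_Ioo] at hb
    exact ⟨(b - P - 1).toNat, by simp only [Finset.mem_range]; omega, by omega⟩
  · intro s _; rfl

end sums

namespace GSeq

variable (V : GSeq.{u, w} k)

/-- The graded module with `(susp V) m = ∐ V i` over `m + c < i < m + c + N`, with the differential
`(x_{m + c + 1}, …, x_{m + c + N - 1}) ↦ (x_{m + c + 2}, …, x_{m + c + N - 1}, - ∑ d ^ (m + c + N - i) x_i)`.
It underlies `Σ V` for `c = 0`, and `Σ⁻¹ V` for `c = - N`. -/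
def susp (N : ℕ) (c : ℤ) : GSeq.{u, w} k where
  X m := ∀ i : Finset.Ioo (m + c) (m + c + N), V.X i
  d m _ _ :=
    { toFun := fun x j =>
        if h : (j : ℤ) ∈ Finset.Ioo (m + c) (m + c + N) then x ⟨j, h⟩
        else - ∑ i : Finset.Ioo (m + c) (m + c + N), V.D i j (x i)
      map_add' := fun x y => funext fun j => by
        by_cases h : (j : ℤ) ∈ Finset.Ioo (m + c) (m + c + N)
        · simp only [dif_pos h, Pi.add_apply]
        · simp only [dif_neg h, Pi.add_apply, map_add, Finset.sum_add_distrib, neg_add]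
      map_smul' := fun r x => funext fun j => by
        by_cases h : (j : ℤ) ∈ Finset.Ioo (m + c) (m + c + N)
        · simp only [dif_pos h, Pi.smul_apply, RingHom.id_apply]
        · simp only [dif_neg h, Pi.smul_apply, map_smul, RingHom.id_apply, smul_neg,
            Finset.smul_sum] }

variable {V} {c : ℤ}

/-- The entry of degree `i` of an element of `susp V`, which is `0` for `i` out of range. -/
def entry {m : ℤ} (i : ℤ) : (V.susp N c).X m →ₗ[k] V.X i where
  toFun x := if h : i ∈ Finset.Ioo (m + c) (m + c + N) then x ⟨i, h⟩ else 0
  map_add' x y := by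
    split_ifs
    · rfl
    · simp
  map_smul' r x := by
    split_ifs
    · rfl
    · simp

lemma entry_eq_zero {m : ℤ} (x : (V.susp N c).X m) (i : ℤ)
    (h : i ∉ Finset.Ioo (m + c) (m + c + N)) : entry i x = 0 := dif_neg h

lemma entry_mk {m : ℤ} (x : ∀ i : Finset.Ioo (m + c) (m + c + N), V.X i) (i : ℤ)
    (h : i ∈ Finset.Ioo (m + c) (m + c + N)) :
    entry i (show (V.susp N c).X m from x) = x ⟨i, h⟩ := dif_pos h

lemma entry_ext {m : ℤ} (x y : (V.susp N c).X m) (h : ∀ i, m + c < i → i < m + c + N →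
    entry i x = entry i y) : x = y := by
  refine funext fun i => ?_
  have := Finset.mem_Ioo.1 i.2
  have := h i this.1 this.2
  rwa [show entry (i : ℤ) x = x i from dif_pos i.2, show entry (i : ℤ) y = y i from dif_pos i.2] at this

lemma sum_entry {m : ℤ} (x : ∀ i : Finset.Ioo (m + c) (m + c + N), V.X i)
    {M : Type w'} [AddCommMonoid M] (f : ∀ i, V.X i → M) :
    ∑ i : Finset.Ioo (m + c) (m + c + N), f i (x i)
      = ∑ i ∈ Finset.Ioo (m + c) (m + c + N), f i (entry i (show (V.susp N c).X m from x)) := by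
  rw [← Finset.sum_coe_sort (Finset.Ioo (m + c) (m + c + N))]
  exact Finset.sum_congr rfl fun i _ => by rw [entry_mk x i i.2]

/-- The last entry of the differential, placed in degree `m + c + N`. -/
def suspTop {m : ℤ} (x : (V.susp N c).X m) (i : ℤ) : V.X i :=
  if i = m + c + N then - ∑ j ∈ Finset.Ioo (m + c) (m + c + N), V.D j i (entry j x) else 0

lemma entry_d {m m' : ℤ} (h : m + 1 = m') (x : (V.susp N c).X m) (j : ℤ) (h1 : m' + c < j)
    (h2 : j < m' + c + N) :
    entry j ((V.susp N c).d m m' h x) = entry j x + suspTop x j := by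
  have hj := Finset.mem_Ioo.2 ⟨h1, h2⟩
  rw [show entry j ((V.susp N c).d m m' h x) = (V.susp N c).d m m' h x ⟨j, hj⟩ from dif_pos hj]
  by_cases hm : j ∈ Finset.Ioo (m + c) (m + c + N)
  · have e : (V.susp N c).d m m' h x ⟨j, hj⟩ = x ⟨j, hm⟩ := dif_pos hm
    rw [e, show entry j x = x ⟨j, hm⟩ from dif_pos hm, suspTop, if_neg, add_zero]
    have := Finset.mem_Ioo.1 hm
    omega
  · have e : (V.susp N c).d m m' h x ⟨j, hj⟩
        = - ∑ i : Finset.Ioo (m + c) (m + c + N), V.D i j (x i) := dif_neg hm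
    rw [e, entry_eq_zero _ _ hm, suspTop, if_pos, zero_add, sum_entry x (fun i z => V.D i j z)]
    rw [Finset.mem_Ioo] at hm
    omega

end GSeq

lemma NDGMod.susp_dpow (V : NDGMod.{u, w} k N) (c m : ℤ)
    (x : (V.susp N c).X m) (n : ℕ) : n ≤ N → ∀ (m' : ℤ) (h : m + n = m') (j : ℤ), m' + c < j →
    j < m' + c + N → GSeq.entry j ((V.susp N c).dpow n m m' h x) = GSeq.entry j x + GSeq.suspTop x j := by
  induction n with
  | zero =>
    intro _ m' h j h1 h2
    obtain rfl : m = m' := by simpa using h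
    rw [GSeq.dpow_zero, GSeq.suspTop, if_neg (by omega), add_zero]
  | succ n ih =>
    intro hn m' h j h1 h2
    push_cast at h
    rw [GSeq.dpow_succ _ n m (m + n) m' rfl (by omega), GSeq.entry_d _ _ _ h1 h2]
    by_cases hj : j < m + n + c + N
    · rw [ih (by omega) _ rfl j (by omega) hj]
      exact add_eq_left.2 (if_neg (by omega))
    · obtain rfl : j = m + n + c + N := by omega
      rw [GSeq.entry_eq_zero _ _ (by simp), zero_add, GSeq.suspTop, if_pos rfl,
        GSeq.entry_eq_zero x _ (by rw [Finset.mem_Ioo]; omega), zero_add]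
      rw [Finset.sum_congr rfl fun i hi => by
        rw [ih (by omega) _ rfl i (Finset.mem_Ioo.1 hi).1 (Finset.mem_Ioo.1 hi).2]]
      rcases Nat.eq_zero_or_pos n with rfl | hn0
      · rw [GSeq.suspTop, if_pos (by simp)]
        simp only [Nat.cast_zero, add_zero]
        refine congrArg _ (Finset.sum_congr rfl fun i hi => ?_)
        have := Finset.mem_Ioo.1 hi
        rw [GSeq.suspTop, if_neg (by omega), add_zero]
      · rw [GSeq.suspTop, if_neg (by omega), neg_eq_zero]
        simp only [map_add]
        rw [Finset.sum_add_distrib]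
        have e1 : ∑ i ∈ Finset.Ioo (m + n + c) (m + n + c + N),
            V.D i (m + n + c + N) (GSeq.suspTop x i)
            = V.D (m + c + N) (m + n + c + N) (GSeq.suspTop x (m + c + N)) := by
          refine Finset.sum_eq_single_of_mem _ (by simp; omega) fun i _ hi => ?_
          rw [GSeq.suspTop, if_neg hi, map_zero]
        rw [e1, GSeq.suspTop, if_pos rfl, map_neg, map_sum, ← sub_eq_add_neg, sub_eq_zero]
        have e2 : ∀ i ∈ Finset.Ioo (m + c) (m + c + N), V.D (m + c + N) (m + n + c + N)
            (V.D i (m + c + N) (GSeq.entry i x)) = V.D i (m + n + c + N) (GSeq.entry i x) := fun i hi => by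
          have := Finset.mem_Ioo.1 hi
          rw [GSeq.D_D _ _ _ _ (by omega) (by omega)]
        rw [Finset.sum_congr rfl e2]
        have e3 : ∀ I : Finset ℤ, Finset.Ioo (m + n + c) (m + c + N) ⊆ I →
            (∀ i ∈ I, i ∉ Finset.Ioo (m + n + c) (m + c + N) →
              V.D i (m + n + c + N) (GSeq.entry i x) = 0) →
            ∑ i ∈ I, V.D i (m + n + c + N) (GSeq.entry i x)
            = ∑ i ∈ Finset.Ioo (m + n + c) (m + c + N), V.D i (m + n + c + N) (GSeq.entry i x) :=
          fun I h h' => (Finset.sum_subset h h').symm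
        rw [e3 (Finset.Ioo (m + n + c) (m + n + c + N)) ?_ ?_,
          e3 (Finset.Ioo (m + c) (m + c + N)) ?_ ?_]
        · intro i hi
          simp only [Finset.mem_Ioo] at *
          omega
        · intro i hi hi'
          simp only [Finset.mem_Ioo] at *
          exact V.D_eq_zero' _ _ (by omega) _
        · intro i hi
          simp only [Finset.mem_Ioo] at *
          omega
        · intro i hi hi'
          rw [GSeq.entry_eq_zero, map_zero]
          simp only [Finset.mem_Ioo] at *
          omega

/-- `susp` of an `N`-differential graded module. -/
def NDGMod.susp (V : NDGMod.{u, w} k N) (c : ℤ) : NDGMod.{u, w} k N where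
  toGSeq := V.toGSeq.susp N c
  dpow_eq_zero m m' h := by
    refine LinearMap.ext fun x => GSeq.entry_ext _ _ fun j h1 h2 => ?_
    rw [V.susp_dpow c m x N le_rfl m' h j h1 h2,
      GSeq.entry_eq_zero _ _ (by simp; omega), GSeq.suspTop, if_neg (by omega), zero_add,
      LinearMap.zero_apply, map_zero]

/-! ### The functors `Σ` and `Σ⁻¹` on objects -/

namespace NDGModule

lemma sum_add_aux {ι : Type} [Fintype ι] {M : Type w} [AddCommGroup M] (f g g' : ι → M)
    (h : ∀ i, f i = g i + g' i) : ∑ i, f i = ∑ i, g i + ∑ i, g' i := by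
  simp only [h, Finset.sum_add_distrib]

lemma sum_smul_aux {ι : Type} [Fintype ι] {M : Type w} [AddCommGroup M] [Module k M] (r : k)
    (f g : ι → M) (h : ∀ i, f i = r • g i) : ∑ i, f i = r • ∑ i, g i := by
  simp only [h, Finset.smul_sum]

variable (X : NDGModule.{u, v, w, w'} 𝒜)

/-- The scalar multiplication of `Σ X` (for `c = 0`) and of `Σ⁻¹ X` (for `c = - N`): for `x` of degree
`m`, the entry of `x a` in position `t` is `∑_{s ≤ t} [t - 1, s - 1] q ^ (m (t - s)) x_s d ^ (t - s) (a)`.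
In terms of degrees, the entry of degree `i` of `x` is in position `s = i - (m + c)`, and the entry of
degree `j` of `x a` is in position `t = j - (m + n + c)`, where `n` is the degree of `a`. -/
def suspAct (c : ℤ) {A B : 𝒜.Obj} (m n l : ℤ) (_ : m + n = l) :
    ((X.obj A).toGSeq.susp N c).X m →ₗ[k] (𝒜.hom B A).X n →ₗ[k] ((X.obj B).toGSeq.susp N c).X l :=
  LinearMap.mk₂ k
    (fun x a => fun j : Finset.Ioo (l + c) (l + c + N) => ∑ i : Finset.Ioo (m + c) (m + c + N),
      (qBinom (q : k) (j - (l + c) - 1 : ℤ).toNat (i - (m + c) - 1 : ℤ).toNat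
          * ((q ^ (m * (j - n - i)) : kˣ) : k)) •
        X.act (i : ℤ) (j - i) j (by omega) (x i) ((𝒜.hom B A).D n (j - i) a))
    (fun x x' a => funext fun j => sum_add_aux (M := (X.obj B).X j) _ _ _ fun i => by
      rw [← smul_add, ← LinearMap.add_apply, ← map_add]; rfl)
    (fun r x a => funext fun j => sum_smul_aux (M := (X.obj B).X j) r _ _ fun i => by
      rw [show (r • x) i = r • x i from rfl, map_smul, LinearMap.smul_apply, smul_comm])
    (fun x a a' => funext fun j => sum_add_aux (M := (X.obj B).X j) _ _ _ fun i => by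
      rw [← smul_add, ← map_add, ← map_add])
    (fun r x a => funext fun j => sum_smul_aux (M := (X.obj B).X j) r _ _ fun i => by
      rw [map_smul, map_smul, smul_comm])

lemma suspAct_apply (c : ℤ) {A B : 𝒜.Obj} (m n l : ℤ) (h : m + n = l)
    (x : ((X.obj A).toGSeq.susp N c).X m) (a : (𝒜.hom B A).X n) (j : Finset.Ioo (l + c) (l + c + N)) :
    X.suspAct c m n l h x a j = ∑ i : Finset.Ioo (m + c) (m + c + N),
      (qBinom (q : k) (j - (l + c) - 1 : ℤ).toNat (i - (m + c) - 1 : ℤ).toNat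
          * ((q ^ (m * (j - n - i)) : kˣ) : k)) •
        X.act (i : ℤ) (j - i) j (by omega) (x i) ((𝒜.hom B A).D n (j - i) a) := rfl

variable {X} {c : ℤ}

lemma entry_suspAct {A B : 𝒜.Obj} (m n l : ℤ) (h : m + n = l)
    (x : ((X.obj A).toGSeq.susp N c).X m) (a : (𝒜.hom B A).X n) (j : ℤ) (h1 : l + c < j)
    (h2 : j < l + c + N) :
    GSeq.entry j (X.suspAct c m n l h x a) = ∑ i ∈ Finset.Ioo (m + c) (m + c + N),
      (qBinom (q : k) (j - (l + c) - 1 : ℤ).toNat (i - (m + c) - 1 : ℤ).toNat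
          * ((q ^ (m * (j - n - i)) : kˣ) : k)) •
        X.act i (j - i) j (by omega) (GSeq.entry i x) ((𝒜.hom B A).D n (j - i) a) := by
  have hj := Finset.mem_Ioo.2 ⟨h1, h2⟩
  rw [show GSeq.entry j (X.suspAct c m n l h x a) = X.suspAct c m n l h x a ⟨j, hj⟩ from dif_pos hj]
  exact GSeq.sum_entry x (fun i z => (qBinom (q : k) (j - (l + c) - 1 : ℤ).toNat
    (i - (m + c) - 1 : ℤ).toNat * ((q ^ (m * (j - n - i)) : kˣ) : k)) •
        X.act i (j - i) j (by omega) z ((𝒜.hom B A).D n (j - i) a))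

lemma entry_suspAct' (hN : 2 ≤ N) {A B : 𝒜.Obj} (m n l : ℤ) (h : m + n = l)
    (x : ((X.obj A).toGSeq.susp N c).X m) (a : (𝒜.hom B A).X n) (t : ℕ) (ht : t < N - 1) (j : ℤ)
    (hj : j = l + c + 1 + t) :
    GSeq.entry j (X.suspAct c m n l h x a) = ∑ s ∈ Finset.range (N - 1),
      (qBinom (q : k) t s * ((q ^ (m * (t - s)) : kˣ) : k)) •
        X.act (m + c + 1 + s) (j - (m + c + 1 + s)) j (by omega) (GSeq.entry (m + c + 1 + s) x)
          ((𝒜.hom B A).D n (j - (m + c + 1 + s)) a) := by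
  rw [entry_suspAct m n l h x a j (by omega) (by omega), sum_Ioo _ _ hN]
  refine Finset.sum_congr rfl fun s _ => ?_
  have e1 : (j - (l + c) - 1 : ℤ).toNat = t := by omega
  have e2 : (m + c + 1 + s - (m + c) - 1 : ℤ).toNat = s := by omega
  have e3 : j - n - (m + c + 1 + s) = t - s := by omega
  rw [e1, e2, e3]

lemma suspAct_one {A : 𝒜.Obj} (m : ℤ) (x : ((X.obj A).toGSeq.susp N c).X m) :
    X.suspAct c m 0 m (add_zero m) x (𝒜.one A) = x := by
  refine GSeq.entry_ext _ _ fun j h1 h2 => ?_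
  rw [entry_suspAct _ _ _ _ _ _ _ h1 h2,
    Finset.sum_eq_single_of_mem j (Finset.mem_Ioo.2 ⟨h1, h2⟩)]
  · rw [qBinom_self]
    have : ∀ z (hz : j + z = j), X.act j z j hz (GSeq.entry j x) ((𝒜.hom A A).D 0 z (𝒜.one A))
        = GSeq.entry j x := by
      intro z hz
      obtain rfl : z = 0 := by omega
      rw [GSeq.D_self, X.act_one]
    rw [this]
    simp
  · intro i _ hi
    rw [𝒜.D_one A _ (by omega), map_zero, smul_zero]

lemma suspAct_comp (hN : 2 ≤ N) (hq : IsPrimitiveNthRoot N q) {A B C : 𝒜.Obj}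
    (i j l ij jl ijl : ℤ) (h₁ : i + j = ij) (h₂ : j + l = jl)
    (h₃ : ij + l = ijl) (h₄ : i + jl = ijl)
    (x : ((X.obj A).toGSeq.susp N c).X i) (f : (𝒜.hom B A).X j) (g : (𝒜.hom C B).X l) :
    X.suspAct c i jl ijl h₄ x (𝒜.comp j l jl h₂ f g)
      = X.suspAct c ij l ijl h₃ (X.suspAct c i j ij h₁ x f) g := by
  refine GSeq.entry_ext _ _ fun J h1 h2 => ?_
  obtain ⟨t, rfl⟩ : ∃ t : ℕ, J = ijl + c + 1 + t := ⟨(J - (ijl + c + 1)).toNat, by omega⟩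
  have ht : t < N - 1 := by omega
  rw [entry_suspAct' hN _ _ _ _ _ _ t ht _ rfl, entry_suspAct' hN _ _ _ _ _ _ t ht _ rfl]
  generalize hJ : ijl + c + 1 + (t : ℤ) = J
  have e1 : ∀ u ∈ Finset.range (N - 1),
      (qBinom (q : k) t u * ((q ^ (ij * (t - u)) : kˣ) : k)) •
        X.act (ij + c + 1 + u) (J - (ij + c + 1 + u)) J (by omega)
          (GSeq.entry (ij + c + 1 + u) (X.suspAct c i j ij h₁ x f))
          ((𝒜.hom C B).D l (J - (ij + c + 1 + u)) g)
      = ∑ s ∈ Finset.range (N - 1),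
        (qBinom (q : k) t u * qBinom (q : k) u s
          * (((q ^ (ij * (t - u)) : kˣ) : k) * ((q ^ (i * (u - s)) : kˣ) : k))) •
          X.act (i + c + 1 + s) (J - (i + c + 1 + s)) J (by omega) (GSeq.entry (i + c + 1 + s) x)
            (𝒜.comp (ij + c + 1 + u - (i + c + 1 + s)) (J - (ij + c + 1 + u))
              (J - (i + c + 1 + s)) (by omega)
              ((𝒜.hom B A).D j (ij + c + 1 + u - (i + c + 1 + s)) f)
              ((𝒜.hom C B).D l (J - (ij + c + 1 + u)) g)) := by
    intro u hu
    rw [entry_suspAct' hN _ _ _ _ _ _ u (by simpa using hu) _ rfl, map_sum,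
      LinearMap.sum_apply, Finset.smul_sum]
    refine Finset.sum_congr rfl fun s hs => ?_
    rw [map_smul, LinearMap.smul_apply, smul_smul, X.act_comp _ _ _ (ij + c + 1 + u) _ _ (by omega)]
    · congr 1
      ring
    · omega
  rw [Finset.sum_congr rfl e1, Finset.sum_comm]
  refine Finset.sum_congr rfl fun s hs => ?_
  rcases Nat.lt_or_ge t s with hst | hst
  · rw [qBinom_eq_zero _ _ _ hst, zero_mul, zero_smul]
    refine (Finset.sum_eq_zero fun u hu => ?_).symm
    rcases Nat.lt_or_ge t u with htu | htu
    · rw [qBinom_eq_zero _ _ _ htu]; simp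
    · rw [qBinom_eq_zero _ u s (by omega)]; simp
  · obtain ⟨r, rfl⟩ : ∃ r, t = s + r := ⟨t - s, by omega⟩
    rw [𝒜.D_comp j l jl h₂ f g r (J - (i + c + 1 + s)) (by push_cast at hJ; omega), map_sum,
      Finset.smul_sum]
    have hsub : (Finset.range (r + 1)).image (fun b => s + b) ⊆ Finset.range (N - 1) := by
      intro u hu
      simp only [Finset.mem_image, Finset.mem_range] at hu ⊢
      omega
    rw [← Finset.sum_subset hsub, Finset.sum_image (fun a _ b _ h => by simpa using h)]
    · refine Finset.sum_congr rfl fun b hb => ?_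
      have hb' : b ≤ r := by simpa [Nat.lt_succ_iff] using hb
      obtain ⟨d, rfl⟩ : ∃ d, r = b + d := ⟨r - b, by omega⟩
      rw [map_smul, smul_smul]
      have key : ∀ (a a' e e' z : ℤ) (h : a + e = z) (h' : a' + e' = z), a = a' →
          𝒜.comp a e z h ((𝒜.hom B A).D j a f) ((𝒜.hom C B).D l e g)
          = 𝒜.comp a' e' z h' ((𝒜.hom B A).D j a' f) ((𝒜.hom C B).D l e' g) := by
        rintro a a' e e' z h h' rfl
        obtain rfl : e = e' := by omega
        rfl
      rw [key (j + b) (ij + c + 1 + (s + b : ℕ) - (i + c + 1 + s)) _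
        (J - (ij + c + 1 + (s + b : ℕ))) _ _ (by omega) (by push_cast; omega)]
      congr 1
      have hm := qBinom_mul_qBinom hq s b d (by omega)
      have hu : (q ^ (ij * ((s + (b + d) : ℕ) - (s + b : ℕ))) : kˣ) * q ^ (i * ((s + b : ℕ) - s))
          = q ^ (i * ((s + (b + d) : ℕ) - s)) * q ^ (((b + d : ℕ) - b) * j) := by
        rw [← zpow_add, ← zpow_add, ← h₁]; congr 1; push_cast; ring
      have hu' := congrArg Units.val hu
      simp only [Units.val_mul] at hu'
      rw [hu', ← add_assoc s b d, hm]
      ring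
    · intro u _ hu
      simp only [Finset.mem_image, Finset.mem_range, not_exists, not_and] at hu
      rcases Nat.lt_or_ge (s + r) u with htu | htu
      · rw [qBinom_eq_zero _ _ _ htu]; simp
      · rcases Nat.lt_or_ge u s with hus | hus
        · rw [qBinom_eq_zero _ u s hus]; simp
        · exact absurd (by omega) (hu (u - s) (by omega))

/-- The expansion of `d ^ (N - 1 - s) (x) a` for `x` in position `s + 1`. -/
lemma act_D (hN : 2 ≤ N) (hq : IsPrimitiveNthRoot N q) (hc : q ^ c = 1) {A B : 𝒜.Obj} (m n l : ℤ)
    (h : m + n = l) (s : ℕ) (hs : s < N) (x : (X.obj A).X (m + c + 1 + s)) (a : (𝒜.hom B A).X n)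
    (e J : ℤ) (he : e = m + c + N) (hJ : e + n = J) :
    X.act e n J hJ ((X.obj A).D (m + c + 1 + s) e x) a
      = ∑ u ∈ Finset.range N, (qBinom (q : k) u s * ((q ^ (m * (u - s)) : kˣ) : k)) •
          (X.obj B).D (l + c + 1 + u) J (X.act (m + c + 1 + s) (l + c + 1 + u - (m + c + 1 + s))
            (l + c + 1 + u) (by omega) x
              ((𝒜.hom B A).D n (l + c + 1 + u - (m + c + 1 + s)) a)) := by
  obtain ⟨r, rfl⟩ : ∃ r, N = s + r + 1 := ⟨N - s - 1, by omega⟩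
  push_cast at he
  rw [X.act_D_aux hN hq m n a r s rfl (m + c + 1 + s) (by
    rw [show m + c + 1 + s = c + (m + s + 1) by ring, zpow_add, hc, one_mul]) x e J (by omega) hJ]
  have hsub : (Finset.range (r + 1)).image (fun b => s + b) ⊆ Finset.range (s + r + 1) := by
    intro u hu
    simp only [Finset.mem_image, Finset.mem_range] at hu ⊢
    omega
  rw [← Finset.sum_subset hsub, Finset.sum_image (fun a _ b _ h => by simpa using h)]
  · refine Finset.sum_congr rfl fun b _ => ?_
    have key : ∀ (p p' z z' : ℤ) (h : m + c + 1 + s + p = z) (h' : m + c + 1 + s + p' = z'), p = p' →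
        (X.obj B).D z J (X.act (m + c + 1 + s) p z h x ((𝒜.hom B A).D n p a))
        = (X.obj B).D z' J (X.act (m + c + 1 + s) p' z' h' x ((𝒜.hom B A).D n p' a)) := by
      rintro p p' z z' h h' rfl
      obtain rfl : z = z' := by omega
      rfl
    rw [key (n + b) (l + c + 1 + (s + b : ℕ) - (m + c + 1 + s)) _ (l + c + 1 + (s + b : ℕ)) _
      (by omega) (by push_cast; omega)]
    congr 4
    push_cast; ring
  · intro u _ hu
    simp only [Finset.mem_image, Finset.mem_range, not_exists, not_and] at hu
    rcases Nat.lt_or_ge u s with hus | hus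
    · rw [qBinom_eq_zero _ u s hus]; simp
    · rename_i hmem
      have := Finset.mem_range.1 hmem
      exact absurd (by omega) (hu (u - s) (by omega))

lemma suspAct_leibniz (hN : 2 ≤ N) (hq : IsPrimitiveNthRoot N q) (hc : q ^ c = 1) {A B : 𝒜.Obj}
    (i i' j j' l l' : ℤ) (h : i + j = l) (hi : i + 1 = i') (hj : j + 1 = j') (hl : l + 1 = l')
    (x : ((X.obj A).toGSeq.susp N c).X i) (f : (𝒜.hom B A).X j) :
    ((X.obj B).toGSeq.susp N c).d l l' hl (X.suspAct c i j l h x f)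
      = X.suspAct c i' j l' (by omega) (((X.obj A).toGSeq.susp N c).d i i' hi x) f
        + ((q ^ i : kˣ) : k) • X.suspAct c i j' l' (by omega) x ((𝒜.hom B A).d j j' hj f) := by
  refine GSeq.entry_ext _ _ fun J h1 h2 => ?_
  obtain ⟨t, rfl⟩ : ∃ t : ℕ, J = l' + c + 1 + t := ⟨(J - (l' + c + 1)).toNat, by omega⟩
  have ht : t < N - 1 := by omega
  rw [map_add, map_smul, entry_suspAct' hN _ _ _ _ _ _ t ht _ rfl,
    entry_suspAct' hN _ _ _ _ _ _ t ht _ rfl, GSeq.entry_d _ _ _ h1 h2]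
  generalize hJ : l' + c + 1 + (t : ℤ) = J at *
  let W : ℕ → (X.obj B).X J := fun s =>
    X.act (i + c + 1 + s) (J - (i + c + 1 + s)) J (by omega) (GSeq.entry (i + c + 1 + s) x)
      ((𝒜.hom B A).D j (J - (i + c + 1 + s)) f)
  have hWN : W (N - 1) = 0 := by
    simp only [W]
    rw [GSeq.entry_eq_zero _ _ (by rw [Finset.mem_Ioo]; omega), map_zero, LinearMap.zero_apply]
  -- the last summand of the definition
  have hR2 : ∀ s ∈ Finset.range (N - 1), (qBinom (q : k) t s * ((q ^ (i * (t - s)) : kˣ) : k)) •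
        X.act (i + c + 1 + s) (J - (i + c + 1 + s)) J (by omega) (GSeq.entry (i + c + 1 + s) x)
          ((𝒜.hom B A).D j' (J - (i + c + 1 + s)) ((𝒜.hom B A).d j j' hj f))
      = (qBinom (q : k) t s * ((q ^ (i * (t - s)) : kˣ) : k)) • W s := by
    intro s _
    rcases Nat.lt_or_ge t s with hst | hst
    · rw [qBinom_eq_zero _ _ _ hst]; simp
    · rw [GSeq.D_d _ _ _ _ _ (by omega)]
  have hR1 : ∀ s ∈ Finset.range (N - 1), (qBinom (q : k) t s * ((q ^ (i' * (t - s)) : kˣ) : k)) •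
        X.act (i' + c + 1 + s) (J - (i' + c + 1 + s)) J (by omega)
          (GSeq.entry (i' + c + 1 + s) (((X.obj A).toGSeq.susp N c).d i i' hi x))
          ((𝒜.hom B A).D j (J - (i' + c + 1 + s)) f)
      = (qBinom (q : k) t s * ((q ^ (i' * (t - s)) : kˣ) : k)) • W (s + 1)
        + (qBinom (q : k) t s * ((q ^ (i' * (t - s)) : kˣ) : k)) •
          X.act (i' + c + 1 + s) (J - (i' + c + 1 + s)) J (by omega)
          (GSeq.suspTop x (i' + c + 1 + s)) ((𝒜.hom B A).D j (J - (i' + c + 1 + s)) f) := by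
    intro s hs
    have hs' := Finset.mem_range.1 hs
    rw [GSeq.entry_d _ _ _ (by omega) (by omega), map_add, LinearMap.add_apply, smul_add]
    congr 2
    exact X.act_congr _ _ (by push_cast; omega) (fun i => GSeq.entry i x)
      (fun z => (𝒜.hom B A).D j z f)
  rw [Finset.sum_congr rfl hR1, Finset.sum_congr rfl hR2, Finset.sum_add_distrib, Finset.smul_sum,
    add_right_comm]
  simp only [smul_smul]
  obtain ⟨N', rfl⟩ : ∃ N', N = N' + 2 := ⟨N - 2, by omega⟩
  have hN1 : N' + 2 - 1 = N' + 1 := by omega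
  rw [hN1] at hWN ⊢
  rw [sum_pascal W (fun s => qBinom (q : k) t s * ((q ^ (i' * (t - s)) : kˣ) : k))
    (fun s => ((q ^ i : kˣ) : k) * (qBinom (q : k) t s * ((q ^ (i * (t - s)) : kˣ) : k)))
    (fun s => qBinom (q : k) (t + 1) s * ((q ^ (i * ((t + 1 : ℕ) - s)) : kˣ) : k)) N' ?_ ?_ ?_,
    Finset.sum_range_succ _ (N' + 1), hWN, smul_zero, add_zero]
  rotate_left
  · have e1 : i * ((t + 1 : ℕ) - (0 : ℕ)) = i + i * (t - (0 : ℕ)) := by push_cast; ring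
    simp only [e1, zpow_add, Units.val_mul, qBinom_zero_right]
    ring
  · intro b _
    rcases Nat.lt_or_ge t b with hb | hb
    · simp only [qBinom_eq_zero _ _ _ hb, qBinom_eq_zero (q : k) t (b + 1) (by omega),
        qBinom_eq_zero (q : k) (t + 1) (b + 1) (by omega)]
      simp
    · have e1 : i * ((t + 1 : ℕ) - (b + 1 : ℕ)) = i * (t - b) := by push_cast; ring
      have e2 : i' * (t - b) = i * (t - b) + (t - b : ℕ) := by
        push_cast [Nat.cast_sub hb]; rw [← hi]; ring
      have e3 : i * (t - b) = i + i * (t - (b + 1 : ℕ)) := by push_cast; ring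
      have e4 : ((q ^ i : kˣ) : k) * ((q ^ (i * (t - (b + 1 : ℕ))) : kˣ) : k)
          = ((q ^ (i * (t - b)) : kˣ) : k) := by
        rw [← Units.val_mul, ← zpow_add, ← e3]
      rw [e1, e2, zpow_add, zpow_natCast, qBinom_succ_succ' _ _ _ hb, mul_left_comm, e4]
      push_cast
      ring
  · simp only [qBinom_eq_zero (q : k) t (N' + 1) (by omega)]
    simp
  rcases Nat.lt_or_ge (t + 1) (N' + 1) with htN | htN
  · rw [entry_suspAct' hN _ _ _ _ _ _ (t + 1) (by omega) _ (by push_cast; omega), hN1, GSeq.suspTop,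
      if_neg (by omega)]
    congr 1
    refine (Finset.sum_eq_zero fun s hs => ?_).symm
    have hs' := Finset.mem_range.1 hs
    by_cases hsN : s = N'
    · rw [hsN, qBinom_eq_zero _ _ _ (by omega)]; simp
    · rw [GSeq.suspTop, if_neg (by omega), map_zero, LinearMap.zero_apply, smul_zero]
  · obtain rfl : t = N' := by omega
    rw [GSeq.entry_eq_zero _ _ (by rw [Finset.mem_Ioo]; omega), zero_add, GSeq.suspTop,
      if_pos (by push_cast at *; omega), sum_Ioo _ _ hN, hN1,
      Finset.sum_range_succ (fun s => (qBinom (q : k) t s * ((q ^ (i' * (t - s)) : kˣ) : k)) • _) t,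
      Finset.sum_eq_zero (s := Finset.range t), zero_add]
    swap
    · intro s hs
      have hs' := Finset.mem_range.1 hs
      rw [GSeq.suspTop, if_neg (by omega), map_zero, LinearMap.zero_apply, smul_zero]
    have hz : ∀ z (hz : i' + c + 1 + t + z = J),
        X.act (i' + c + 1 + t) z J hz (GSeq.suspTop x (i' + c + 1 + t)) ((𝒜.hom B A).D j z f)
        = - ∑ s ∈ Finset.range (t + 1), ∑ u ∈ Finset.range (t + 2),
          (qBinom (q : k) u s * ((q ^ (i * (u - s)) : kˣ) : k)) •
          (X.obj B).D (l + c + 1 + u) J (X.act (i + c + 1 + s) (l + c + 1 + u - (i + c + 1 + s))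
            (l + c + 1 + u) (by omega) (GSeq.entry (i + c + 1 + s) x)
              ((𝒜.hom B A).D j (l + c + 1 + u - (i + c + 1 + s)) f)) := by
      intro z hz
      obtain rfl : z = j := by omega
      rw [GSeq.D_self, GSeq.suspTop, if_pos (by push_cast; omega), sum_Ioo _ _ hN, hN1, map_neg,
        LinearMap.neg_apply, map_sum, LinearMap.sum_apply]
      refine congrArg _ (Finset.sum_congr rfl fun s hs => ?_)
      have hs' := Finset.mem_range.1 hs
      exact X.act_D hN hq hc i z l h s (by omega) _ f _ J (by push_cast; omega) hz
    rw [hz, qBinom_self, one_mul, sub_self, mul_zero, zpow_zero, Units.val_one, one_smul,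
      ← sub_eq_add_neg, eq_sub_iff_add_eq, neg_add_eq_iff_eq_add]
    simp only [Finset.sum_range_succ _ (t + 1)]
    rw [Finset.sum_add_distrib, Finset.sum_comm]
    refine congrArg₂ _ (Finset.sum_congr rfl fun u hu => ?_) (Finset.sum_congr rfl fun s hs => ?_)
    · rw [entry_suspAct' hN _ _ _ _ _ _ u (by simpa using hu) _ rfl, map_sum]
      exact Finset.sum_congr rfl fun s _ => (map_smul _ _ _).symm
    · obtain rfl : J = l + c + 1 + (t + 1 : ℕ) := by push_cast; omega
      rw [GSeq.D_self]

/-- `Σ X` (for `c = 0`) and `Σ⁻¹ X` (for `c = - N`). -/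
def susp (hN : 2 ≤ N) (hq : IsPrimitiveNthRoot N q) (c : ℤ) (hc : q ^ c = 1)
    (X : NDGModule.{u, v, w, w'} 𝒜) : NDGModule.{u, v, w, w'} 𝒜 where
  obj A := (X.obj A).susp c
  act := X.suspAct c
  act_one _ := suspAct_one
  act_comp := suspAct_comp hN hq
  leibniz := suspAct_leibniz hN hq hc

/-! ### The category of right modules -/

/-- A morphism of right `N`-differential graded modules: a collection of maps, homogeneous of degree
`0`, commuting with the differentials and with the scalar multiplication. -/
@[ext]
structure Hom (X Y : NDGModule.{u, v, w, w'} 𝒜) where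
  app : ∀ (A : 𝒜.Obj) (i : ℤ), (X.obj A).X i →ₗ[k] (Y.obj A).X i
  comm_d : ∀ (A : 𝒜.Obj) (i j : ℤ) (h : i + 1 = j) (x : (X.obj A).X i),
    app A j ((X.obj A).d i j h x) = (Y.obj A).d i j h (app A i x)
  comm_act : ∀ {A B : 𝒜.Obj} (i j l : ℤ) (h : i + j = l) (x : (X.obj A).X i) (f : (𝒜.hom B A).X j),
    app B l (X.act i j l h x f) = Y.act i j l h (app A i x) f

/-- The category `C_Ndg(𝒜)` of right `N`-differential graded `𝒜`-modules. -/
instance : Category (NDGModule.{u, v, w, w'} 𝒜) where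
  Hom := Hom
  id X := { app := fun _ _ => LinearMap.id, comm_d := fun _ _ _ _ _ => rfl,
            comm_act := fun _ _ _ _ _ _ => rfl }
  comp f g :=
    { app := fun A i => g.app A i ∘ₗ f.app A i
      comm_d := fun A i j h x => by simp [f.comm_d, g.comm_d]
      comm_act := fun i j l h x a => by simp [f.comm_act, g.comm_act] }

@[simp] lemma id_app (X : NDGModule.{u, v, w, w'} 𝒜) (A : 𝒜.Obj) (i : ℤ) :
    Hom.app (𝟙 X) A i = LinearMap.id := rfl

@[simp] lemma comp_app {X Y Z : NDGModule.{u, v, w, w'} 𝒜} (f : X ⟶ Y) (g : Y ⟶ Z) (A : 𝒜.Obj)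
    (i : ℤ) : Hom.app (f ≫ g) A i = Hom.app g A i ∘ₗ Hom.app f A i := rfl

@[ext] lemma hom_ext {X Y : NDGModule.{u, v, w, w'} 𝒜} {f g : X ⟶ Y}
    (h : ∀ A i x, Hom.app f A i x = Hom.app g A i x) : f = g :=
  Hom.ext (funext fun A => funext fun i => LinearMap.ext (h A i))

end NDGModule

lemma GSeq.map_dpow {V : GSeq.{u, w} k} {W : GSeq.{u, w'} k} (φ : ∀ i, V.X i →ₗ[k] W.X i)
    (hφ : ∀ i j h x, φ j (V.d i j h x) = W.d i j h (φ i x)) (n : ℕ) :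
    ∀ (i j : ℤ) (h : i + n = j) (x : V.X i), φ j (V.dpow n i j h x) = W.dpow n i j h (φ i x) := by
  induction n with
  | zero =>
    intro i j h x
    obtain rfl : i = j := by simpa using h
    simp
  | succ n ih =>
    intro i j h x
    rw [V.dpow_succ n i (i + n) j rfl (by push_cast at h; omega),
      W.dpow_succ n i (i + n) j rfl (by push_cast at h; omega), hφ, ih]

lemma GSeq.map_D {V : GSeq.{u, w} k} {W : GSeq.{u, w'} k} (φ : ∀ i, V.X i →ₗ[k] W.X i)
    (hφ : ∀ i j h x, φ j (V.d i j h x) = W.d i j h (φ i x)) (i j : ℤ) (x : V.X i) :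
    φ j (V.D i j x) = W.D i j (φ i x) := by
  rcases le_or_gt i j with h | h
  · rw [V.D_eq_dpow (j - i).toNat i j (by omega), W.D_eq_dpow (j - i).toNat i j (by omega),
      GSeq.map_dpow φ hφ]
  · simp [GSeq.D_eq_zero _ _ _ h]

namespace NDGModule

lemma map_suspAct {X Y : NDGModule.{u, v, w, w'} 𝒜} (f : X ⟶ Y) (c : ℤ) {A B : 𝒜.Obj} (m n l : ℤ)
    (h : m + n = l) (x : ((X.obj A).toGSeq.susp N c).X m) (a : (𝒜.hom B A).X n)
    (j : Finset.Ioo (l + c) (l + c + N)) :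
    Hom.app f B j (X.suspAct c m n l h x a j)
      = Y.suspAct c m n l h (fun i : Finset.Ioo (m + c) (m + c + N) => Hom.app f A i (x i)) a j := by
  rw [suspAct_apply, map_sum]
  refine Eq.trans (Finset.sum_congr rfl fun i _ => ?_) (suspAct_apply Y c m n l h _ a j).symm
  rw [map_smul, f.comm_act]

/-- The functors `Σ` (for `c = 0`) and `Σ⁻¹` (for `c = - N`); morphisms act entrywise. -/
def suspFunctor (hN : 2 ≤ N) (hq : IsPrimitiveNthRoot N q) (c : ℤ) (hc : q ^ c = 1) :
    NDGModule.{u, v, w, w'} 𝒜 ⥤ NDGModule.{u, v, w, w'} 𝒜 where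
  obj X := X.susp hN hq c hc
  map {X Y} f :=
    { app := fun A m =>
        { toFun := fun x => fun i : Finset.Ioo (m + c) (m + c + N) => Hom.app f A i (x i)
          map_add' := fun x y => funext fun i => map_add (Hom.app f A i) (x i) (y i)
          map_smul' := fun r x => funext fun i => map_smul (Hom.app f A i) r (x i) }
      comm_d := fun A m m' h x => funext fun j => by
        by_cases hj : (j : ℤ) ∈ Finset.Ioo (m + c) (m + c + N)
        · refine (congrArg (Hom.app f A j) (dif_pos hj)).trans (Eq.symm (dif_pos hj))
        · refine (congrArg (Hom.app f A j) (dif_neg hj)).trans (Eq.trans ?_ (Eq.symm (dif_neg hj)))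
          rw [map_neg, map_sum]
          refine congrArg _ (Finset.sum_congr rfl fun i _ => ?_)
          exact GSeq.map_D (Hom.app f A) (f.comm_d A) i j _
      comm_act := fun {A B} m n l h x a => funext fun j => by
        exact map_suspAct f c m n l h x a j }
  map_id X := rfl
  map_comp f g := rfl

/-- The functor `Σ`, with `(Σ X) m = ∐ X i` over `m + 1 ≤ i ≤ m + N - 1`. -/
def sigma (𝒜 : NDGCat.{u, v, w} k N q) (hN : 2 ≤ N) (hq : IsPrimitiveNthRoot N q) :
    NDGModule.{u, v, w, w'} 𝒜 ⥤ NDGModule.{u, v, w, w'} 𝒜 :=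
  suspFunctor hN hq 0 (zpow_zero q)

/-- The functor `Σ⁻¹`, with `(Σ⁻¹ X) m = ∐ X i` over `m - N + 1 ≤ i ≤ m - 1`. -/
def sigmaInv (𝒜 : NDGCat.{u, v, w} k N q) (hN : 2 ≤ N) (hq : IsPrimitiveNthRoot N q) :
    NDGModule.{u, v, w, w'} 𝒜 ⥤ NDGModule.{u, v, w, w'} 𝒜 :=
  suspFunctor hN hq (-N) (by rw [zpow_neg, zpow_natCast, hq.pow_eq_one, inv_one])

end NDGModule

/-! ### The shift functor `θ_q` -/

/-- The shift of the grading, with the differential multiplied by `q⁻¹`. -/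
def GSeq.shift (V : GSeq.{u, w} k) (q : kˣ) : GSeq.{u, w} k where
  X i := V.X (i + 1)
  d i j h := ((q⁻¹ : kˣ) : k) • V.d (i + 1) (j + 1) (by omega)

lemma GSeq.shift_dpow (V : GSeq.{u, w} k) (q : kˣ) (n : ℕ) : ∀ (i j : ℤ) (h : i + n = j)
    (x : V.X (i + 1)), (V.shift q).dpow n i j h x
      = (((q⁻¹ : kˣ) : k) ^ n • V.dpow n (i + 1) (j + 1) (by omega) x : V.X (j + 1)) := by
  induction n with
  | zero =>
    intro i j h x
    obtain rfl : i = j := by simpa using h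
    simp only [pow_zero, one_smul, GSeq.dpow_zero]
    rfl
  | succ n ih =>
    intro i j h x
    push_cast at h
    refine ((V.shift q).dpow_succ n i (i + n) j rfl (by omega) x (by push_cast; omega)).trans ?_
    rw [ih]
    change ((q⁻¹ : kˣ) : k) • V.d (i + n + 1) (j + 1) _ (_ • _) = _
    rw [map_smul, smul_smul, ← pow_succ', V.dpow_succ n (i + 1) (i + n + 1) (j + 1) (by omega)
      (by omega)]

/-- `GSeq.shift` of an `N`-differential graded module. -/
def NDGMod.shift (V : NDGMod.{u, w} k N) (q : kˣ) : NDGMod.{u, w} k N where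
  toGSeq := V.toGSeq.shift q
  dpow_eq_zero i j h := LinearMap.ext fun x => by
    refine (V.toGSeq.shift_dpow q N i j h x).trans ?_
    rw [V.dpow_eq_zero]
    exact smul_zero (A := V.X (j + 1)) _

namespace NDGModule

lemma theta_leibniz (X : NDGModule.{u, v, w, w'} 𝒜) {A B : 𝒜.Obj} (i i' j j' l l' : ℤ)
    (h : i + j = l) (hi : i + 1 = i') (hj : j + 1 = j') (hl : l + 1 = l')
    (x : (X.obj A).X (i + 1)) (f : (𝒜.hom B A).X j) :
    ((q⁻¹ : kˣ) : k) • (X.obj B).d (l + 1) (l' + 1) (by omega)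
        (X.act (i + 1) j (l + 1) (by omega) x f)
      = X.act (i' + 1) j (l' + 1) (by omega)
          (((q⁻¹ : kˣ) : k) • (X.obj A).d (i + 1) (i' + 1) (by omega) x) f
        + ((q ^ i : kˣ) : k) • X.act (i + 1) j' (l' + 1) (by omega) x ((𝒜.hom B A).d j j' hj f) := by
  rw [X.leibniz (i + 1) (i' + 1) j j' (l + 1) (l' + 1) (by omega) (by omega) hj (by omega),
    smul_add, map_smul, LinearMap.smul_apply, smul_smul, ← Units.val_mul, zpow_add_one,
    mul_comm (q ^ i), inv_mul_cancel_left]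

/-- The shift functor `θ_q`: `(θ_q X)(A) m = X(A) (m + 1)`, with the same scalar multiplication and the
differential multiplied by `q⁻¹`. -/
def theta (𝒜 : NDGCat.{u, v, w} k N q) : NDGModule.{u, v, w, w'} 𝒜 ⥤ NDGModule.{u, v, w, w'} 𝒜 where
  obj X :=
    { obj := fun A => (X.obj A).shift q
      act := fun i j l h => X.act (i + 1) j (l + 1) (by omega)
      act_one := fun A i x => X.act_one A (i + 1) x
      act_comp := fun i j l ij jl ijl h₁ h₂ h₃ h₄ x f g =>
        X.act_comp (i + 1) j l (ij + 1) jl (ijl + 1) (by omega) h₂ (by omega) (by omega) x f g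
      leibniz := theta_leibniz X }
  map f :=
    { app := fun A i => Hom.app f A (i + 1)
      comm_d := fun A i j h x =>
        (map_smul (Hom.app f A (j + 1)) _ _).trans
          (congrArg (((q⁻¹ : kˣ) : k) • ·) (f.comm_d A (i + 1) (j + 1) _ x))
      comm_act := fun i j l h x a => f.comm_act (i + 1) j (l + 1) _ x a }
  map_id X := rfl
  map_comp f g := rfl

/-! ### The graded modules of homogeneous morphisms and the homotopy category -/

/-- The `k`-module `Hom_𝒜 r (X, Y)` of homogeneous morphisms of degree `r` of right graded
`𝒜`-modules, as a submodule of the module of all families `F A i j : X(A) i → Y(A) j`: only the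
components with `j = i + r` are non-zero, and `F (x f) = F (x) f`. -/
def GrHom (X Y : NDGModule.{u, v, w, w'} 𝒜) (r : ℤ) :
    Submodule k (∀ (A : 𝒜.Obj) (i j : ℤ), (X.obj A).X i →ₗ[k] (Y.obj A).X j) where
  carrier := {F | (∀ A i j, i + r ≠ j → F A i j = 0) ∧
    ∀ (A B : 𝒜.Obj) (i j l i' l' : ℤ) (h : i + j = l) (h' : i' + j = l') (_ : i + r = i')
      (x : (X.obj A).X i) (f : (𝒜.hom B A).X j),
      F B l l' (X.act i j l h x f) = Y.act i' j l' h' (F A i i' x) f}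
  zero_mem' := ⟨fun _ _ _ _ => rfl, fun _ _ _ _ _ _ _ _ _ _ _ _ => by simp⟩
  add_mem' := fun {F G} hF hG => ⟨fun A i j h => by simp [hF.1 A i j h, hG.1 A i j h],
    fun A B i j l i' l' h h' hr x f => by
      simp [hF.2 A B i j l i' l' h h' hr x f, hG.2 A B i j l i' l' h h' hr x f]⟩
  smul_mem' := fun c F hF => ⟨fun A i j h => by simp [hF.1 A i j h],
    fun A B i j l i' l' h h' hr x f => by simp [hF.2 A B i j l i' l' h h' hr x f]⟩

/-- The differential `d (F) = d ∘ F - q ^ r F ∘ d` on homogeneous morphisms of degree `r`. -/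
def dHom (X Y : NDGModule.{u, v, w, w'} 𝒜) (r s : ℤ) (hs : r + 1 = s) :
    GrHom X Y r →ₗ[k] GrHom X Y s where
  toFun F := ⟨fun A i j => (Y.obj A).d (j - 1) j (by omega) ∘ₗ F.1 A i (j - 1)
      - ((q ^ r : kˣ) : k) • F.1 A (i + 1) j ∘ₗ (X.obj A).d i (i + 1) rfl, by
    refine ⟨fun A i j h => ?_, fun A B i j l i' l' h h' hr x f => ?_⟩
    · simp only
      rw [F.2.1 A i (j - 1) (by omega), F.2.1 A (i + 1) j (by omega)]
      simp
    · simp only [LinearMap.sub_apply, LinearMap.comp_apply, LinearMap.smul_apply, map_sub, map_smul]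
      rw [F.2.2 A B i j l (i' - 1) (l' - 1) h (by omega) (by omega),
        Y.leibniz (i' - 1) i' j (j + 1) (l' - 1) l' (by omega) (by omega) rfl (by omega),
        X.leibniz i (i + 1) j (j + 1) l (l + 1) h rfl rfl rfl, map_add, map_smul,
        F.2.2 A B (i + 1) j (l + 1) i' l' (by omega) h' (by omega),
        F.2.2 A B i (j + 1) (l + 1) (i' - 1) l' (by omega) (by omega) (by omega),
        smul_add, smul_smul, ← Units.val_mul, ← zpow_add]
      have : r + i = i' - 1 := by omega
      rw [this]
      abel⟩
  map_add' F G := by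
    refine Subtype.ext (funext fun A => funext fun i => funext fun j => LinearMap.ext fun x => ?_)
    simp
    abel
  map_smul' c F := by
    refine Subtype.ext (funext fun A => funext fun i => funext fun j => LinearMap.ext fun x => ?_)
    simp [smul_sub, smul_comm c]

/-- The graded module `Hom_𝒜(X, Y) = ∐ Hom_𝒜 r (X, Y)` with the differential `dHom`. -/
def homSeq (X Y : NDGModule.{u, v, w, w'} 𝒜) : GSeq.{u, max v w'} k where
  X r := GrHom X Y r
  d r s hs := dHom X Y r s hs

/-- Composition of homogeneous morphisms with a morphism on the left. -/
def postcomp (X : NDGModule.{u, v, w, w'} 𝒜) {Y Z : NDGModule.{u, v, w, w'} 𝒜} (g : Y ⟶ Z) (r : ℤ) :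
    GrHom X Y r →ₗ[k] GrHom X Z r where
  toFun F := ⟨fun A i j => Hom.app g A j ∘ₗ F.1 A i j, fun A i j h => by simp [F.2.1 A i j h],
    fun A B i j l i' l' h h' hr x f => by
      simp [F.2.2 A B i j l i' l' h h' hr x f, g.comm_act]⟩
  map_add' F G := by
    refine Subtype.ext (funext fun A => funext fun i => funext fun j => LinearMap.ext fun x => ?_)
    simp
  map_smul' c F := by
    refine Subtype.ext (funext fun A => funext fun i => funext fun j => LinearMap.ext fun x => ?_)
    simp

/-- Composition of homogeneous morphisms with a morphism on the right. -/
def precomp {X Y : NDGModule.{u, v, w, w'} 𝒜} (f : X ⟶ Y) (Z : NDGModule.{u, v, w, w'} 𝒜) (r : ℤ) :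
    GrHom Y Z r →ₗ[k] GrHom X Z r where
  toFun F := ⟨fun A i j => F.1 A i j ∘ₗ Hom.app f A i, fun A i j h => by simp [F.2.1 A i j h],
    fun A B i j l i' l' h h' hr x a => by
      simp [F.2.2 A B i j l i' l' h h' hr, f.comm_act]⟩
  map_add' F G := rfl
  map_smul' c F := rfl

lemma precomp_dHom {X Y : NDGModule.{u, v, w, w'} 𝒜} (f : X ⟶ Y) (Z : NDGModule.{u, v, w, w'} 𝒜)
    (r s : ℤ) (h : r + 1 = s) (F : GrHom Y Z r) :
    precomp f Z s (dHom Y Z r s h F) = dHom X Z r s h (precomp f Z r F) := by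
  refine Subtype.ext (funext fun A => funext fun i => funext fun j => LinearMap.ext fun x => ?_)
  simp [precomp, dHom, f.comm_d]

lemma postcomp_dHom (X : NDGModule.{u, v, w, w'} 𝒜) {Y Z : NDGModule.{u, v, w, w'} 𝒜} (g : Y ⟶ Z)
    (r s : ℤ) (h : r + 1 = s) (F : GrHom X Y r) :
    postcomp X g s (dHom X Y r s h F) = dHom X Z r s h (postcomp X g r F) := by
  refine Subtype.ext (funext fun A => funext fun i => funext fun j => LinearMap.ext fun x => ?_)
  simp [postcomp, dHom, g.comm_d]

/-- The map `d ^ (N - 1) : Hom_𝒜 (1 - N) (X, Y) → Hom_𝒜 0 (X, Y)`. -/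
def dHomTop (X Y : NDGModule.{u, v, w, w'} 𝒜) :
    GrHom X Y (-((N - 1 : ℕ) : ℤ)) →ₗ[k] GrHom X Y 0 :=
  (homSeq X Y).dpow (N - 1) (-((N - 1 : ℕ) : ℤ)) 0 (neg_add_cancel _)

/-- Two morphisms `f, g : X ⟶ Y` are homotopic if `f - g = d ^ (N - 1) (S)` in `Hom_𝒜 0 (X, Y)` for
some `S` in `Hom_𝒜 (1 - N) (X, Y)`; so the classes of morphisms `X ⟶ Y` form
`H^0_(1) Hom_𝒜(X, Y) = Ker d / Im d ^ (N - 1)`. -/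
def Homotopic (𝒜 : NDGCat.{u, v, w} k N q) : HomRel (NDGModule.{u, v, w, w'} 𝒜) := fun X Y f g =>
  ∃ S : GrHom X Y (-((N - 1 : ℕ) : ℤ)), ∀ (A : 𝒜.Obj) (i : ℤ) (x : (X.obj A).X i),
    Hom.app f A i x - Hom.app g A i x = (dHomTop X Y S).1 A i i x

instance (𝒜 : NDGCat.{u, v, w} k N q) : Congruence (Homotopic.{u, v, w, w'} 𝒜) where
  equivalence :=
    { refl := fun f => ⟨0, fun A i x => by simp⟩
      symm := fun ⟨S, hS⟩ => ⟨-S, fun A i x => by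
        rw [← neg_sub, hS, map_neg]; rfl⟩
      trans := fun ⟨S, hS⟩ ⟨T, hT⟩ => ⟨S + T, fun A i x => by
        rw [← sub_add_sub_cancel, hS, hT, map_add]; rfl⟩ }
  comp_left := fun {X Y Z} f g g' ⟨S, hS⟩ => ⟨precomp f Z _ S, fun A i x => by
    have : precomp f Z 0 (dHomTop Y Z S) = dHomTop X Z (precomp f Z _ S) :=
      GSeq.map_dpow (V := homSeq Y Z) (W := homSeq X Z) (precomp f Z)
        (fun r s h F => precomp_dHom f Z r s h F) (N - 1) _ 0 (neg_add_cancel _) S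
    rw [← this]
    exact hS A i (Hom.app f A i x)⟩
  comp_right := fun {X Y Z} f f' g ⟨S, hS⟩ => ⟨postcomp X g _ S, fun A i x => by
    have : postcomp X g 0 (dHomTop X Y S) = dHomTop X Z (postcomp X g _ S) :=
      GSeq.map_dpow (V := homSeq X Y) (W := homSeq X Z) (postcomp X g)
        (fun r s h F => postcomp_dHom X g r s h F) (N - 1) _ 0 (neg_add_cancel _) S
    rw [← this]
    exact (map_sub (Hom.app g A i) _ _).symm.trans (congrArg (Hom.app g A i) (hS A i x))⟩

/-- The homotopy category `K_Ndg(𝒜)`. -/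
abbrev KNdg (𝒜 : NDGCat.{u, v, w} k N q) := CategoryTheory.Quotient (Homotopic.{u, v, w, w'} 𝒜)

/-- An endofunctor of `C_Ndg(𝒜)` respects homotopy. -/
def RespectsHomotopy (F : NDGModule.{u, v, w, w'} 𝒜 ⥤ NDGModule.{u, v, w, w'} 𝒜) : Prop :=
  ∀ ⦃X Y : NDGModule.{u, v, w, w'} 𝒜⦄ (f g : X ⟶ Y), Homotopic 𝒜 f g → Homotopic 𝒜 (F.map f) (F.map g)

/-- The endofunctor of `K_Ndg(𝒜)` induced by an endofunctor of `C_Ndg(𝒜)` that respects homotopy. -/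
def induced (F : NDGModule.{u, v, w, w'} 𝒜 ⥤ NDGModule.{u, v, w, w'} 𝒜) (hF : RespectsHomotopy F) :
    KNdg.{u, v, w, w'} 𝒜 ⥤ KNdg.{u, v, w, w'} 𝒜 :=
  CategoryTheory.Quotient.lift _ (F ⋙ CategoryTheory.Quotient.functor _)
    fun _ _ f g h => CategoryTheory.Quotient.sound _ (hF f g h)

end NDGModule

end

/-- The `n`-th power of an endofunctor. -/
def iterate {C : Type v} [Category.{w} C] (F : C ⥤ C) : ℕ → (C ⥤ C)
  | 0 => 𝟭 C
  | n + 1 => iterate F n ⋙ F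

end NDG

/-!
Write `x = (x_p)` for an element of degree `m` of `Σ X`, where `m < p < m + N` and `x_p ∈ X p`, and call
`x_{m + 1}` its first entry.

*The isomorphisms on `C_Ndg`.* The `N`-th power of `θ_q` is the shift of the grading by `N` with the
differential unchanged, since `q ^ N = 1` (`nonempty_iterate_theta_card_iso`). The three modules `Σ X`,
`Σ⁻¹ θ_q ^ N X` and `θ_q ^ N Σ⁻¹ X` have the same entries in every degree; their differentials agree, and so do
their scalar multiplications, as these involve `m` only through powers of `q ^ m`.

*Homotopies.* For `S` of degree `1 - N` one has `d ^ (N - 1) (S) = ∑ d ^ (N - 1 - l) S d ^ l`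
(`dHomTop_apply`), because the Gaussian binomial coefficients `[N, l]` with `0 < l < N` vanish. The module
`Σ Y` is the cokernel of the embedding of `Y` into a relatively injective module, and also the kernel of a
projection from such a module onto a shift of `Y`. This has two concrete consequences.
* If `h : X → Y` is `𝒜`-linear of degree `0`, and `h d - d h` is the first entry of `f - g` for two
  morphisms `f, g : X ⟶ Σ Y`, then `f` and `g` are homotopic (`homotopic_of_first`).
* Every `S : Y → Z` of degree `1 - N` yields an `𝒜`-linear map `psi S : Σ Y → Z` of degree `0` such that
  `psi S ∘ d - d ∘ psi S` is minus the composition of `d ^ (N - 1) (S)` with the first entry (`psi_d`,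
  `psi_act`).

Taken together, they show that `Σ` respects homotopy: if `f - g = d ^ (N - 1) (S)`, then `h = - psi S`
satisfies the criterion for `Σ f` and `Σ g`.

*The isomorphism on `K_Ndg`.* For the first entry `S : Σ X → θ_q ^ N X`, one has `d ^ (N - 1) (S) = 0`, so
that `psi S` is a morphism `Σ Σ X ⟶ θ_q ^ N X` (`projHom`). It has a section (`inclHom`), which sends `x` to
the element whose entries are the `d ^ r (x)`, each placed in the last entry of `Σ X`. The other composition
is homotopic to the identity, by the criterion applied to the map that adds up the entries of `Σ Σ X` of equal
degree in `X`, with the opposite sign (`contraction_d`).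

*Linearity.* The scalar multiplication of `Σ X` is determined by the Leibniz rule together with its effect
on the first entry, or on the elements with only a last entry. So the linearity of all these maps follows from
their behaviour under `d` (`act_linear_of_single`, `act_linear_of_first`), and no identity between
Gaussian binomial coefficients is needed for it.
-/

namespace NDG

noncomputable section

variable {k : Type u} [CommRing k] {N : ℕ} {q : kˣ} {𝒜 : NDGCat.{u, v, w} k N q}

/-! ### Shifts of the grading -/

namespace GSeq

variable (V : GSeq.{u, w} k)

lemma D_bijective {i i' : ℤ} (h : i = i') : Function.Bijective (V.D i i') := by
  subst h
  have : (V.D i i : V.X i → V.X i) = id := funext fun x => V.D_self i x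
  rw [this]
  exact Function.bijective_id

lemma D_d_of_eq {i i' j j' : ℤ} (hi : i = i') (hj : j = j') (h : i + 1 = j) (h' : i' + 1 = j')
    (x : V.X i) : V.D j j' (V.d i j h x) = V.d i' j' h' (V.D i i' x) := by
  subst hi hj
  simp

/-- The shift of the grading by `c`, with the differential multiplied by `s`. -/
def shiftBy (c : ℤ) (s : k) : GSeq.{u, w} k where
  X i := V.X (i + c)
  d i j h := s • V.d (i + c) (j + c) (by omega)

lemma shiftBy_dpow (c : ℤ) (s : k) (n : ℕ) : ∀ (i j : ℤ) (h : i + n = j) (x : V.X (i + c)),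
    (V.shiftBy c s).dpow n i j h x
      = (s ^ n • V.dpow n (i + c) (j + c) (by omega) x : V.X (j + c)) := by
  induction n with
  | zero =>
    intro i j h x
    obtain rfl : i = j := by simpa using h
    simp only [pow_zero, one_smul, GSeq.dpow_zero]
    rfl
  | succ n ih =>
    intro i j h x
    push_cast at h
    refine ((V.shiftBy c s).dpow_succ n i (i + n) j rfl (by omega) x (by push_cast; omega)).trans ?_
    rw [ih]
    change s • V.d (i + n + c) (j + c) _ (_ • _) = _
    rw [map_smul, smul_smul, ← pow_succ', V.dpow_succ n (i + c) (i + n + c) (j + c) (by omega)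
      (by omega)]

lemma shiftBy_D (c : ℤ) (i j : ℤ) (x : V.X (i + c)) :
    (V.shiftBy c 1).D i j x = (V.D (i + c) (j + c) x : V.X (j + c)) := by
  rcases le_or_gt i j with h | h
  · refine ((V.shiftBy c 1).D_eq_dpow (j - i).toNat i j (by omega) x).trans ?_
    rw [shiftBy_dpow, V.D_eq_dpow (j - i).toNat (i + c) (j + c) (by omega), one_pow, one_smul]
  · rw [V.D_eq_zero _ _ (by omega), GSeq.D_eq_zero _ _ _ h]
    rfl

end GSeq

/-- `GSeq.shiftBy` of an `N`-differential graded module. -/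
def NDGMod.shiftBy (V : NDGMod.{u, w} k N) (c : ℤ) (s : k) : NDGMod.{u, w} k N where
  toGSeq := V.toGSeq.shiftBy c s
  dpow_eq_zero i j h := LinearMap.ext fun x => by
    refine (V.toGSeq.shiftBy_dpow c s N i j h x).trans ?_
    rw [V.dpow_eq_zero]
    exact smul_zero (A := V.X (j + c)) _

namespace NDGModule

lemma D_act_of_eq (X : NDGModule.{u, v, w, w'} 𝒜) {A B : 𝒜.Obj} {i i' j l l' : ℤ} (hi : i = i')
    (hl : l = l') (h : i + j = l) (h' : i' + j = l') (x : (X.obj A).X i) (f : (𝒜.hom B A).X j) :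
    (X.obj B).D l l' (X.act i j l h x f) = X.act i' j l' h' ((X.obj A).D i i' x) f := by
  subst hi hl
  simp

lemma shiftBy_leibniz {c : ℤ} {s : k} (hs : s * ((q ^ c : kˣ) : k) = 1)
    (X : NDGModule.{u, v, w, w'} 𝒜) {A B : 𝒜.Obj} (i i' j j' l l' : ℤ)
    (h : i + j = l) (hi : i + 1 = i') (hj : j + 1 = j') (hl : l + 1 = l')
    (x : (X.obj A).X (i + c)) (f : (𝒜.hom B A).X j) :
    s • (X.obj B).d (l + c) (l' + c) (by omega) (X.act (i + c) j (l + c) (by omega) x f)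
      = X.act (i' + c) j (l' + c) (by omega) (s • (X.obj A).d (i + c) (i' + c) (by omega) x) f
        + ((q ^ i : kˣ) : k) • X.act (i + c) j' (l' + c) (by omega) x ((𝒜.hom B A).d j j' hj f) := by
  rw [X.leibniz (i + c) (i' + c) j j' (l + c) (l' + c) (by omega) (by omega) hj (by omega),
    smul_add, map_smul, LinearMap.smul_apply, smul_smul, zpow_add, mul_comm (q ^ i), Units.val_mul,
    ← mul_assoc, hs, one_mul]

/-- The shift functor `X(A) m ↦ X(A) (m + c)`, with the same scalar multiplication and the differential
multiplied by `s`. The Leibniz rule forces `s = q ^ (-c)`. -/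
def shiftFunctor (𝒜 : NDGCat.{u, v, w} k N q) (c : ℤ) (s : k) (hs : s * ((q ^ c : kˣ) : k) = 1) :
    NDGModule.{u, v, w, w'} 𝒜 ⥤ NDGModule.{u, v, w, w'} 𝒜 where
  obj X :=
    { obj := fun A => (X.obj A).shiftBy c s
      act := fun i j l h => X.act (i + c) j (l + c) (by omega)
      act_one := fun A i x => X.act_one A (i + c) x
      act_comp := fun i j l ij jl ijl h₁ h₂ h₃ h₄ x f g =>
        X.act_comp (i + c) j l (ij + c) jl (ijl + c) (by omega) h₂ (by omega) (by omega) x f g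
      leibniz := shiftBy_leibniz hs X }
  map f :=
    { app := fun A i => Hom.app f A (i + c)
      comm_d := fun A i j h x =>
        (map_smul (Hom.app f A (j + c)) _ _).trans
          (congrArg (s • ·) (f.comm_d A (i + c) (j + c) _ x))
      comm_act := fun i j l h x a => f.comm_act (i + c) j (l + c) _ x a }
  map_id X := rfl
  map_comp f g := rfl

/-- The inverse of a morphism whose components are bijective. -/
def Hom.inverse {X Y : NDGModule.{u, v, w, w'} 𝒜} (f : X ⟶ Y)
    (h : ∀ A i, Function.Bijective (Hom.app f A i)) : Y ⟶ X where
  app A i := (LinearEquiv.ofBijective (Hom.app f A i) (h A i)).symm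
  comm_d A i j hij x := by
    obtain ⟨x, rfl⟩ := (h A i).2 x
    rw [← f.comm_d]
    exact (LinearEquiv.symm_apply_apply (LinearEquiv.ofBijective _ (h A j)) _).trans
      (congrArg _ (LinearEquiv.symm_apply_apply (LinearEquiv.ofBijective _ (h A i)) x).symm)
  comm_act {A B} i j l hl x a := by
    obtain ⟨x, rfl⟩ := (h A i).2 x
    rw [← f.comm_act]
    refine (LinearEquiv.symm_apply_apply (LinearEquiv.ofBijective _ (h B l)) _).trans ?_
    exact congrArg (fun z => X.act i j l hl z a)
      (LinearEquiv.symm_apply_apply (LinearEquiv.ofBijective _ (h A i)) x).symm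

lemma isIso_of_bijective {X Y : NDGModule.{u, v, w, w'} 𝒜} (f : X ⟶ Y)
    (h : ∀ A i, Function.Bijective (Hom.app f A i)) : IsIso f :=
  ⟨Hom.inverse f h,
    hom_ext fun A i x => LinearEquiv.symm_apply_apply (LinearEquiv.ofBijective _ (h A i)) x,
    hom_ext fun A i x => LinearEquiv.apply_symm_apply (LinearEquiv.ofBijective _ (h A i)) x⟩

lemma nonempty_iso_of_bijective {F G : NDGModule.{u, v, w, w'} 𝒜 ⥤ NDGModule.{u, v, w, w'} 𝒜}
    (α : F ⟶ G) (h : ∀ X A i, Function.Bijective (Hom.app (α.app X) A i)) : Nonempty (F ≅ G) := by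
  have : ∀ X, IsIso (α.app X) := fun X => isIso_of_bijective _ (h X)
  have : IsIso α := NatIso.isIso_of_isIso_app α
  exact ⟨asIso α⟩

lemma nonempty_id_iso_shift (hs : 1 * ((q ^ (0 : ℤ) : kˣ) : k) = 1) :
    Nonempty (𝟭 _ ≅ shiftFunctor.{u, v, w, w'} 𝒜 0 1 hs) :=
  nonempty_iso_of_bijective
    { app := fun X =>
        { app := fun A i => (X.obj A).D i (i + 0)
          comm_d := fun A i j h x =>
            ((X.obj A).D_d_of_eq (by omega) (by omega) h (by omega) x).trans (one_smul k _).symm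
          comm_act := fun i j l h x a => X.D_act_of_eq (by omega) (by omega) h (by omega) x a }
      naturality := fun X Y f => hom_ext fun A i x =>
        (GSeq.map_D (Hom.app f A) (f.comm_d A) i (i + 0) x).symm }
    fun X A i => (X.obj A).D_bijective (by omega)

lemma nonempty_shift_comp_theta_iso {c c' : ℤ} (hc : c + 1 = c') {s s' : k}
    (h : s * ((q⁻¹ : kˣ) : k) = s') (hs : s * ((q ^ c : kˣ) : k) = 1)
    (hs' : s' * ((q ^ c' : kˣ) : k) = 1) :
    Nonempty (shiftFunctor.{u, v, w, w'} 𝒜 c s hs ⋙ theta 𝒜 ≅ shiftFunctor 𝒜 c' s' hs') :=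
  nonempty_iso_of_bijective
    { app := fun X =>
        { app := fun A i => (X.obj A).D (i + 1 + c) (i + c')
          comm_d := fun A i j h' x => by
            have key : ∀ y : (X.obj A).X (i + 1 + c),
                (X.obj A).D (j + 1 + c) (j + c') (((q⁻¹ : kˣ) : k) • s •
                  (X.obj A).d (i + 1 + c) (j + 1 + c) (by omega) y)
                = s' • (X.obj A).d (i + c') (j + c') (by omega)
                  ((X.obj A).D (i + 1 + c) (i + c') y) := fun y => by
              rw [map_smul, map_smul, smul_smul, mul_comm, h,
                (X.obj A).D_d_of_eq (i' := i + c') (by omega) (by omega) (by omega) (by omega)]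
            exact key x
          comm_act := fun i j l h x a =>
            X.D_act_of_eq (by omega) (by omega) (by omega) (by omega) x a }
      naturality := fun X Y f => hom_ext fun A i x =>
        (GSeq.map_D (Hom.app f A) (f.comm_d A) (i + 1 + c) (i + c') x).symm }
    fun X A i => (X.obj A).D_bijective (by omega)

lemma nonempty_iterate_theta_iso (n : ℕ) : ∀ (s : k) (_ : s = ((q⁻¹ : kˣ) : k) ^ n)
    (hs : s * ((q ^ (n : ℤ) : kˣ) : k) = 1),
    Nonempty (iterate (theta.{u, v, w, w'} 𝒜) n ≅ shiftFunctor 𝒜 n s hs) := by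
  induction n with
  | zero =>
    intro s h hs
    rw [pow_zero] at h
    subst h
    exact nonempty_id_iso_shift hs
  | succ n ih =>
    intro s h hs
    obtain ⟨e⟩ := ih _ rfl (by
      rw [zpow_natCast, Units.val_pow_eq_pow_val, ← mul_pow, Units.inv_mul, one_pow])
    obtain ⟨e'⟩ := nonempty_shift_comp_theta_iso (𝒜 := 𝒜) (c' := (n + 1 : ℕ)) (s' := s)
      (by push_cast; ring) (by rw [h, pow_succ]) _ hs
    exact ⟨Functor.isoWhiskerRight e _ ≪≫ e'⟩

lemma one_mul_zpow_card (hq : IsPrimitiveNthRoot N q) : (1 : k) * ((q ^ (N : ℤ) : kˣ) : k) = 1 := by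
  rw [zpow_natCast, hq.pow_eq_one]
  simp

/-- The `N`-th power of `θ_q` is the shift of the grading by `N`, with the same differential. -/
lemma nonempty_iterate_theta_card_iso (hq : IsPrimitiveNthRoot N q) :
    Nonempty (iterate (theta.{u, v, w, w'} 𝒜) N ≅ shiftFunctor 𝒜 N 1 (one_mul_zpow_card hq)) :=
  nonempty_iterate_theta_iso N 1 (by
    rw [← Units.val_pow_eq_pow_val, inv_pow, hq.pow_eq_one]
    simp) _

end NDGModule

/-! ### Comparison of `Σ` and `Σ⁻¹` -/

namespace GSeq

variable (V : GSeq.{u, w} k) {c c' e m m' : ℤ}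

lemma suspTop_apply (x : (V.susp N c).X m) (i : ℤ) : suspTop x i =
    if i = m + c + N then - ∑ j ∈ Finset.Ioo (m + c) (m + c + N), V.D j i (entry j x) else 0 := rfl

/-- The regrouping `(susp V) m → (susp V) m'` for two offsets of the grading, which is the identity on
entries if `m + c = m' + c'`. -/
def regroup (N : ℕ) (c c' m m' : ℤ) : (V.susp N c).X m →ₗ[k] (V.susp N c').X m' :=
  LinearMap.pi fun i : Finset.Ioo (m' + c') (m' + c' + N) => entry (i : ℤ)

variable {V}

lemma entry_regroup (h : m + c = m' + c') (x : (V.susp N c).X m) (j : ℤ) :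
    entry j (V.regroup N c c' m m' x) = entry j x := by
  by_cases hj : j ∈ Finset.Ioo (m' + c') (m' + c' + N)
  · exact entry_mk _ j hj
  · rw [entry_eq_zero _ _ hj, entry_eq_zero _ _ (by rwa [h])]

lemma regroup_bijective (h : m + c = m' + c') : Function.Bijective (V.regroup N c c' m m') := by
  refine ⟨fun x y hxy => entry_ext _ _ fun j _ _ => ?_, fun y => ⟨V.regroup N c' c m' m y, ?_⟩⟩
  · rw [← entry_regroup h x, hxy, entry_regroup h]
  · exact entry_ext _ _ fun j _ _ => by rw [entry_regroup h, entry_regroup h.symm]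

lemma suspTop_regroup (h : m + c = m' + c') (x : (V.susp N c).X m) (j : ℤ) :
    suspTop (V.regroup N c c' m m' x) j = suspTop x j := by
  simp only [suspTop_apply, entry_regroup h, h]

variable (V)

/-- The regrouping `(susp V) m → (susp V') m'`, where `V'` is the shift of `V` by `e`; it is the
identity on entries if `m + c = m' + c' + e`. -/
def regroupShift (N : ℕ) (c c' e m m' : ℤ) :
    (V.susp N c).X m →ₗ[k] ((V.shiftBy e 1).susp N c').X m' :=
  LinearMap.pi fun i : Finset.Ioo (m' + c') (m' + c' + N) =>
    (entry ((i : ℤ) + e) : (V.susp N c).X m →ₗ[k] V.X (i + e))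

variable {V}

lemma entry_regroupShift (h : m + c = m' + c' + e) (x : (V.susp N c).X m) (j : ℤ) :
    entry j (V.regroupShift N c c' e m m' x) = (entry (j + e) x : V.X (j + e)) := by
  by_cases hj : j ∈ Finset.Ioo (m' + c') (m' + c' + N)
  · exact entry_mk _ j hj
  · rw [entry_eq_zero _ _ hj, entry_eq_zero x (j + e)
      (by simp only [Finset.mem_Ioo] at *; omega)]
    rfl

lemma regroupShift_bijective (h : m + c = m' + c' + e) :
    Function.Bijective (V.regroupShift N c c' e m m') := by
  refine ⟨fun x y hxy => entry_ext _ _ fun j _ _ => ?_, fun y => ?_⟩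
  · obtain ⟨i, rfl⟩ : ∃ i, j = i + e := ⟨j - e, by ring⟩
    rw [← entry_regroupShift h x, hxy, entry_regroupShift h]
  · obtain ⟨z, hz⟩ : ∃ z : ∀ i, V.X (i + e), ∀ i, z i = entry i y := ⟨fun i => entry i y, fun _ => rfl⟩
    refine ⟨fun j : Finset.Ioo (m + c) (m + c + N) => V.D (j - e + e) j (z (j - e)), ?_⟩
    refine entry_ext _ _ fun j h1 h2 => ?_
    refine (entry_regroupShift h _ j).trans ?_
    refine (entry_mk _ (j + e) (by rw [Finset.mem_Ioo]; omega)).trans ?_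
    have : ∀ i, i = j → V.D (i + e) (j + e) (z i) = z j := by
      rintro _ rfl
      exact V.D_self _ _
    exact (this _ (by ring)).trans (hz j)

lemma suspTop_regroupShift (h : m + c = m' + c' + e) (x : (V.susp N c).X m) (j : ℤ) :
    suspTop (V.regroupShift N c c' e m m' x) j = (suspTop x (j + e) : V.X (j + e)) := by
  rw [suspTop_apply, suspTop_apply]
  by_cases hj : j = m' + c' + N
  · rw [if_pos hj, if_pos (by omega)]
    refine congrArg (fun z : V.X (j + e) => -z) ?_
    refine Finset.sum_bij (fun i _ => i + e) ?_ ?_ ?_ ?_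
    · intro i hi
      simp only [Finset.mem_Ioo] at *
      omega
    · intro a _ b _ hab
      omega
    · intro b hb
      simp only [Finset.mem_Ioo] at *
      exact ⟨b - e, by omega, by omega⟩
    · intro i _
      rw [entry_regroupShift h]
      exact V.shiftBy_D e i j _
  · rw [if_neg hj, if_neg (by omega)]
    rfl

end GSeq

namespace NDGModule

lemma zpow_add_mul_card (hq : IsPrimitiveNthRoot N q) {m m' : ℤ} (hm : m' = m + N) (z : ℤ) :
    q ^ (m' * z) = q ^ (m * z) := by
  rw [hm, add_mul, zpow_add, zpow_mul q (N : ℤ), zpow_natCast, hq.pow_eq_one, one_zpow, mul_one]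

lemma regroup_d {V : GSeq.{u, w} k} {c c' m m' n n' : ℤ} (h : m + 1 = m') (h' : n + 1 = n')
    (hm : m + c = n + c') (x : (V.susp N c).X m) :
    V.regroup N c c' m' n' ((V.susp N c).d m m' h x)
      = (V.susp N c').d n n' h' (V.regroup N c c' m n x) := by
  refine GSeq.entry_ext _ _ fun j h1 h2 => ?_
  rw [GSeq.entry_regroup (by omega), GSeq.entry_d h _ j (by omega) (by omega),
    GSeq.entry_d h' _ j h1 h2, GSeq.entry_regroup hm, GSeq.suspTop_regroup hm]

lemma regroupShift_d {V : GSeq.{u, w} k} {c c' e m m' n n' : ℤ} (h : m + 1 = m') (h' : n + 1 = n')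
    (hm : m + c = n + c' + e) (x : (V.susp N c).X m) :
    V.regroupShift N c c' e m' n' ((V.susp N c).d m m' h x)
      = ((V.shiftBy e 1).susp N c').d n n' h' (V.regroupShift N c c' e m n x) := by
  refine GSeq.entry_ext _ _ fun j h1 h2 => ?_
  refine (GSeq.entry_regroupShift (by omega) _ _).trans ?_
  refine (GSeq.entry_d h _ (j + e) (by omega) (by omega)).trans ?_
  refine Eq.trans ?_ (GSeq.entry_d (V := V.shiftBy e 1) h' _ j h1 h2).symm
  exact (congrArg₂ (fun y z : V.X (j + e) => y + z) (GSeq.entry_regroupShift hm x j)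
    (GSeq.suspTop_regroupShift hm x j)).symm

lemma regroup_suspAct (hq : IsPrimitiveNthRoot N q) (X : NDGModule.{u, v, w, w'} 𝒜) {A B : 𝒜.Obj}
    {c c' : ℤ} (hc : c = c' + N) (m n l m' l' : ℤ) (h : m + n = l) (hm : m' = m + N)
    (h' : m' + n = l') (x : ((X.obj A).toGSeq.susp N c).X m) (a : (𝒜.hom B A).X n) :
    (X.obj B).regroup N c c' l l' (X.suspAct c m n l h x a)
      = X.suspAct c' m' n l' h' ((X.obj A).regroup N c c' m m' x) a := by
  have e1 : m + c = m' + c' := by omega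
  have e2 : l + c = l' + c' := by omega
  refine GSeq.entry_ext _ _ fun j h1 h2 => ?_
  rw [GSeq.entry_regroup e2, entry_suspAct m n l h x a j (by omega) (by omega),
    entry_suspAct m' n l' h' _ a j h1 h2, e1, e2]
  refine Finset.sum_congr rfl fun i _ => ?_
  rw [GSeq.entry_regroup e1, zpow_add_mul_card hq hm]

lemma regroupShift_suspAct (hq : IsPrimitiveNthRoot N q) (X : NDGModule.{u, v, w, w'} 𝒜)
    {A B : 𝒜.Obj} {c c' : ℤ} (hc : c = c' + N) (m n l : ℤ) (h : m + n = l)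
    (x : ((X.obj A).toGSeq.susp N c).X m) (a : (𝒜.hom B A).X n) :
    (X.obj B).regroupShift N c c' N l l (X.suspAct c m n l h x a)
      = ((shiftFunctor 𝒜 N 1 (one_mul_zpow_card hq)).obj X).suspAct c' m n l h
          ((X.obj A).regroupShift N c c' N m m x) a := by
  refine GSeq.entry_ext (V := (X.obj B).toGSeq.shiftBy N 1) _ _ fun j h1 h2 => ?_
  refine (GSeq.entry_regroupShift (by omega) _ _).trans ?_
  refine (entry_suspAct m n l h x a (j + N) (by omega) (by omega)).trans ?_
  refine Eq.trans ?_ (entry_suspAct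
    (X := (shiftFunctor 𝒜 N 1 (one_mul_zpow_card hq)).obj X) m n l h _ a j h1 h2).symm
  symm
  refine Finset.sum_bij (fun i _ => i + N) ?_ ?_ ?_ ?_
  · intro i hi
    simp only [Finset.mem_Ioo] at *
    omega
  · intro a _ b _ hab
    omega
  · intro b hb
    simp only [Finset.mem_Ioo] at *
    exact ⟨b - N, by omega, by omega⟩
  · intro i _
    have e1 : (j - (l + c') - 1 : ℤ) = j + N - (l + c) - 1 := by omega
    have e2 : (i - (m + c') - 1 : ℤ) = i + N - (m + c) - 1 := by omega
    have e3 : j + N - n - (i + N) = j - n - i := by ring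
    rw [e1, e2, e3]
    refine congrArg (fun z : (X.obj B).X (j + N) => _ • z) ?_
    have key : ∀ z (hz : i + N + z = j + N), z = j - i →
        X.act (i + N) (j - i) (j + N) (by omega) (GSeq.entry (i + N) x) ((𝒜.hom B A).D n (j - i) a)
        = X.act (i + N) z (j + N) hz (GSeq.entry (i + N) x) ((𝒜.hom B A).D n z a) := by
      rintro _ _ rfl; rfl
    refine Eq.trans ?_ (key _ (by ring) (by ring))
    exact congrArg (fun y => X.act (i + N) (j - i) (j + N) (by omega) y
      ((𝒜.hom B A).D n (j - i) a)) (GSeq.entry_regroupShift (by omega) x i)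

lemma zpow_neg_card (hq : IsPrimitiveNthRoot N q) : q ^ (-N : ℤ) = 1 := by
  rw [zpow_neg, zpow_natCast, hq.pow_eq_one, inv_one]

lemma entry_suspFunctor_map (hN : 2 ≤ N) (hq : IsPrimitiveNthRoot N q) {c : ℤ} (hc : q ^ c = 1)
    {X Y : NDGModule.{u, v, w, w'} 𝒜} (f : X ⟶ Y) (A : 𝒜.Obj) (m j : ℤ)
    (x : ((X.obj A).toGSeq.susp N c).X m) :
    GSeq.entry (V := (Y.obj A).toGSeq) (N := N) (c := c) (m := m) j
      (Hom.app ((suspFunctor hN hq c hc).map f) A m x) = Hom.app f A j (GSeq.entry j x) := by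
  by_cases hj : j ∈ Finset.Ioo (m + c) (m + c + N)
  · rw [show GSeq.entry j x = x ⟨j, hj⟩ from dif_pos hj]
    exact dif_pos hj
  · rw [GSeq.entry_eq_zero x j hj, map_zero]
    exact dif_neg hj

lemma regroup_map (hN : 2 ≤ N) (hq : IsPrimitiveNthRoot N q) {c c' : ℤ} (hc : q ^ c = 1)
    (hc' : q ^ c' = 1) {X Y : NDGModule.{u, v, w, w'} 𝒜} (f : X ⟶ Y) (A : 𝒜.Obj) {m m' : ℤ}
    (h : m + c = m' + c') (x : ((X.obj A).toGSeq.susp N c).X m) :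
    (Y.obj A).regroup N c c' m m' (Hom.app ((suspFunctor hN hq c hc).map f) A m x)
      = Hom.app ((suspFunctor hN hq c' hc').map f) A m' ((X.obj A).regroup N c c' m m' x) := by
  refine GSeq.entry_ext (V := (Y.obj A).toGSeq) _ _ fun j _ _ => ?_
  refine (GSeq.entry_regroup h _ _).trans ?_
  rw [entry_suspFunctor_map, entry_suspFunctor_map, GSeq.entry_regroup h]

/-- `Σ X → θ_q ^ N Σ⁻¹ X`, the identity on entries. -/
def regroupHom (hN : 2 ≤ N) (hq : IsPrimitiveNthRoot N q) (X : NDGModule.{u, v, w, w'} 𝒜) :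
    (sigma 𝒜 hN hq).obj X ⟶
      (shiftFunctor 𝒜 N 1 (one_mul_zpow_card hq)).obj ((sigmaInv 𝒜 hN hq).obj X) where
  app A m := (X.obj A).regroup N 0 (-N) m (m + N)
  comm_d A m m' h x :=
    (regroup_d (V := (X.obj A).toGSeq) (c := 0) (c' := -N) (n := m + N) (n' := m' + N) h (by omega)
      (by ring) x).trans (one_smul k _).symm
  comm_act {A B} m n l h x a := by
    have key := regroup_suspAct hq X (A := A) (B := B) (c := 0) (c' := -N) (by ring) m n l (m + N) (l + N) h rfl
      (by omega) x a
    exact key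

lemma nonempty_sigma_iso_sigmaInv_comp_shift (hN : 2 ≤ N) (hq : IsPrimitiveNthRoot N q) :
    Nonempty (sigma.{u, v, w, w'} 𝒜 hN hq ≅
      sigmaInv 𝒜 hN hq ⋙ shiftFunctor 𝒜 N 1 (one_mul_zpow_card hq)) :=
  nonempty_iso_of_bijective
    { app := regroupHom hN hq
      naturality := fun X Y f => hom_ext fun A m x => by
        exact regroup_map hN hq (c' := -N) (zpow_zero q) (zpow_neg_card hq) f A (m' := m + N)
          (by ring) x }
    fun X A m => GSeq.regroup_bijective (by ring)

/-- `Σ X → Σ⁻¹ θ_q ^ N X`, the identity on entries. -/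
def regroupShiftHom (hN : 2 ≤ N) (hq : IsPrimitiveNthRoot N q) (X : NDGModule.{u, v, w, w'} 𝒜) :
    (sigma 𝒜 hN hq).obj X ⟶
      (sigmaInv 𝒜 hN hq).obj ((shiftFunctor 𝒜 N 1 (one_mul_zpow_card hq)).obj X) where
  app A m := (X.obj A).regroupShift N 0 (-N) N m m
  comm_d A m m' h x :=
    regroupShift_d (V := (X.obj A).toGSeq) (c := 0) (c' := -N) (e := N) h h (by ring) x
  comm_act m n l h x a :=
    regroupShift_suspAct hq X (c := 0) (c' := -N) (by ring) m n l h x a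

lemma nonempty_sigma_iso_shift_comp_sigmaInv (hN : 2 ≤ N) (hq : IsPrimitiveNthRoot N q) :
    Nonempty (sigma.{u, v, w, w'} 𝒜 hN hq ≅
      shiftFunctor 𝒜 N 1 (one_mul_zpow_card hq) ⋙ sigmaInv 𝒜 hN hq) :=
  nonempty_iso_of_bijective
    { app := regroupShiftHom hN hq
      naturality := fun X Y f => hom_ext fun A m x => by
        refine GSeq.entry_ext (V := (Y.obj A).toGSeq.shiftBy N 1) (c := -N) (m := m) _ _
          fun j _ _ => ?_
        refine (GSeq.entry_regroupShift (c := 0) (c' := -N) (by ring) _ _).trans ?_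
        refine (entry_suspFunctor_map hN hq _ f A m (j + N) x).trans ?_
        refine Eq.trans ?_ (entry_suspFunctor_map hN hq (zpow_neg_card hq)
          ((shiftFunctor 𝒜 N 1 (one_mul_zpow_card hq)).map f) A m j _).symm
        exact congrArg (Hom.app f A (j + N))
          (GSeq.entry_regroupShift (c := 0) (c' := -N) (by ring) _ _).symm }
    fun X A m => GSeq.regroupShift_bijective (by ring)

end NDGModule

/-! ### The formula for `d ^ (N - 1)` on homogeneous morphisms of degree `1 - N` -/

/-- The coefficient of `d ^ (n - l) F d ^ l` in `d ^ n (F)`, for `F` of degree `r` with `q ^ r = q`. -/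
def homCoeff (q : k) (n l : ℕ) : k := (-1) ^ l * q ^ (l + 1).choose 2 * qBinom q n l

lemma homCoeff_zero_right (q : k) (n : ℕ) : homCoeff q n 0 = 1 := by simp [homCoeff]

lemma homCoeff_succ_succ (q : k) {n l : ℕ} (h : l ≤ n) :
    homCoeff q (n + 1) (l + 1) = homCoeff q n (l + 1) - q ^ (n + 1) * homCoeff q n l := by
  obtain ⟨b, rfl⟩ := Nat.exists_eq_add_of_le h
  have e : (l + 1 + 1).choose 2 = (l + 1).choose 2 + (l + 1) := by
    rw [Nat.choose_succ_succ' (l + 1) 1, Nat.choose_one_right, add_comm]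
  simp only [homCoeff, qBinom_succ_succ' q (l + b) l h, e, Nat.add_sub_cancel_left]
  ring

/-- All coefficients of `d ^ (N - 1)` are `1`: they are equal since those of `d ^ N` other than the
extreme ones vanish. -/
lemma homCoeff_card_sub_one (hN : 2 ≤ N) (hq : IsPrimitiveNthRoot N q) (l : ℕ) (hl : l ≤ N - 1) :
    homCoeff (q : k) (N - 1) l = 1 := by
  induction l with
  | zero => exact homCoeff_zero_right _ _
  | succ l ih =>
    have h := homCoeff_succ_succ (q : k) (n := N - 1) (l := l) (by omega)
    rw [ih (by omega), show N - 1 + 1 = N by omega, homCoeff,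
      qBinom_top hN hq (l + 1) (by omega) hl, ← Units.val_pow_eq_pow_val q N, hq.pow_eq_one] at h
    simp only [mul_zero, Units.val_one, mul_one] at h
    exact (sub_eq_zero.1 h.symm)

namespace NDGModule

lemma homSeq_dpow_apply (X Y : NDGModule.{u, v, w, w'} 𝒜) {r : ℤ} (hr : q ^ r = q)
    (F : GrHom X Y r) (A : 𝒜.Obj) (n : ℕ) : ∀ (s : ℤ) (h : r + n = s) (i j : ℤ) (_ : i + s = j)
    (x : (X.obj A).X i), ((homSeq X Y).dpow n r s h F : GrHom X Y s).1 A i j x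
      = ∑ l ∈ Finset.range (n + 1), homCoeff (q : k) n l •
          (Y.obj A).D (i + l + r) j (F.1 A (i + l) (i + l + r) ((X.obj A).D i (i + l) x)) := by
  induction n with
  | zero =>
    intro s h i j hj x
    obtain rfl : r = s := by simpa using h
    rw [Finset.sum_range_one, homCoeff_zero_right, one_smul]
    have : ∀ a, a = i → (Y.obj A).D (a + r) j (F.1 A a (a + r) ((X.obj A).D i a x)) = F.1 A i j x := by
      rintro _ rfl
      subst hj
      simp
    exact (this _ (by simp)).symm
  | succ n ih =>
    intro s h i j hj x
    push_cast at h
    have e : ((homSeq X Y).dpow (n + 1) r s (by push_cast; omega) F : GrHom X Y s)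
        = dHom X Y (r + n) s (by omega) ((homSeq X Y).dpow n r (r + n) rfl F) :=
      (homSeq X Y).dpow_succ n r (r + n) s rfl (by omega) F (by push_cast; omega)
    rw [e]
    change (Y.obj A).d (j - 1) j (by omega)
        (((homSeq X Y).dpow n r (r + n) rfl F : GrHom X Y (r + n)).1 A i (j - 1) x)
      - ((q ^ (r + n) : kˣ) : k) •
        ((homSeq X Y).dpow n r (r + n) rfl F : GrHom X Y (r + n)).1 A (i + 1) j
          ((X.obj A).d i (i + 1) rfl x) = _
    rw [ih _ rfl i (j - 1) (by omega), ih _ rfl (i + 1) j (by omega), map_sum, Finset.smul_sum,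
      sub_eq_add_neg, ← Finset.sum_neg_distrib, add_comm]
    have h1 : ∀ l ∈ Finset.range (n + 1), (Y.obj A).d (j - 1) j (by omega) (homCoeff (q : k) n l •
        (Y.obj A).D (i + l + r) (j - 1) (F.1 A (i + l) (i + l + r) ((X.obj A).D i (i + l) x)))
        = homCoeff (q : k) n l •
          (Y.obj A).D (i + l + r) j (F.1 A (i + l) (i + l + r) ((X.obj A).D i (i + l) x)) := by
      intro l hl
      have := Finset.mem_range.1 hl
      rw [map_smul, GSeq.d_D _ _ _ _ (by omega)]
    have h2 : ∀ l ∈ Finset.range (n + 1), -(((q ^ (r + n) : kˣ) : k) • homCoeff (q : k) n l •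
        (Y.obj A).D (i + 1 + l + r) j (F.1 A (i + 1 + l) (i + 1 + l + r)
          ((X.obj A).D (i + 1) (i + 1 + l) ((X.obj A).d i (i + 1) rfl x))))
        = (-((q : k) ^ (n + 1) * homCoeff (q : k) n l)) •
          (Y.obj A).D (i + (l + 1 : ℕ) + r) j (F.1 A (i + (l + 1 : ℕ)) (i + (l + 1 : ℕ) + r)
            ((X.obj A).D i (i + (l + 1 : ℕ)) x)) := by
      intro l _
      have key : ∀ a, a = i + 1 + l → (Y.obj A).D (i + 1 + l + r) j (F.1 A (i + 1 + l) (i + 1 + l + r)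
          ((X.obj A).D i (i + 1 + l) x))
          = (Y.obj A).D (a + r) j (F.1 A a (a + r) ((X.obj A).D i a x)) := by
        rintro _ rfl; rfl
      rw [GSeq.D_d _ _ _ _ _ (by omega), key (i + (l + 1 : ℕ)) (by push_cast; ring), smul_smul,
        neg_smul, zpow_add, hr, zpow_natCast, ← pow_succ', Units.val_pow_eq_pow_val]
    rw [Finset.sum_congr rfl h1, Finset.sum_congr rfl h2]
    refine sum_pascal (fun l : ℕ => (Y.obj A).D (i + l + r) j
      (F.1 A (i + l) (i + l + r) ((X.obj A).D i (i + l) x)))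
      (fun l => -((q : k) ^ (n + 1) * homCoeff (q : k) n l)) (fun l => homCoeff (q : k) n l)
      (fun l => homCoeff (q : k) (n + 1) l) n ?_ ?_ ?_
    · simp only [homCoeff_zero_right]
    · intro b hb
      rw [homCoeff_succ_succ _ hb]
      ring
    · rw [homCoeff, qBinom_eq_zero _ _ _ (by omega), mul_zero]

/-- The homotopy formula: `d ^ (N - 1) (S) = ∑ d ^ (N - 1 - l) S d ^ l` for `S` of degree `1 - N`. -/
lemma dHomTop_apply (hN : 2 ≤ N) (hq : IsPrimitiveNthRoot N q) (X Y : NDGModule.{u, v, w, w'} 𝒜)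
    (S : GrHom X Y (-((N - 1 : ℕ) : ℤ))) (A : 𝒜.Obj) (i : ℤ) (x : (X.obj A).X i) :
    (dHomTop X Y S).1 A i i x = ∑ l ∈ Finset.range N,
      (Y.obj A).D (i + l + -((N - 1 : ℕ) : ℤ)) i
        (S.1 A (i + l) (i + l + -((N - 1 : ℕ) : ℤ)) ((X.obj A).D i (i + l) x)) := by
  refine (homSeq_dpow_apply X Y ?_ S A (N - 1) 0 _ i i (by ring) x).trans ?_
  · have : -((N - 1 : ℕ) : ℤ) = 1 - N := by omega
    rw [this, zpow_sub, zpow_natCast, hq.pow_eq_one, zpow_one, inv_one, mul_one]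
  · rw [show N - 1 + 1 = N by omega]
    refine Finset.sum_congr rfl fun l hl => ?_
    have := Finset.mem_range.1 hl
    rw [homCoeff_card_sub_one hN hq l (by omega), one_smul]

end NDGModule

/-! ### Entries, generators and partial sums of `Σ V` -/

namespace NDGMod

variable (V : NDGMod.{u, w} k N)

/-- The entry of degree `i` of an element of `Σ V`, which is `0` for `i` out of range. -/
def ent (m i : ℤ) : (V.susp 0).X m →ₗ[k] V.X i := GSeq.entry (V := V.toGSeq) (N := N) (c := 0) i

/-- The new entry `- ∑ d ^ (m + N - j) x_j` of the differential, which has degree `i = m + N`. For other `i`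
it is `0`. -/
def top (m i : ℤ) : (V.susp 0).X m →ₗ[k] V.X i :=
  if i = m + N then - ∑ j ∈ Finset.Ioo m (m + N), V.D j i ∘ₗ V.ent m j else 0

variable {V}

lemma ent_eq_zero {m i : ℤ} (h : ¬ (m < i ∧ i < m + N)) (x : (V.susp 0).X m) : V.ent m i x = 0 :=
  GSeq.entry_eq_zero x i (by rwa [Finset.mem_Ioo, add_zero])

lemma ent_mk {m i : ℤ} (h1 : m < i) (h2 : i < m + N)
    (x : ∀ i : Finset.Ioo (m + 0) (m + 0 + N), V.X i) :
    V.ent m i x = x ⟨i, by rw [Finset.mem_Ioo]; omega⟩ :=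
  GSeq.entry_mk x i _

lemma ent_ext {m : ℤ} {x y : (V.susp 0).X m}
    (h : ∀ i, m < i → i < m + N → V.ent m i x = V.ent m i y) : x = y :=
  GSeq.entry_ext (V := V.toGSeq) x y fun i h1 h2 => h i (by omega) (by omega)

lemma top_apply (m i : ℤ) (x : (V.susp 0).X m) : V.top m i x =
    if i = m + N then - ∑ j ∈ Finset.Ioo m (m + N), V.D j i (V.ent m j x) else 0 := by
  rw [top]
  split_ifs <;> simp

lemma suspTop_eq_top {m : ℤ} (x : (V.toGSeq.susp N 0).X m) (i : ℤ) :
    GSeq.suspTop x i = V.top m i x := by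
  refine Eq.trans ?_ (top_apply m i _).symm
  rw [GSeq.suspTop_apply, add_zero]
  rfl

lemma top_self (m : ℤ) (x : (V.susp 0).X m) :
    V.top m (m + N) x = - ∑ j ∈ Finset.Ioo m (m + N), V.D j (m + N) (V.ent m j x) := by
  simp [top]

lemma top_of_ne {m i : ℤ} (h : i ≠ m + N) (x : (V.susp 0).X m) : V.top m i x = 0 := by
  simp [top, h]

lemma ent_d {m m' : ℤ} (h : m + 1 = m') (x : (V.susp 0).X m) {j : ℤ} (h1 : m' < j)
    (h2 : j < m' + N) : V.ent m' j ((V.susp 0).d m m' h x) = V.ent m j x + V.top m j x :=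
  (GSeq.entry_d (V := V.toGSeq) (c := 0) h x j (by omega) (by omega)).trans
    (congrArg _ (suspTop_eq_top (V := V) x j))

/-- The powers of the differential of `Σ V` up to the `N`-th shift the entries, with one new entry. -/
lemma ent_D {m m' : ℤ} (h : m ≤ m') (h' : m' ≤ m + N) (x : (V.susp 0).X m) {j : ℤ} (h1 : m' < j)
    (h2 : j < m' + N) : V.ent m' j ((V.susp 0).D m m' x) = V.ent m j x + V.top m j x := by
  rw [(V.susp 0).D_eq_dpow (m' - m).toNat m m' (by omega)]
  exact (V.susp_dpow 0 m x (m' - m).toNat (by omega) m' (by omega) j (by omega) (by omega)).trans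
    (congrArg _ (suspTop_eq_top (V := V) x j))

/-- An entry of `x` that is still in range after applying a power of the differential is unchanged. -/
lemma ent_D_of_lt {m m' : ℤ} (h : m ≤ m') (x : (V.susp 0).X m) {j : ℤ} (h1 : m' < j)
    (h2 : j < m + N) : V.ent m' j ((V.susp 0).D m m' x) = V.ent m j x := by
  rw [ent_D h (by omega) x h1 (by omega), top_of_ne (by omega), add_zero]

variable (V)

/-- The element of `(Σ V) m` with the entry `v` in degree `i`, and all other entries `0`. It is `0` if `i`
is out of range. -/
def single (m i : ℤ) : V.X i →ₗ[k] (V.susp 0).X m :=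
  LinearMap.pi fun j : Finset.Ioo (m + 0) (m + 0 + N) => if (j : ℤ) = i then V.D i j else 0

variable {V}

lemma ent_single_self {m i : ℤ} (h1 : m < i) (h2 : i < m + N) (v : V.X i) :
    V.ent m i (V.single m i v) = v := by
  refine (ent_mk h1 h2 _).trans ?_
  change (if i = i then V.D i i else 0) v = v
  rw [if_pos rfl, GSeq.D_self]

lemma ent_single_of_ne {m i j : ℤ} (h : j ≠ i) (v : V.X i) : V.ent m j (V.single m i v) = 0 := by
  by_cases hj : m < j ∧ j < m + N
  · refine (ent_mk hj.1 hj.2 _).trans ?_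
    change (if j = i then V.D i j else 0) v = 0
    rw [if_neg h, LinearMap.zero_apply]
  · exact ent_eq_zero hj _

lemma top_single {m i j : ℤ} (h1 : m < i) (h2 : i < m + N) (hj : j = m + N) (v : V.X i) :
    V.top m j (V.single m i v) = - V.D i j v := by
  subst hj
  rw [top_self, Finset.sum_eq_single_of_mem i (Finset.mem_Ioo.2 ⟨h1, h2⟩), ent_single_self h1 h2]
  intro j _ hj
  rw [ent_single_of_ne hj, map_zero]

/-- `Σ V` is spanned by the elements `d ^ r (x)` for `x` with only a last entry. -/
lemma susp_induction (P : ∀ m, (V.susp 0).X m → Prop) (zero : ∀ m, P m 0)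
    (add : ∀ m x y, P m x → P m y → P m (x + y))
    (d : ∀ m m' h x, P m x → P m' ((V.susp 0).d m m' h x))
    (single : ∀ (m i : ℤ) (_ : i + 1 = m + N) v, P m (V.single m i v)) (m : ℤ) (x : (V.susp 0).X m) :
    P m x := by
  have hD : ∀ (n : ℕ) (m m' : ℤ) (_ : m + n = m') x, P m x → P m' ((V.susp 0).D m m' x) := by
    intro n
    induction n with
    | zero =>
      rintro m m' h x hx
      obtain rfl : m = m' := by simpa using h
      rwa [GSeq.D_self]
    | succ n ih =>
      intro m m' h x hx
      push_cast at h
      rw [← GSeq.d_D _ m (m + n) m' (by omega) (by omega)]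
      exact d _ _ _ _ (ih _ _ rfl _ hx)
  suffices h : ∀ (n : ℕ) (x : (V.susp 0).X m), (∀ i, i + n < m + N → V.ent m i x = 0) → P m x from
    h N x fun i hi => ent_eq_zero (by omega) x
  intro n
  induction n with
  | zero =>
    intro x hx
    have : x = 0 := ent_ext fun i _ h2 => by rw [hx i (by simpa using h2), map_zero]
    rw [this]
    exact zero m
  | succ n ih =>
    intro x hx
    by_cases hn : n + 1 < N
    -- Subtract `d ^ n` of an element with only a last entry, to remove the lowest entry of `x`.
    · let y := (V.susp 0).D (m - n) m (V.single (m - n) (m + N - 1 - n) (V.ent m (m + N - 1 - n) x))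
      rw [← sub_add_cancel x y]
      refine add m _ _ (ih _ fun i hi => ?_) (hD n _ _ (by ring) _ (single _ _ (by ring) _))
      by_cases hi' : m < i ∧ i < m + N
      · have e := ent_D (V := V) (m := m - n) (m' := m) (by omega) (by omega)
          (V.single (m - n) (m + N - 1 - n) (V.ent m (m + N - 1 - n) x)) hi'.1 hi'.2
        rw [map_sub, e, top_of_ne (by omega), add_zero]
        by_cases hi2 : i = m + N - 1 - n
        · subst hi2
          rw [ent_single_self (by omega) (by omega), sub_self]
        · rw [ent_single_of_ne hi2, sub_zero]
          exact hx i (by push_cast; omega)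
      · exact ent_eq_zero hi' _
    · exact ih x fun i hi => ent_eq_zero (by omega) x

variable (V)

/-- The partial sum `∑ d ^ (s - p) (x_p)` over `p ≤ s`. For `s < m + N` these are the entries of the lift
of `x` along the projection `(z_m, …, z_{m + N - 1}) ↦ (z_p - d (z_{p - 1}))` onto `Σ V` with `z_m = 0`;
for `s = m + N` the sum is completed to `0` by the last entry of the differential. -/
def cum (m s : ℤ) : (V.susp 0).X m →ₗ[k] V.X s :=
  ∑ p ∈ Finset.Ioo m (m + N), V.D p s ∘ₗ V.ent m p + V.top m s

variable {V}

lemma cum_apply (m s : ℤ) (x : (V.susp 0).X m) :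
    V.cum m s x = ∑ p ∈ Finset.Ioo m (m + N), V.D p s (V.ent m p x) + V.top m s x := by
  simp [cum]

lemma cum_top (m : ℤ) (x : (V.susp 0).X m) : V.cum m (m + N) x = 0 := by
  rw [cum_apply, top_self, add_neg_cancel]

/-- Applying the differential replaces the lift of `x` by the shifted lift, corrected by the image of the
first entry so that its component of degree `m + 1` is again `0`. -/
lemma cum_d (hN : 2 ≤ N) {m m' s : ℤ} (h : m + 1 = m') (hs : s ≤ m + N) (x : (V.susp 0).X m) :
    V.cum m' s ((V.susp 0).d m m' h x) = V.cum m s x - V.D m' s (V.ent m m' x) := by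
  rw [cum_apply, cum_apply, top_of_ne (by omega), add_zero]
  have h1 : ∀ p ∈ Finset.Ioo m' (m' + N), V.D p s (V.ent m' p ((V.susp 0).d m m' h x))
      = V.D p s (V.ent m p x) + V.D p s (V.top m p x) := by
    intro p hp
    rw [Finset.mem_Ioo] at hp
    rw [ent_d h x hp.1 hp.2, map_add]
  rw [Finset.sum_congr rfl h1, Finset.sum_add_distrib,
    Finset.sum_eq_single_of_mem (f := fun p => V.D p s (V.top m p x)) (m + N)
      (by rw [Finset.mem_Ioo]; omega)
      (fun p _ hp => by rw [top_of_ne hp, map_zero])]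
  have h2 : V.D (m + N) s (V.top m (m + N) x) = V.top m s x := by
    rcases eq_or_lt_of_le hs with rfl | hs
    · rw [GSeq.D_self]
    · rw [GSeq.D_eq_zero _ _ _ hs, top_of_ne hs.ne]
      rfl
  have h3 : ∑ p ∈ Finset.Ioo m' (m' + N), V.D p s (V.ent m p x)
      = ∑ p ∈ Finset.Ioo m' (m + N), V.D p s (V.ent m p x) := by
    refine (Finset.sum_subset (fun p hp => ?_) fun p hp hp' => ?_).symm
    · simp only [Finset.mem_Ioo] at *
      omega
    · simp only [Finset.mem_Ioo] at *
      rw [ent_eq_zero (by omega), map_zero]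
  have h4 : Finset.Ioo m (m + N) = insert m' (Finset.Ioo m' (m + N)) := by
    ext p
    simp only [Finset.mem_insert, Finset.mem_Ioo]
    omega
  rw [h2, h3, h4, Finset.sum_insert (by simp)]
  abel

end NDGMod

namespace NDGModule

/-! ### Homogeneous `𝒜`-linear maps out of and into `Σ X` -/

variable (X : NDGModule.{u, v, w, w'} 𝒜)

/-- The scalar multiplication of `Σ X`. -/
def sigmaAct {A B : 𝒜.Obj} (m n l : ℤ) (h : m + n = l) :
    ((X.obj A).susp 0).X m →ₗ[k] (𝒜.hom B A).X n →ₗ[k] ((X.obj B).susp 0).X l :=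
  X.suspAct 0 m n l h

variable {X}

lemma ent_sigmaAct {A B : 𝒜.Obj} {m n l : ℤ} (h : m + n = l) (x : ((X.obj A).susp 0).X m)
    (a : (𝒜.hom B A).X n) {j : ℤ} (h1 : l < j) (h2 : j < l + N) :
    (X.obj B).ent l j (X.sigmaAct m n l h x a) = ∑ i ∈ Finset.Ioo m (m + N),
      (qBinom (q : k) (j - l - 1 : ℤ).toNat (i - m - 1 : ℤ).toNat
          * ((q ^ (m * (j - n - i)) : kˣ) : k)) •
        X.act i (j - i) j (by omega) ((X.obj A).ent m i x) ((𝒜.hom B A).D n (j - i) a) := by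
  refine (entry_suspAct m n l h x a j (by omega) (by omega)).trans ?_
  simp only [add_zero]
  rfl

lemma sigma_leibniz (hN : 2 ≤ N) (hq : IsPrimitiveNthRoot N q) {A B : 𝒜.Obj} {i i' j j' l l' : ℤ}
    (h : i + j = l) (hi : i + 1 = i') (hj : j + 1 = j') (hl : l + 1 = l')
    (x : ((X.obj A).susp 0).X i) (f : (𝒜.hom B A).X j) :
    ((X.obj B).susp 0).d l l' hl (X.sigmaAct i j l h x f)
      = X.sigmaAct i' j l' (by omega) (((X.obj A).susp 0).d i i' hi x) f
        + ((q ^ i : kˣ) : k) • X.sigmaAct i j' l' (by omega) x ((𝒜.hom B A).d j j' hj f) :=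
  suspAct_leibniz hN hq (zpow_zero q) i i' j j' l l' h hi hj hl x f

/-- The first entry `Σ X → X` is `𝒜`-linear. -/
lemma ent_first_sigmaAct (hN : 2 ≤ N) {A B : 𝒜.Obj} {m m' n l l' : ℤ} (h : m + n = l)
    (hm : m + 1 = m') (hl : l + 1 = l') (x : ((X.obj A).susp 0).X m) (a : (𝒜.hom B A).X n) :
    (X.obj B).ent l l' (X.sigmaAct m n l h x a)
      = X.act m' n l' (by omega) ((X.obj A).ent m m' x) a := by
  rw [ent_sigmaAct h x a (by omega) (by omega),
    Finset.sum_eq_single_of_mem m' (Finset.mem_Ioo.2 ⟨by omega, by omega⟩)]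
  · have e1 : (l' - l - 1 : ℤ).toNat = 0 := by omega
    have e2 : (m' - m - 1 : ℤ).toNat = 0 := by omega
    have e3 : l' - n - m' = 0 := by omega
    rw [e1, e2, e3]
    have : ∀ j (hj : m' + j = l'), X.act m' j l' hj ((X.obj A).ent m m' x) ((𝒜.hom B A).D n j a)
        = X.act m' n l' (by omega) ((X.obj A).ent m m' x) a := by
      intro j hj
      obtain rfl : j = n := by omega
      rw [GSeq.D_self]
    rw [this]
    simp
  · intro i hi hne
    rw [Finset.mem_Ioo] at hi
    rw [qBinom_eq_zero _ _ _ (by omega)]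
    simp

/-- The inclusion `X → Σ X` of the last entry is `𝒜`-linear. -/
lemma single_sigmaAct (hN : 2 ≤ N) {A B : 𝒜.Obj} {m n l i j : ℤ} (h : m + n = l)
    (hi : i + 1 = m + N) (hj : i + n = j) (v : (X.obj A).X i) (a : (𝒜.hom B A).X n) :
    X.sigmaAct m n l h ((X.obj A).single m i v) a = (X.obj B).single l j (X.act i n j hj v a) := by
  refine NDGMod.ent_ext fun p h1 h2 => ?_
  rw [ent_sigmaAct h _ a h1 h2,
    Finset.sum_eq_single_of_mem i (Finset.mem_Ioo.2 ⟨by omega, by omega⟩)]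
  · rw [NDGMod.ent_single_self (by omega) (by omega)]
    by_cases hp : p = j
    · subst hp
      rw [NDGMod.ent_single_self (by omega) (by omega)]
      have e1 : (p - l - 1 : ℤ).toNat = (i - m - 1 : ℤ).toNat := by omega
      have e3 : p - n - i = 0 := by omega
      rw [e1, e3, qBinom_self]
      have : ∀ j (hj : i + j = p), X.act i j p hj v ((𝒜.hom B A).D n j a)
          = X.act i n p (by omega) v a := by
        intro j hj
        obtain rfl : j = n := by omega
        rw [GSeq.D_self]
      rw [this]
      simp
    · rw [NDGMod.ent_single_of_ne hp, GSeq.D_eq_zero _ _ _ (by omega)]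
      simp
  · intro i' _ hne
    rw [NDGMod.ent_single_of_ne hne]
    simp

/-- A homogeneous map `h : Σ X → Y` of degree `0` is `𝒜`-linear if `h d - d h` is `𝒜`-linear and the
restriction of `h` to the elements with only a last entry is `𝒜`-linear: the elements `x` such that
`h (x a) = h (x) a` for all `a` are stable under `d`, by the Leibniz rules. -/
lemma act_linear_of_single (hN : 2 ≤ N) (hq : IsPrimitiveNthRoot N q)
    {Y : NDGModule.{u, v, w, w'} 𝒜}
    (h : ∀ (A : 𝒜.Obj) (i : ℤ), ((X.obj A).susp 0).X i →ₗ[k] (Y.obj A).X i)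
    (hd : ∀ (A B : 𝒜.Obj) (m m' n l l' : ℤ) (hl : m + n = l) (hm : m + 1 = m') (hl' : l + 1 = l')
      (x : ((X.obj A).susp 0).X m) (a : (𝒜.hom B A).X n),
      h B l' (((X.obj B).susp 0).d l l' hl' (X.sigmaAct m n l hl x a))
          - (Y.obj B).d l l' hl' (h B l (X.sigmaAct m n l hl x a))
        = Y.act m' n l' (by omega) (h A m' (((X.obj A).susp 0).d m m' hm x)
          - (Y.obj A).d m m' hm (h A m x)) a)
    (hs : ∀ (A B : 𝒜.Obj) (m n l i j : ℤ) (hl : m + n = l) (_ : i + 1 = m + N) (hj : i + n = j)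
      (v : (X.obj A).X i) (a : (𝒜.hom B A).X n),
      h B l ((X.obj B).single l j (X.act i n j hj v a))
        = Y.act m n l hl (h A m ((X.obj A).single m i v)) a)
    {A B : 𝒜.Obj} (m n l : ℤ) (hl : m + n = l) (x : ((X.obj A).susp 0).X m)
    (a : (𝒜.hom B A).X n) :
    h B l (X.sigmaAct m n l hl x a) = Y.act m n l hl (h A m x) a := by
  revert n l
  refine NDGMod.susp_induction (V := X.obj A)
    (fun m x => ∀ (n l : ℤ) (hl : m + n = l) (a : (𝒜.hom B A).X n),
      h B l (X.sigmaAct m n l hl x a) = Y.act m n l hl (h A m x) a) ?_ ?_ ?_ ?_ m x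
  · intro m n l hl a
    simp
  · intro m x y hx hy n l hl a
    simp [hx n l hl a, hy n l hl a]
  · intro m m' hm x hx n l' hl' a
    have e := hd A B m m' n (m + n) l' rfl hm (by omega) x a
    rw [sigma_leibniz hN hq rfl hm rfl, map_add, map_smul, hx, hx,
      Y.leibniz m m' n (n + 1) (m + n) l' rfl hm rfl (by omega), map_sub,
      LinearMap.sub_apply, add_sub_add_right_eq_sub] at e
    exact sub_left_injective e
  · intro m i hi v n l hl a
    rw [single_sigmaAct hN hl hi rfl, hs A B m n l i (i + n) hl hi rfl]

/-- A map `b : Z → Σ Y` commuting with the differentials is `𝒜`-linear if its first entry is: the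
entries of `b` are the first entries of the maps `d ^ r b`. -/
lemma act_linear_of_first (hN : 2 ≤ N) (hq : IsPrimitiveNthRoot N q) {Z : NDGModule.{u, v, w, w'} 𝒜}
    (b : ∀ (A : 𝒜.Obj) (i : ℤ), (Z.obj A).X i →ₗ[k] ((X.obj A).susp 0).X i)
    (hd : ∀ (A : 𝒜.Obj) (i j : ℤ) (hij : i + 1 = j) (z : (Z.obj A).X i),
      b A j ((Z.obj A).d i j hij z) = ((X.obj A).susp 0).d i j hij (b A i z))
    (hf : ∀ (A B : 𝒜.Obj) (m m' n l l' : ℤ) (hl : m + n = l) (_ : m + 1 = m') (_ : l + 1 = l')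
      (z : (Z.obj A).X m) (a : (𝒜.hom B A).X n),
      (X.obj B).ent l l' (b B l (Z.act m n l hl z a))
        = X.act m' n l' (by omega) ((X.obj A).ent m m' (b A m z)) a)
    {A B : 𝒜.Obj} (m n l : ℤ) (hl : m + n = l) (z : (Z.obj A).X m) (a : (𝒜.hom B A).X n) :
    b B l (Z.act m n l hl z a) = X.sigmaAct m n l hl (b A m z) a := by
  have key : ∀ (t : ℕ) (m n l : ℤ) (hl : m + n = l) (z : (Z.obj A).X m) (a : (𝒜.hom B A).X n)
      (j : ℤ) (_ : j = l + 1 + t) (_ : j < l + N),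
      (X.obj B).ent l j (b B l (Z.act m n l hl z a))
        = (X.obj B).ent l j (X.sigmaAct m n l hl (b A m z) a) := by
    intro t
    induction t with
    | zero =>
      intro m n l hl z a j hj _
      rw [hf A B m (m + 1) n l j hl rfl (by simp [hj]),
        ent_first_sigmaAct hN hl rfl (by simp [hj])]
    | succ t ih =>
      intro m n l hl z a j hj hjN
      push_cast at hj
      have e1 := NDGMod.ent_d (V := X.obj B) rfl (b B l (Z.act m n l hl z a))
        (j := j) (by omega) (by omega)
      have e2 := NDGMod.ent_d (V := X.obj B) rfl (X.sigmaAct m n l hl (b A m z) a)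
        (j := j) (by omega) (by omega)
      rw [NDGMod.top_of_ne (by omega), add_zero] at e1 e2
      rw [← e1, ← e2, ← hd, Z.leibniz m (m + 1) n (n + 1) l (l + 1) hl rfl rfl rfl,
        sigma_leibniz hN hq hl rfl rfl rfl, ← hd, map_add, map_smul, map_add, map_smul, map_add,
        map_smul, ih _ _ _ _ _ _ _ (by omega) (by omega), ih _ _ _ _ _ _ _ (by omega) (by omega)]
  refine NDGMod.ent_ext fun j h1 h2 => ?_
  exact key (j - (l + 1)).toNat m n l hl z a j (by omega) h2

/-! ### A criterion for homotopy of morphisms into `Σ Y` -/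

/-- The components of the homogeneous map `X → Σ Y` of degree `1 - N` with only a last entry, given by a
map `X → Y` of degree `0`. -/
def singleMap {Y : NDGModule.{u, v, w, w'} 𝒜}
    (h : ∀ (A : 𝒜.Obj) (i : ℤ), (X.obj A).X i →ₗ[k] (Y.obj A).X i) (A : 𝒜.Obj) (i j : ℤ) :
    (X.obj A).X i →ₗ[k] ((Y.obj A).susp 0).X j :=
  if i + -((N - 1 : ℕ) : ℤ) = j then (Y.obj A).single j i ∘ₗ h A i else 0

lemma singleMap_apply {Y : NDGModule.{u, v, w, w'} 𝒜}
    (h : ∀ (A : 𝒜.Obj) (i : ℤ), (X.obj A).X i →ₗ[k] (Y.obj A).X i) (A : 𝒜.Obj) {i j : ℤ}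
    (hij : i + -((N - 1 : ℕ) : ℤ) = j) (x : (X.obj A).X i) :
    singleMap h A i j x = (Y.obj A).single j i (h A i x) := by
  rw [singleMap, if_pos hij, LinearMap.comp_apply]

/-- The maps `singleMap` as an element of `Hom_𝒜 (1 - N) (X, Σ Y)`. -/
def singleGrHom (hN : 2 ≤ N) (hq : IsPrimitiveNthRoot N q) {Y : NDGModule.{u, v, w, w'} 𝒜}
    (h : ∀ (A : 𝒜.Obj) (i : ℤ), (X.obj A).X i →ₗ[k] (Y.obj A).X i)
    (hact : ∀ (A B : 𝒜.Obj) (m n l : ℤ) (hl : m + n = l) (x : (X.obj A).X m) (a : (𝒜.hom B A).X n),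
      h B l (X.act m n l hl x a) = Y.act m n l hl (h A m x) a) :
    GrHom X ((sigma 𝒜 hN hq).obj Y) (-((N - 1 : ℕ) : ℤ)) :=
  ⟨singleMap h, fun A i j hij => if_neg hij, fun A B i j l i' l' hl hl' hi x f => by
    have key : singleMap h B l l' (X.act i j l hl x f)
        = Y.sigmaAct i' j l' hl' (singleMap h A i i' x) f := by
      rw [singleMap_apply h B (by omega), singleMap_apply h A hi, hact,
        single_sigmaAct hN hl' (by omega) hl]
    exact key⟩

/-- Two morphisms `f, g : X ⟶ Σ Y` are homotopic if the first entry of `f - g` is `h d - d h` for an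
`𝒜`-linear map `h : X → Y` of degree `0`. -/
lemma homotopic_of_first (hN : 2 ≤ N) (hq : IsPrimitiveNthRoot N q)
    {Y : NDGModule.{u, v, w, w'} 𝒜} (f g : X ⟶ (sigma 𝒜 hN hq).obj Y)
    (h : ∀ (A : 𝒜.Obj) (i : ℤ), (X.obj A).X i →ₗ[k] (Y.obj A).X i)
    (hact : ∀ (A B : 𝒜.Obj) (m n l : ℤ) (hl : m + n = l) (x : (X.obj A).X m) (a : (𝒜.hom B A).X n),
      h B l (X.act m n l hl x a) = Y.act m n l hl (h A m x) a)
    (hd : ∀ (A : 𝒜.Obj) (i j : ℤ) (hij : i + 1 = j) (x : (X.obj A).X i),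
      h A j ((X.obj A).d i j hij x) - (Y.obj A).d i j hij (h A i x)
        = (Y.obj A).ent i j (Hom.app f A i x) - (Y.obj A).ent i j (Hom.app g A i x)) :
    Homotopic 𝒜 f g := by
  refine ⟨singleGrHom hN hq h hact, fun A i x => ?_⟩
  rw [dHomTop_apply hN hq]
  refine NDGMod.ent_ext (V := Y.obj A) fun p h1 h2 => ?_
  have ef : ∀ f : X ⟶ (sigma 𝒜 hN hq).obj Y,
      (Y.obj A).ent (p - 1) p (Hom.app f A (p - 1) ((X.obj A).D i (p - 1) x))
        = (Y.obj A).ent i p (Hom.app f A i x) := fun f => by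
    rw [GSeq.map_D (Hom.app f A) (f.comm_d A)]
    exact NDGMod.ent_D_of_lt (V := Y.obj A) (by omega) _ (by omega) (by omega)
  have e := hd A (p - 1) p (by omega) ((X.obj A).D i (p - 1) x)
  rw [ef, ef, GSeq.d_D _ _ _ _ (by omega)] at e
  refine ((map_sub ((Y.obj A).ent i p) _ _).trans e.symm).trans ?_
  refine Eq.trans ?_ (map_sum ((Y.obj A).ent i p) _ _).symm
  have hl : ∀ l ∈ Finset.range N, (Y.obj A).ent i p (((Y.obj A).susp 0).D
      (i + l + -((N - 1 : ℕ) : ℤ)) i ((singleGrHom hN hq h hact).1 A (i + l)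
        (i + l + -((N - 1 : ℕ) : ℤ)) ((X.obj A).D i (i + l) x)))
      = (if (l : ℤ) = p - i then h A p ((X.obj A).D i p x) else 0)
        + if (l : ℤ) = p - i - 1 then
          -(Y.obj A).d (p - 1) p (by omega) (h A (p - 1) ((X.obj A).D i (p - 1) x)) else 0 := by
    intro l hl
    have hl' := Finset.mem_range.1 hl
    have e1 : (singleGrHom hN hq h hact).1 A (i + l)
        (i + l + -((N - 1 : ℕ) : ℤ)) ((X.obj A).D i (i + l) x)
        = (Y.obj A).single (i + l + -((N - 1 : ℕ) : ℤ)) (i + l)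
          (h A (i + l) ((X.obj A).D i (i + l) x)) := singleMap_apply h A rfl _
    rw [e1, NDGMod.ent_D (by omega) (by omega) _ h1 h2]
    congr 1
    · split_ifs with hp
      · obtain rfl : p = i + l := by omega
        rw [NDGMod.ent_single_self (by omega) (by omega)]
      · rw [NDGMod.ent_single_of_ne (by omega)]
    · split_ifs with hp
      · rw [NDGMod.top_single (by omega) (by omega) (by omega)]
        have : ∀ r (hr : r + 1 = p), r = i + l → -(Y.obj A).D (i + l) p
            (h A (i + l) ((X.obj A).D i (i + l) x))
            = -(Y.obj A).d r p hr (h A r ((X.obj A).D i r x)) := by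
          rintro _ hr rfl
          rw [GSeq.D_succ]
        exact this _ _ (by omega)
      · rw [NDGMod.top_of_ne (by omega)]
  refine Eq.trans ?_ (Finset.sum_congr rfl hl).symm
  rw [Finset.sum_add_distrib, Finset.sum_eq_single_of_mem (p - i).toNat
    (Finset.mem_range.2 (by omega)) (fun l _ hl => if_neg (by omega)),
    Finset.sum_eq_single_of_mem (p - i - 1).toNat
    (Finset.mem_range.2 (by omega)) (fun l _ hl => if_neg (by omega)), if_pos (by omega),
    if_pos (by omega), sub_eq_add_neg]

end NDGModule

namespace NDGModule

variable {X Y Z : NDGModule.{u, v, w, w'} 𝒜}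

/-! ### Maps out of `Σ Y` given by homogeneous maps of degree `1 - N` -/

/-- The map `x ↦ ∑ d ^ (m + N - 1 - s) S (z_s)` on `Σ Y`, where the `z_s` are the partial sums of `x`. It is
the composition of the lift of `x` along the projection onto `Σ Y` with the map induced by `S` on the relatively
injective module of the families `(z_m, …, z_{m + N - 1})`. -/
def psi (S : GrHom Y Z (-((N - 1 : ℕ) : ℤ))) (A : 𝒜.Obj) (m : ℤ) :
    ((Y.obj A).susp 0).X m →ₗ[k] (Z.obj A).X m :=
  ∑ s ∈ Finset.Ioo m (m + N), (Z.obj A).D (s + -((N - 1 : ℕ) : ℤ)) m ∘ₗ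
    S.1 A s (s + -((N - 1 : ℕ) : ℤ)) ∘ₗ (Y.obj A).cum m s

lemma psi_apply (S : GrHom Y Z (-((N - 1 : ℕ) : ℤ))) (A : 𝒜.Obj) (m : ℤ)
    (x : ((Y.obj A).susp 0).X m) :
    psi S A m x = ∑ s ∈ Finset.Ioo m (m + N), (Z.obj A).D (s + -((N - 1 : ℕ) : ℤ)) m
      (S.1 A s (s + -((N - 1 : ℕ) : ℤ)) ((Y.obj A).cum m s x)) := by
  simp [psi]

/-- Comparison of two sums over shifted intervals, in the form in which it occurs for `psi S ∘ d` and
`d ∘ psi S`. -/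
lemma sum_Ioo_succ_sub {M : Type w} [AddCommGroup M] (hN : 2 ≤ N) (m m' : ℤ) (h : m + 1 = m')
    (T U : ℤ → M) (h0 : T (m + N) = 0) (h1 : T m' = U m') :
    ∑ s ∈ Finset.Ioo m' (m' + N), (T s - U s) - ∑ s ∈ Finset.Ioo m (m + N), T s
      = - ∑ l ∈ Finset.range N, U (m' + l) := by
  obtain ⟨n, rfl⟩ : ∃ n, N = n + 2 := ⟨N - 2, by omega⟩
  have e1 : ∀ s : ℕ, m' + ((s + 1 : ℕ) : ℤ) = m' + 1 + s := fun s => by push_cast; ring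
  have e3 : m' + 1 + (n : ℤ) = m + (n + 2 : ℕ) := by push_cast; omega
  rw [Finset.sum_sub_distrib, sum_Ioo _ _ hN, sum_Ioo _ _ hN, sum_Ioo _ _ hN,
    show n + 2 - 1 = n + 1 by omega, Finset.sum_range_succ' (fun l : ℕ => U (m' + l)) (n + 1),
    Finset.sum_range_succ (fun s : ℕ => T (m' + 1 + s)) n,
    Finset.sum_range_succ' (fun s : ℕ => T (m + 1 + s)) n]
  simp only [e1, e3, h0, Nat.cast_zero, add_zero, h, h1]
  abel

/-- The map `psi S` commutes with the differentials up to `d ^ (N - 1) (S)` applied to the first entry. -/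
lemma psi_d (hN : 2 ≤ N) (hq : IsPrimitiveNthRoot N q) (S : GrHom Y Z (-((N - 1 : ℕ) : ℤ)))
    (A : 𝒜.Obj) (m m' : ℤ) (h : m + 1 = m') (x : ((Y.obj A).susp 0).X m) :
    psi S A m' (((Y.obj A).susp 0).d m m' h x) - (Z.obj A).d m m' h (psi S A m x)
      = - (dHomTop Y Z S).1 A m' m' ((Y.obj A).ent m m' x) := by
  rw [dHomTop_apply hN hq, psi_apply, psi_apply, map_sum]
  have h1 : ∀ s ∈ Finset.Ioo m' (m' + N), (Z.obj A).D (s + -((N - 1 : ℕ) : ℤ)) m'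
      (S.1 A s (s + -((N - 1 : ℕ) : ℤ)) ((Y.obj A).cum m' s (((Y.obj A).susp 0).d m m' h x)))
      = (Z.obj A).D (s + -((N - 1 : ℕ) : ℤ)) m'
          (S.1 A s (s + -((N - 1 : ℕ) : ℤ)) ((Y.obj A).cum m s x))
        - (Z.obj A).D (s + -((N - 1 : ℕ) : ℤ)) m'
          (S.1 A s (s + -((N - 1 : ℕ) : ℤ)) ((Y.obj A).D m' s ((Y.obj A).ent m m' x))) := by
    intro s hs
    rw [Finset.mem_Ioo] at hs
    rw [NDGMod.cum_d hN h (by omega), map_sub, map_sub]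
  have h2 : ∀ s ∈ Finset.Ioo m (m + N), (Z.obj A).d m m' h ((Z.obj A).D (s + -((N - 1 : ℕ) : ℤ)) m
      (S.1 A s (s + -((N - 1 : ℕ) : ℤ)) ((Y.obj A).cum m s x)))
      = (Z.obj A).D (s + -((N - 1 : ℕ) : ℤ)) m'
          (S.1 A s (s + -((N - 1 : ℕ) : ℤ)) ((Y.obj A).cum m s x)) := by
    intro s hs
    rw [Finset.mem_Ioo] at hs
    rw [GSeq.d_D _ _ _ _ (by omega)]
  rw [Finset.sum_congr rfl h1, Finset.sum_congr rfl h2]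
  refine sum_Ioo_succ_sub hN m m' h
    (fun s => (Z.obj A).D (s + -((N - 1 : ℕ) : ℤ)) m'
      (S.1 A s (s + -((N - 1 : ℕ) : ℤ)) ((Y.obj A).cum m s x)))
    (fun s => (Z.obj A).D (s + -((N - 1 : ℕ) : ℤ)) m'
      (S.1 A s (s + -((N - 1 : ℕ) : ℤ)) ((Y.obj A).D m' s ((Y.obj A).ent m m' x)))) ?_ ?_
  · simp only [NDGMod.cum_top, map_zero]
  · have : (Y.obj A).cum m m' x = (Y.obj A).D m' m' ((Y.obj A).ent m m' x) := by
      rw [NDGMod.cum_apply, NDGMod.top_of_ne (by omega), add_zero]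
      refine Finset.sum_eq_single_of_mem m' (by rw [Finset.mem_Ioo]; omega) fun p hp hne => ?_
      rw [Finset.mem_Ioo] at hp
      rw [GSeq.D_eq_zero _ _ _ (by omega), LinearMap.zero_apply]
    simp only [this]

lemma psi_single (S : GrHom Y Z (-((N - 1 : ℕ) : ℤ))) (hN : 2 ≤ N) (A : 𝒜.Obj) (m i : ℤ)
    (h : i + 1 = m + N) (v : (Y.obj A).X i) :
    psi S A m ((Y.obj A).single m i v) = S.1 A i m v := by
  have hc : ∀ s, s < m + N →
      (Y.obj A).cum m s ((Y.obj A).single m i v) = (Y.obj A).D i s v := fun s hs => by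
    rw [NDGMod.cum_apply, NDGMod.top_of_ne hs.ne, add_zero,
      Finset.sum_eq_single_of_mem i (by rw [Finset.mem_Ioo]; omega),
      NDGMod.ent_single_self (by omega) (by omega)]
    intro p _ hp
    rw [NDGMod.ent_single_of_ne hp, map_zero]
  rw [psi_apply, Finset.sum_eq_single_of_mem i (by rw [Finset.mem_Ioo]; omega), hc i (by omega),
    GSeq.D_self]
  · have : ∀ j, j = m → (Z.obj A).D j m (S.1 A i j v) = S.1 A i m v := by
      rintro _ rfl
      rw [GSeq.D_self]
    exact this _ (by omega)
  · intro s hs hne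
    rw [Finset.mem_Ioo] at hs
    rw [hc s hs.2, GSeq.D_eq_zero _ i s (by omega)]
    simp

lemma psi_act (hN : 2 ≤ N) (hq : IsPrimitiveNthRoot N q) (S : GrHom Y Z (-((N - 1 : ℕ) : ℤ)))
    {A B : 𝒜.Obj} (m n l : ℤ) (hl : m + n = l) (x : ((Y.obj A).susp 0).X m)
    (a : (𝒜.hom B A).X n) :
    psi S B l (Y.sigmaAct m n l hl x a) = Z.act m n l hl (psi S A m x) a := by
  refine act_linear_of_single hN hq (psi S) ?_ ?_ m n l hl x a
  · intro A B m m' n l l' hl hm hl' x a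
    rw [psi_d hN hq, psi_d hN hq, ent_first_sigmaAct hN hl hm hl',
      (dHomTop Y Z S).2.2 A B m' n l' m' l' (by omega) (by omega) (by omega), map_neg,
      LinearMap.neg_apply]
  · intro A B m n l i j hl hi hj v a
    rw [psi_single S hN B l j (by omega), psi_single S hN A m i hi,
      S.2.2 A B i n j m l hj hl (by omega)]

/-! ### `Σ` and `θ_q` respect homotopy -/

lemma ent_sigma_map (hN : 2 ≤ N) (hq : IsPrimitiveNthRoot N q) (f : X ⟶ Y) (A : 𝒜.Obj) (m j : ℤ)
    (x : ((X.obj A).susp 0).X m) :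
    (Y.obj A).ent m j (Hom.app ((sigma 𝒜 hN hq).map f) A m x)
      = Hom.app f A j ((X.obj A).ent m j x) :=
  entry_suspFunctor_map hN hq (zpow_zero q) f A m j x

lemma respectsHomotopy_sigma (hN : 2 ≤ N) (hq : IsPrimitiveNthRoot N q) :
    RespectsHomotopy (sigma.{u, v, w, w'} 𝒜 hN hq) := by
  rintro X Y f g ⟨S, hS⟩
  refine homotopic_of_first hN hq _ _ (fun A i => -psi S A i) ?_ ?_
  · intro A B m n l hl x a
    have key : ∀ y : ((X.obj A).susp 0).X m, -psi S B l (X.sigmaAct m n l hl y a)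
        = Y.act m n l hl (-psi S A m y) a := fun y => by
      rw [psi_act hN hq, map_neg, LinearMap.neg_apply]
    exact key x
  · intro A i j hij x
    have key : ∀ y : ((X.obj A).susp 0).X i, -psi S A j (((X.obj A).susp 0).d i j hij y)
        - (Y.obj A).d i j hij (-psi S A i y)
        = Hom.app f A j ((X.obj A).ent i j y) - Hom.app g A j ((X.obj A).ent i j y) := fun y => by
      rw [hS, map_neg, sub_neg_eq_add, neg_add_eq_sub, ← neg_sub, psi_d hN hq, neg_neg]
    refine (key x).trans ?_
    exact (congrArg₂ (· - ·) (ent_sigma_map hN hq f A i j x) (ent_sigma_map hN hq g A i j x)).symm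

/-- The map `F ↦ q ^ (-r) F` from `Hom_𝒜 r (X, Y)` to `Hom_𝒜 r (θ_q X, θ_q Y)`; the factor makes it commute
with the differentials. -/
def thetaGrHom (X Y : NDGModule.{u, v, w, w'} 𝒜) (r : ℤ) :
    GrHom X Y r →ₗ[k] GrHom ((theta 𝒜).obj X) ((theta 𝒜).obj Y) r where
  toFun F := ⟨fun A i j => ((q ^ (-r) : kˣ) : k) • (F.1 A (i + 1) (j + 1) :
      (X.obj A).X (i + 1) →ₗ[k] (Y.obj A).X (j + 1)),
    fun A i j h => by
      have key : ((q ^ (-r) : kˣ) : k) • F.1 A (i + 1) (j + 1) = 0 := by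
        rw [F.2.1 A (i + 1) (j + 1) (by omega), smul_zero]
      exact key,
    fun A B i j l i' l' h h' hr x f => by
      have key : ∀ y : (X.obj A).X (i + 1), ((q ^ (-r) : kˣ) : k) •
          F.1 B (l + 1) (l' + 1) (X.act (i + 1) j (l + 1) (by omega) y f)
          = Y.act (i' + 1) j (l' + 1) (by omega)
            (((q ^ (-r) : kˣ) : k) • F.1 A (i + 1) (i' + 1) y) f := fun y => by
        rw [F.2.2 A B (i + 1) j (l + 1) (i' + 1) (l' + 1) (by omega) (by omega) (by omega), map_smul,
          LinearMap.smul_apply]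
      exact key x⟩
  map_add' F G := Subtype.ext (funext fun A => funext fun i => funext fun j =>
    smul_add (A := (X.obj A).X (i + 1) →ₗ[k] (Y.obj A).X (j + 1)) _ _ _)
  map_smul' c F := Subtype.ext (funext fun A => funext fun i => funext fun j =>
    smul_comm ((q ^ (-r) : kˣ) : k) c (F.1 A (i + 1) (j + 1)))

lemma thetaGrHom_dHom (X Y : NDGModule.{u, v, w, w'} 𝒜) (r s : ℤ) (h : r + 1 = s)
    (F : GrHom X Y r) :
    thetaGrHom X Y s (dHom X Y r s h F) = dHom _ _ r s h (thetaGrHom X Y r F) := by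
  refine Subtype.ext (funext fun A => funext fun i => funext fun j => LinearMap.ext fun x => ?_)
  have key : ∀ y : (X.obj A).X (i + 1), ((q ^ (-s) : kˣ) : k) •
      ((Y.obj A).d (j + 1 - 1) (j + 1) (by omega) (F.1 A (i + 1) (j + 1 - 1) y)
        - ((q ^ r : kˣ) : k) • F.1 A (i + 1 + 1) (j + 1) ((X.obj A).d (i + 1) (i + 1 + 1) rfl y))
      = ((q⁻¹ : kˣ) : k) • (Y.obj A).d (j - 1 + 1) (j + 1) (by omega)
          (((q ^ (-r) : kˣ) : k) • F.1 A (i + 1) (j - 1 + 1) y)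
        - ((q ^ r : kˣ) : k) • ((q ^ (-r) : kˣ) : k) • F.1 A (i + 1 + 1) (j + 1)
          (((q⁻¹ : kˣ) : k) • (X.obj A).d (i + 1) (i + 1 + 1) (by omega) y) := fun y => by
    have e : ∀ a b (ha : a + 1 = j + 1) (hb : b + 1 = j + 1), a = b →
        (Y.obj A).d a (j + 1) ha (F.1 A (i + 1) a y)
          = (Y.obj A).d b (j + 1) hb (F.1 A (i + 1) b y) := by
      rintro a b ha hb rfl; rfl
    have eq : ((q ^ (-s) : kˣ) : k) = ((q⁻¹ : kˣ) : k) * ((q ^ (-r) : kˣ) : k) := by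
      rw [← Units.val_mul, ← zpow_neg_one, ← zpow_add]
      congr 2
      omega
    rw [e (j + 1 - 1) (j - 1 + 1) (by omega) (by omega) (by omega), map_smul, map_smul, smul_sub, eq]
    module
  exact key x

lemma respectsHomotopy_theta : RespectsHomotopy (theta.{u, v, w, w'} 𝒜) := by
  rintro X Y f g ⟨S, hS⟩
  refine ⟨thetaGrHom X Y _ S, fun A i x => ?_⟩
  have e : thetaGrHom X Y 0 (dHomTop X Y S) = dHomTop _ _ (thetaGrHom X Y _ S) :=
    GSeq.map_dpow (V := homSeq X Y) (W := homSeq ((theta 𝒜).obj X) ((theta 𝒜).obj Y))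
      (thetaGrHom X Y) (fun r s h F => thetaGrHom_dHom X Y r s h F) (N - 1) _ 0 (neg_add_cancel _) S
  rw [← e]
  refine (hS A (i + 1) x).trans ?_
  have key : ∀ y : (X.obj A).X (i + 1), (dHomTop X Y S).1 A (i + 1) (i + 1) y
      = ((q ^ (-(0 : ℤ)) : kˣ) : k) • (dHomTop X Y S).1 A (i + 1) (i + 1) y := fun y => by
    rw [neg_zero, zpow_zero, Units.val_one, one_smul]
  exact key x

end NDGModule

/-! ### The comparison of `Σ Σ V` with `V` shifted by `N` -/

lemma sum_Ioo_succ {M : Type w} [AddCommGroup M] (hN : 2 ≤ N) (m : ℤ) (T : ℤ → M)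
    (h : T (m + 1) = 0) : ∑ s ∈ Finset.Ioo m (m + N), T (s + 1)
      = ∑ s ∈ Finset.Ioo m (m + N), T s + T (m + N) := by
  obtain ⟨n, rfl⟩ : ∃ n, N = n + 2 := ⟨N - 2, by omega⟩
  have e1 : ∀ s : ℕ, m + 1 + s + 1 = m + 1 + (s + 1 : ℕ) := fun s => by push_cast; ring
  have e2 : m + (n + 2 : ℕ) = m + 1 + (n + 1 : ℕ) := by push_cast; ring
  rw [sum_Ioo _ _ hN, sum_Ioo _ _ hN, show n + 2 - 1 = n + 1 by omega, e2]
  simp only [e1]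
  rw [Finset.sum_range_succ, Finset.sum_range_succ' (fun s : ℕ => T (m + 1 + s)) n]
  simp [h]

namespace NDGMod

variable (V : NDGMod.{u, w} k N)

/-- The sum of the entries of degree `p` in `V` of an element of `Σ Σ V`. -/
def diag (m p : ℤ) : ((V.susp 0).susp 0).X m →ₗ[k] V.X p :=
  ∑ l ∈ Finset.Ioo m (m + N), V.ent l p ∘ₗ (V.susp 0).ent m l

variable {V}

lemma diag_apply (m p : ℤ) (y : ((V.susp 0).susp 0).X m) :
    V.diag m p y = ∑ l ∈ Finset.Ioo m (m + N), V.ent l p ((V.susp 0).ent m l y) := by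
  simp [diag]

lemma diag_eq_zero {m p : ℤ} (h : p ≤ m + 1) (y : ((V.susp 0).susp 0).X m) : V.diag m p y = 0 := by
  rw [diag_apply]
  refine Finset.sum_eq_zero fun l hl => ?_
  rw [Finset.mem_Ioo] at hl
  exact ent_eq_zero (by omega) _

/-- The first entry of the partial sum in degree `s` of an element of `Σ Σ V`. -/
lemma ent_cum {m s p : ℤ} (hp : s + 1 = p) (hs : s < m + N)
    (y : ((V.susp 0).susp 0).X m) : V.ent s p ((V.susp 0).cum m s y) = V.diag m p y := by
  rw [cum_apply, top_of_ne hs.ne, add_zero, map_sum, diag_apply]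
  refine Finset.sum_congr rfl fun l hl => ?_
  rw [Finset.mem_Ioo] at hl
  rcases le_or_gt l s with h | h
  · exact ent_D_of_lt h _ (by omega) (by omega)
  · rw [GSeq.D_eq_zero _ _ _ h, LinearMap.zero_apply, map_zero, ent_eq_zero (by omega)]

lemma diag_d (hN : 2 ≤ N) {m m' p : ℤ} (h : m + 1 = m') (h1 : m' < p) (h2 : p ≤ m + N)
    (y : ((V.susp 0).susp 0).X m) :
    V.diag m' p (((V.susp 0).susp 0).d m m' h y)
      = V.diag m p y - V.ent m' p ((V.susp 0).ent m m' y) := by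
  rw [← ent_cum (s := p - 1) (by omega) (by omega), cum_d hN h (by omega), map_sub,
    ent_cum (by omega) (by omega), ent_D_of_lt (by omega) _ (by omega) (by omega)]

lemma diag_single {m i : ℤ} (h1 : m < i) (h2 : i < m + N) (p : ℤ) (x : (V.susp 0).X i) :
    V.diag m p ((V.susp 0).single m i x) = V.ent i p x := by
  rw [diag_apply, Finset.sum_eq_single_of_mem i (Finset.mem_Ioo.2 ⟨h1, h2⟩),
    ent_single_self h1 h2]
  intro l _ hl
  rw [ent_single_of_ne hl, map_zero]

variable (V)

/-- The projection of `Σ Σ V` onto the shift of `V` by `N`: the sum of the images in degree `m + N` of all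
entries of degree at most `m + N`. -/
def proj (m : ℤ) : ((V.susp 0).susp 0).X m →ₗ[k] V.X (m + N) :=
  ∑ s ∈ Finset.Ioo m (m + N), V.D (s + 1) (m + N) ∘ₗ V.diag m (s + 1)

variable {V}

lemma proj_apply (m : ℤ) (y : ((V.susp 0).susp 0).X m) :
    V.proj m y = ∑ s ∈ Finset.Ioo m (m + N), V.D (s + 1) (m + N) (V.diag m (s + 1) y) := by
  simp [proj]

variable (V)

/-- The map `Σ Σ V → Σ V` whose entries are the sums `diag`, with the opposite sign. It gives rise to the
homotopy between the identity of `Σ Σ V` and the projector onto the shift of `V`. -/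
def contraction (m : ℤ) : ((V.susp 0).susp 0).X m →ₗ[k] (V.susp 0).X m :=
  LinearMap.pi fun p : Finset.Ioo (m + 0) (m + 0 + N) => -V.diag m p

variable {V}

lemma ent_contraction {m p : ℤ} (h1 : m < p) (h2 : p < m + N) (y : ((V.susp 0).susp 0).X m) :
    V.ent m p (V.contraction m y) = -V.diag m p y :=
  ent_mk h1 h2 _

lemma contraction_d (hN : 2 ≤ N) {m m' : ℤ} (h : m + 1 = m') (y : ((V.susp 0).susp 0).X m) :
    V.contraction m' (((V.susp 0).susp 0).d m m' h y) - (V.susp 0).d m m' h (V.contraction m y)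
      = (V.susp 0).ent m m' y - V.single m' (m + N) (V.proj m y) := by
  refine ent_ext fun p h1 h2 => ?_
  rw [map_sub, map_sub, ent_contraction h1 h2, ent_d h _ h1 h2, diag_d hN h h1 (by omega)]
  -- The entry of degree `m + N` is the new entry of the differential, where the projection appears.
  rcases eq_or_ne p (m + N) with rfl | hp
  · rw [ent_eq_zero (m := m) (i := m + N) (by omega) (V.contraction m y), zero_add,
      ent_single_self h1 h2, top_self, proj_apply, neg_sub, sub_neg_eq_add]
    have e1 : ∑ s ∈ Finset.Ioo m (m + N), V.D s (m + N) (V.ent m s (V.contraction m y))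
        = - ∑ s ∈ Finset.Ioo m (m + N), V.D s (m + N) (V.diag m s y) := by
      rw [← Finset.sum_neg_distrib]
      refine Finset.sum_congr rfl fun s hs => ?_
      rw [Finset.mem_Ioo] at hs
      rw [ent_contraction hs.1 hs.2, map_neg]
    have e2 := sum_Ioo_succ hN m (fun p => V.D p (m + N) (V.diag m p y))
      (by simp only [diag_eq_zero le_rfl, map_zero])
    rw [e1, e2, GSeq.D_self]
    abel
  · rw [ent_contraction (by omega) (by omega), top_of_ne hp, ent_single_of_ne hp]
    abel

variable (V)

/-- The inclusion of the shift of `V` by `N` into `Σ Σ V`: the entry of degree `t` of the image of `x` is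
the element of `Σ V` with last entry `d ^ (t - m - 1) (x)` and all other entries `0`. -/
def incl (m : ℤ) : V.X (m + N) →ₗ[k] ((V.susp 0).susp 0).X m :=
  LinearMap.pi fun t : Finset.Ioo (m + 0) (m + 0 + N) =>
    (V.single t ((t : ℤ) + N - 1) ∘ₗ V.D (m + N) ((t : ℤ) + N - 1) : V.X (m + N) →ₗ[k] (V.susp 0).X t)

variable {V}

lemma ent_incl {m t : ℤ} (h1 : m < t) (h2 : t < m + N) (x : V.X (m + N)) :
    (V.susp 0).ent m t (V.incl m x) = V.single t (t + N - 1) (V.D (m + N) (t + N - 1) x) :=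
  ent_mk (V := V.susp 0) h1 h2 _

lemma ent_first_incl (hN : 2 ≤ N) {m m' : ℤ} (h : m + 1 = m') (x : V.X (m + N)) :
    (V.susp 0).ent m m' (V.incl m x) = V.single m' (m + N) x := by
  rw [ent_incl (by omega) (by omega)]
  have : ∀ p, p = m + N → V.single m' p (V.D (m + N) p x) = V.single m' (m + N) x := by
    rintro _ rfl
    rw [GSeq.D_self]
  exact this _ (by omega)

lemma incl_d (hN : 2 ≤ N) {m m' : ℤ} (h : m + 1 = m') (x : V.X (m + N)) :
    V.incl m' (V.d (m + N) (m' + N) (by omega) x) = ((V.susp 0).susp 0).d m m' h (V.incl m x) := by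
  refine ent_ext fun t h1 h2 => ?_
  rw [ent_incl h1 h2, ent_d h _ h1 h2, GSeq.D_d _ _ _ _ _ (by omega)]
  -- For `t = m + N`, the new entry of the differential is a sum of two contributions of each entry, which
  -- cancel in pairs except at the last position.
  rcases eq_or_ne t (m + N) with rfl | ht
  · rw [ent_eq_zero (by omega), zero_add, top_self]
    refine ent_ext fun p h3 h4 => ?_
    have e : ∀ l ∈ Finset.Ioo m (m + N), V.ent (m + N) p ((V.susp 0).D l (m + N)
        ((V.susp 0).ent m l (V.incl m x)))
        = (if l = p + 1 - N then V.D (m + N) p x else 0)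
          - if l = p - N then V.D (m + N) p x else 0 := by
      intro l hl
      rw [Finset.mem_Ioo] at hl
      rw [ent_incl hl.1 hl.2, ent_D (by omega) (by omega) _ h3 h4]
      refine (congrArg₂ (· + ·) ?_ ?_).trans (sub_eq_add_neg _ _).symm
      · split_ifs with hp
        · obtain rfl : p = l + N - 1 := by omega
          rw [ent_single_self (by omega) (by omega)]
        · rw [ent_single_of_ne (by omega)]
      · split_ifs with hp
        · rw [top_single (by omega) (by omega) (by omega), GSeq.D_D _ _ _ _ (by omega) (by omega)]
        · rw [top_of_ne (by omega), neg_zero]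
    rw [map_neg, map_sum, Finset.sum_congr rfl e, Finset.sum_sub_distrib, Finset.sum_ite_eq',
      Finset.sum_ite_eq', if_pos (Finset.mem_Ioo.2 ⟨by omega, by omega⟩ : p - N ∈ _)]
    by_cases hp : p = m + N + N - 1
    · subst hp
      rw [ent_single_self (by omega) (by omega), if_neg (by rw [Finset.mem_Ioo]; omega)]
      abel
    · rw [ent_single_of_ne hp, if_pos (by rw [Finset.mem_Ioo]; omega)]
      abel
  · rw [ent_incl (by omega) (by omega), top_of_ne ht, add_zero]

lemma proj_incl (hN : 2 ≤ N) (m : ℤ) (x : V.X (m + N)) : V.proj m (V.incl m x) = x := by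
  have e : ∀ p, p ≤ m + N → V.diag m p (V.incl m x) = if p = m + N then V.D (m + N) p x else 0 := by
    intro p hp
    rw [diag_apply, Finset.sum_eq_single_of_mem (m + 1) (by rw [Finset.mem_Ioo]; omega),
      ent_first_incl hN rfl]
    · split_ifs with h
      · subst h
        rw [ent_single_self (by omega) (by omega), GSeq.D_self]
      · rw [ent_single_of_ne h]
    · intro l hl hne
      rw [Finset.mem_Ioo] at hl
      rw [ent_incl hl.1 hl.2, ent_single_of_ne (by omega)]
  rw [proj_apply, Finset.sum_eq_single_of_mem (m + N - 1) (by rw [Finset.mem_Ioo]; omega),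
    e _ (by omega), if_pos (by omega), GSeq.D_D _ _ _ _ (by omega) (by omega), GSeq.D_self]
  intro s hs hne
  rw [Finset.mem_Ioo] at hs
  rw [e _ (by omega), if_neg (by omega), map_zero]

/-- The formula for `d ^ (N - 1) (S)` gives `0` if `S` is the first entry of `Σ V`: the summand for
`l = N - 1` is the new entry of `d ^ (N - 1) (x)`, which cancels the other summands. -/
lemma sum_D_ent_first (hN : 2 ≤ N) (i : ℤ) (x : (V.susp 0).X i) :
    ∑ l ∈ Finset.range N, V.D (i + l + 1) (i + N)
      (V.ent (i + l) (i + l + 1) ((V.susp 0).D i (i + l) x)) = 0 := by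
  obtain ⟨n, rfl⟩ : ∃ n, N = n + 1 := ⟨N - 1, by omega⟩
  have e1 : ∀ l ∈ Finset.range n, V.D (i + l + 1) (i + (n + 1 : ℕ))
      (V.ent (i + l) (i + l + 1) ((V.susp 0).D i (i + l) x))
      = V.D (i + 1 + l) (i + (n + 1 : ℕ)) (V.ent i (i + 1 + l) x) := by
    intro l hl
    have := Finset.mem_range.1 hl
    rw [ent_D_of_lt (by omega) _ (by omega) (by push_cast; omega), add_right_comm]
  have e2 : i + (n : ℤ) + 1 = i + (n + 1 : ℕ) := by push_cast; ring
  rw [Finset.sum_range_succ, Finset.sum_congr rfl e1, e2,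
    ent_D (by omega) (by push_cast; omega) _ (by omega) (by push_cast; omega),
    ent_eq_zero (by omega), zero_add, GSeq.D_self, top_self, sum_Ioo _ _ hN]
  simp

end NDGMod

namespace NDGModule

variable {X Y : NDGModule.{u, v, w, w'} 𝒜}

/-- The first entry `Σ X → X`, as a homogeneous map of degree `1 - N` to the shift of `X` by `N`. -/
def firstMap (X : NDGModule.{u, v, w, w'} 𝒜) (A : 𝒜.Obj) (i j : ℤ) :
    ((X.obj A).susp 0).X i →ₗ[k] (X.obj A).X (j + N) :=
  if i + -((N - 1 : ℕ) : ℤ) = j then (X.obj A).ent i (j + N) else 0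

lemma firstMap_apply (A : 𝒜.Obj) {i j : ℤ} (hij : i + -((N - 1 : ℕ) : ℤ) = j)
    (x : ((X.obj A).susp 0).X i) : firstMap X A i j x = (X.obj A).ent i (j + N) x := by
  rw [firstMap, if_pos hij]

/-- The maps `firstMap` as an element of `Hom_𝒜 (1 - N) (Σ X, θ_q ^ N X)`. -/
def firstGrHom (hN : 2 ≤ N) (hq : IsPrimitiveNthRoot N q) (X : NDGModule.{u, v, w, w'} 𝒜) :
    GrHom ((sigma 𝒜 hN hq).obj X) ((shiftFunctor 𝒜 N 1 (one_mul_zpow_card hq)).obj X)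
      (-((N - 1 : ℕ) : ℤ)) :=
  ⟨firstMap X, fun A i j hij => if_neg hij, fun A B i j l i' l' hl hl' hi x f => by
    have key : ∀ y : ((X.obj A).susp 0).X i, firstMap X B l l' (X.sigmaAct i j l hl y f)
        = X.act (i' + N) j (l' + N) (by omega) (firstMap X A i i' y) f := fun y => by
      rw [firstMap_apply B (by omega), firstMap_apply A hi,
        ent_first_sigmaAct hN hl (m' := i' + N) (by omega) (by omega)]
    exact key x⟩

lemma dHomTop_firstGrHom (hN : 2 ≤ N) (hq : IsPrimitiveNthRoot N q) (A : 𝒜.Obj) (i : ℤ)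
    (x : ((X.obj A).susp 0).X i) : (dHomTop _ _ (firstGrHom hN hq X)).1 A i i x = 0 := by
  refine (dHomTop_apply hN hq _ _ (firstGrHom hN hq X) A i x).trans ?_
  refine Eq.trans (Finset.sum_congr rfl fun l hl => ?_) (NDGMod.sum_D_ent_first hN i x)
  refine (GSeq.shiftBy_D _ _ _ _ _).trans ?_
  have key : ∀ j, j = i + l + 1 → ∀ y : ((X.obj A).susp 0).X (i + l),
      (X.obj A).D j (i + N) ((X.obj A).ent (i + l) j y)
        = (X.obj A).D (i + l + 1) (i + N) ((X.obj A).ent (i + l) (i + l + 1) y) := by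
    rintro _ rfl y; rfl
  refine Eq.trans ?_ (key (i + l + -((N - 1 : ℕ) : ℤ) + N) (by omega) _)
  exact congrArg ((X.obj A).D _ _) (firstMap_apply A rfl _)

lemma psi_firstGrHom (hN : 2 ≤ N) (hq : IsPrimitiveNthRoot N q) (A : 𝒜.Obj) (m : ℤ)
    (y : (((X.obj A).susp 0).susp 0).X m) :
    psi (firstGrHom hN hq X) A m y = (X.obj A).proj m y := by
  rw [NDGMod.proj_apply]
  refine (psi_apply (firstGrHom hN hq X) A m y).trans (Finset.sum_congr rfl fun s hs => ?_)
  rw [Finset.mem_Ioo] at hs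
  refine (GSeq.shiftBy_D _ _ _ _ _).trans ?_
  have key : ∀ j, j = s + 1 → ∀ z : ((X.obj A).susp 0).X s,
      (X.obj A).D j (m + N) ((X.obj A).ent s j z)
        = (X.obj A).D (s + 1) (m + N) ((X.obj A).ent s (s + 1) z) := by
    rintro _ rfl z; rfl
  rw [← NDGMod.ent_cum rfl hs.2]
  refine Eq.trans ?_ (key (s + -((N - 1 : ℕ) : ℤ) + N) (by omega) _)
  exact congrArg ((X.obj A).D _ _) (firstMap_apply A rfl _)

/-- The projection `Σ Σ X ⟶ θ_q ^ N X`. It is the map out of `Σ (Σ X)` given by the first entry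
`Σ X → X`, so that its differential and its linearity come from `psi_d` and `psi_act`. -/
def projHom (hN : 2 ≤ N) (hq : IsPrimitiveNthRoot N q) (X : NDGModule.{u, v, w, w'} 𝒜) :
    (sigma 𝒜 hN hq).obj ((sigma 𝒜 hN hq).obj X) ⟶
      (shiftFunctor 𝒜 N 1 (one_mul_zpow_card hq)).obj X where
  app A m := psi (firstGrHom hN hq X) A m
  comm_d A m m' h y := by
    refine sub_eq_zero.1 ((psi_d hN hq (firstGrHom hN hq X) A m m' h y).trans ?_)
    rw [neg_eq_zero]
    exact dHomTop_firstGrHom hN hq A m' _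
  comm_act m n l h y a := psi_act hN hq (firstGrHom hN hq X) m n l h y a

lemma projHom_app (hN : 2 ≤ N) (hq : IsPrimitiveNthRoot N q) (A : 𝒜.Obj) (m : ℤ)
    (y : (((X.obj A).susp 0).susp 0).X m) :
    Hom.app (projHom hN hq X) A m y = (X.obj A).proj m y :=
  psi_firstGrHom hN hq A m y

lemma proj_act (hN : 2 ≤ N) (hq : IsPrimitiveNthRoot N q) {A B : 𝒜.Obj} (m n l : ℤ)
    (hl : m + n = l) (y : (((X.obj A).susp 0).susp 0).X m) (a : (𝒜.hom B A).X n) :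
    (X.obj B).proj l (((sigma 𝒜 hN hq).obj X).sigmaAct m n l hl y a)
      = X.act (m + N) n (l + N) (by omega) ((X.obj A).proj m y) a := by
  refine (projHom_app hN hq B l _).symm.trans (((projHom hN hq X).comm_act m n l hl y a).trans ?_)
  exact congrArg (fun z => X.act (m + N) n (l + N) (by omega) z a) (projHom_app hN hq A m y)

lemma proj_map (hN : 2 ≤ N) (hq : IsPrimitiveNthRoot N q) (f : X ⟶ Y) (A : 𝒜.Obj) (m : ℤ)
    (y : (((X.obj A).susp 0).susp 0).X m) :
    (Y.obj A).proj m (Hom.app ((sigma 𝒜 hN hq).map ((sigma 𝒜 hN hq).map f)) A m y)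
      = Hom.app f A (m + N) ((X.obj A).proj m y) := by
  rw [NDGMod.proj_apply m y, map_sum]
  refine (NDGMod.proj_apply m _).trans (Finset.sum_congr rfl fun s _ => ?_)
  rw [GSeq.map_D (Hom.app f A) (f.comm_d A), NDGMod.diag_apply m (s + 1) y, map_sum]
  refine congrArg _ ((NDGMod.diag_apply m (s + 1) _).trans (Finset.sum_congr rfl fun l _ => ?_))
  refine Eq.trans ?_ (ent_sigma_map hN hq f A l (s + 1) _)
  exact congrArg ((Y.obj A).ent l (s + 1))
    (ent_sigma_map hN hq ((sigma 𝒜 hN hq).map f) A m l y)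

/-- The projections `Σ Σ X ⟶ θ_q ^ N X` as a natural transformation. -/
def projTrans (𝒜 : NDGCat.{u, v, w} k N q) (hN : 2 ≤ N) (hq : IsPrimitiveNthRoot N q) :
    sigma.{u, v, w, w'} 𝒜 hN hq ⋙ sigma 𝒜 hN hq ⟶ shiftFunctor 𝒜 N 1 (one_mul_zpow_card hq) where
  app := projHom hN hq
  naturality X Y f := hom_ext fun A m y => by
    refine (projHom_app hN hq A m _).trans ((proj_map hN hq f A m y).trans ?_)
    exact congrArg (Hom.app f A (m + N)) (projHom_app hN hq A m y).symm

/-- The inclusion `θ_q ^ N X ⟶ Σ Σ X`. -/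
def inclHom (hN : 2 ≤ N) (hq : IsPrimitiveNthRoot N q) (X : NDGModule.{u, v, w, w'} 𝒜) :
    (shiftFunctor 𝒜 N 1 (one_mul_zpow_card hq)).obj X ⟶
      (sigma 𝒜 hN hq).obj ((sigma 𝒜 hN hq).obj X) where
  app A m := (X.obj A).incl m
  comm_d A m m' h x := by
    refine Eq.trans ?_ (NDGMod.incl_d hN h x)
    exact congrArg ((X.obj A).incl m') (one_smul k _)
  comm_act m n l h x a := by
    refine act_linear_of_first (X := (sigma 𝒜 hN hq).obj X) hN hq
      (Z := (shiftFunctor 𝒜 N 1 (one_mul_zpow_card hq)).obj X) (fun A m => (X.obj A).incl m)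
      ?_ ?_ m n l h x a
    · intro A m m' h x
      refine Eq.trans ?_ (NDGMod.incl_d hN h x)
      exact congrArg ((X.obj A).incl m') (one_smul k _)
    · intro A B m m' n l l' hl hm hl' x a
      refine (NDGMod.ent_first_incl (V := X.obj B) hN hl' _).trans ?_
      refine (single_sigmaAct hN (m := m') (n := n) (l := l') (i := m + N) (j := l + N) (by omega)
        (by omega) (by omega) x a).symm.trans ?_
      exact congrArg (fun z => X.sigmaAct m' n l' (by omega) z a)
        (NDGMod.ent_first_incl (V := X.obj A) hN hm x).symm

lemma inclHom_comp_projHom (hN : 2 ≤ N) (hq : IsPrimitiveNthRoot N q)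
    (X : NDGModule.{u, v, w, w'} 𝒜) : inclHom hN hq X ≫ projHom hN hq X = 𝟙 _ :=
  hom_ext fun A m x => (projHom_app hN hq A m _).trans (NDGMod.proj_incl hN m x)

lemma contraction_act (hN : 2 ≤ N) (hq : IsPrimitiveNthRoot N q) {A B : 𝒜.Obj} (m n l : ℤ)
    (hl : m + n = l) (y : (((X.obj A).susp 0).susp 0).X m) (a : (𝒜.hom B A).X n) :
    (X.obj B).contraction l (((sigma 𝒜 hN hq).obj X).sigmaAct m n l hl y a)
      = X.sigmaAct m n l hl ((X.obj A).contraction m y) a := by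
  refine act_linear_of_single (X := (sigma 𝒜 hN hq).obj X) (Y := (sigma 𝒜 hN hq).obj X) hN hq
    (fun A m => (X.obj A).contraction m) ?_ ?_ m n l hl y a
  · intro A B m m' n l l' hl hm hl' y a
    refine (NDGMod.contraction_d (V := X.obj B) hN hl' _).trans ?_
    refine Eq.trans ?_ (congrArg (fun z => X.sigmaAct m' n l' (by omega) z a)
      (NDGMod.contraction_d (V := X.obj A) hN hm y)).symm
    rw [map_sub, LinearMap.sub_apply,
      single_sigmaAct hN (l := l') (j := l + N) (by omega) (by omega) (by omega)]
    refine congrArg₂ (· - ·) (ent_first_sigmaAct (X := (sigma 𝒜 hN hq).obj X) hN hl hm hl' y a) ?_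
    exact congrArg ((X.obj B).single l' (l + N)) (proj_act hN hq m n l hl y a)
  · have key : ∀ (A : 𝒜.Obj) (m i : ℤ) (_ : i + 1 = m + N) (v : ((X.obj A).susp 0).X i),
        (X.obj A).contraction m (((X.obj A).susp 0).single m i v) = 0 := by
      intro A m i hi v
      refine NDGMod.ent_ext fun p h1 h2 => ?_
      rw [NDGMod.ent_contraction h1 h2, NDGMod.diag_single (by omega) (by omega),
        NDGMod.ent_eq_zero (by omega), neg_zero, map_zero]
    intro A B m n l i j hl hi hj v a
    refine (key B l j (by omega) _).trans (Eq.symm ?_)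
    refine (congrArg (fun z => X.sigmaAct m n l hl z a) (key A m i hi v)).trans ?_
    rw [map_zero, LinearMap.zero_apply]

lemma homotopic_projHom_comp_inclHom (hN : 2 ≤ N) (hq : IsPrimitiveNthRoot N q)
    (X : NDGModule.{u, v, w, w'} 𝒜) :
    Homotopic 𝒜 (𝟙 ((sigma 𝒜 hN hq).obj ((sigma 𝒜 hN hq).obj X)))
      (projHom hN hq X ≫ inclHom hN hq X) := by
  refine homotopic_of_first (Y := (sigma 𝒜 hN hq).obj X) hN hq _ _
    (fun A m => (X.obj A).contraction m) ?_ ?_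
  · intro A B m n l hl y a
    exact contraction_act hN hq m n l hl y a
  · intro A m m' h y
    refine (NDGMod.contraction_d (V := X.obj A) hN h y).trans (congrArg₂ (· - ·) rfl ?_)
    refine Eq.trans ?_ (NDGMod.ent_first_incl (V := X.obj A) hN h _).symm
    exact congrArg ((X.obj A).single m' (m + N)) (projHom_app hN hq A m y).symm

/-! ### Passage to the homotopy category -/

/-- Powers of the endofunctor induced on the homotopy category are induced by powers. -/
lemma nonempty_functor_comp_iterate_iso
    {F : NDGModule.{u, v, w, w'} 𝒜 ⥤ NDGModule.{u, v, w, w'} 𝒜} (hF : RespectsHomotopy F) (n : ℕ) :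
    Nonempty (CategoryTheory.Quotient.functor (Homotopic 𝒜) ⋙ iterate (induced F hF) n ≅
      iterate F n ⋙ CategoryTheory.Quotient.functor (Homotopic 𝒜)) := by
  induction n with
  | zero => exact ⟨Iso.refl _⟩
  | succ n ih =>
    obtain ⟨e⟩ := ih
    let Q := CategoryTheory.Quotient.functor (Homotopic.{u, v, w, w'} 𝒜)
    let e' : Q ⋙ induced F hF ≅ F ⋙ Q := CategoryTheory.Quotient.lift.isLift _ (F ⋙ Q) _
    exact ⟨(Functor.associator Q (iterate (induced F hF) n) (induced F hF)).symm ≪≫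
      Functor.isoWhiskerRight e (induced F hF) ≪≫ Functor.associator (iterate F n) Q _ ≪≫
      Functor.isoWhiskerLeft (iterate F n) e' ≪≫ (Functor.associator (iterate F n) F Q).symm⟩

/-- The projection `Σ Σ X ⟶ θ_q ^ N X` is an isomorphism in the homotopy category. -/
lemma isIso_functor_map_projHom (hN : 2 ≤ N) (hq : IsPrimitiveNthRoot N q)
    (X : NDGModule.{u, v, w, w'} 𝒜) :
    IsIso ((CategoryTheory.Quotient.functor (Homotopic 𝒜)).map (projHom hN hq X)) := by
  refine ⟨(CategoryTheory.Quotient.functor (Homotopic 𝒜)).map (inclHom hN hq X), ?_, ?_⟩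
  · rw [← CategoryTheory.Functor.map_comp, ← CategoryTheory.Functor.map_id]
    exact (CategoryTheory.Quotient.sound _ (homotopic_projHom_comp_inclHom hN hq X)).symm
  · rw [← CategoryTheory.Functor.map_comp, inclHom_comp_projHom, CategoryTheory.Functor.map_id]

lemma nonempty_induced_sigma_sq_iso (hN : 2 ≤ N) (hq : IsPrimitiveNthRoot N q)
    (hs : RespectsHomotopy (sigma.{u, v, w, w'} 𝒜 hN hq))
    (ht : RespectsHomotopy (theta.{u, v, w, w'} 𝒜)) :
    Nonempty (induced (sigma 𝒜 hN hq) hs ⋙ induced (sigma 𝒜 hN hq) hs ≅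
      iterate (induced (theta 𝒜) ht) N) := by
  let Q := CategoryTheory.Quotient.functor (Homotopic.{u, v, w, w'} 𝒜)
  obtain ⟨e₁⟩ := nonempty_functor_comp_iterate_iso ht N
  obtain ⟨e₂⟩ := nonempty_iterate_theta_card_iso.{u, v, w, w'} (𝒜 := 𝒜) hq
  have : ∀ X, IsIso ((Functor.whiskerRight (projTrans 𝒜 hN hq) Q).app X) :=
    isIso_functor_map_projHom hN hq
  have : IsIso (Functor.whiskerRight (projTrans 𝒜 hN hq) Q) := NatIso.isIso_of_isIso_app _
  let e₃ : Q ⋙ induced (sigma 𝒜 hN hq) hs ⋙ induced (sigma 𝒜 hN hq) hs ≅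
      (sigma 𝒜 hN hq ⋙ sigma 𝒜 hN hq) ⋙ Q := NatIso.ofComponents fun _ => Iso.refl _
  exact ⟨CategoryTheory.Quotient.natIsoLift _ (e₃ ≪≫
    asIso (Functor.whiskerRight (projTrans 𝒜 hN hq) Q) ≪≫ Functor.isoWhiskerRight e₂.symm Q ≪≫
    e₁.symm)⟩

end NDGModule

end

end NDG

theorem mainTheorem5 {k : Type u} [CommRing k] {N : ℕ} (hN : 2 ≤ N) {q : kˣ}
    (hq : NDG.IsPrimitiveNthRoot N q) (𝒜 : NDG.NDGCat.{u, v, w} k N q) :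
    Nonempty (NDG.NDGModule.sigma.{u, v, w, w'} 𝒜 hN hq ≅
        NDG.iterate (NDG.NDGModule.theta.{u, v, w, w'} 𝒜) N ⋙
          NDG.NDGModule.sigmaInv.{u, v, w, w'} 𝒜 hN hq) ∧
    Nonempty (NDG.iterate (NDG.NDGModule.theta.{u, v, w, w'} 𝒜) N ⋙
          NDG.NDGModule.sigmaInv.{u, v, w, w'} 𝒜 hN hq ≅
        NDG.NDGModule.sigmaInv.{u, v, w, w'} 𝒜 hN hq ⋙
          NDG.iterate (NDG.NDGModule.theta.{u, v, w, w'} 𝒜) N) ∧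
    ∃ (hSigma : NDG.NDGModule.RespectsHomotopy (NDG.NDGModule.sigma.{u, v, w, w'} 𝒜 hN hq))
      (hTheta : NDG.NDGModule.RespectsHomotopy (NDG.NDGModule.theta.{u, v, w, w'} 𝒜)),
      Nonempty (NDG.NDGModule.induced (NDG.NDGModule.sigma.{u, v, w, w'} 𝒜 hN hq) hSigma ⋙
          NDG.NDGModule.induced (NDG.NDGModule.sigma.{u, v, w, w'} 𝒜 hN hq) hSigma ≅
        NDG.iterate (NDG.NDGModule.induced (NDG.NDGModule.theta.{u, v, w, w'} 𝒜) hTheta) N) := by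
  obtain ⟨e⟩ := NDG.NDGModule.nonempty_iterate_theta_card_iso.{u, v, w, w'} (𝒜 := 𝒜) hq
  obtain ⟨e₁⟩ := NDG.NDGModule.nonempty_sigma_iso_shift_comp_sigmaInv.{u, v, w, w'} (𝒜 := 𝒜) hN hq
  obtain ⟨e₂⟩ := NDG.NDGModule.nonempty_sigma_iso_sigmaInv_comp_shift.{u, v, w, w'} (𝒜 := 𝒜) hN hq
  have f₁ := e₁ ≪≫ Functor.isoWhiskerRight e.symm _
  have f₂ := e₂ ≪≫ Functor.isoWhiskerLeft (NDG.NDGModule.sigmaInv 𝒜 hN hq) e.symm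
  exact ⟨⟨f₁⟩, ⟨f₁.symm ≪≫ f₂⟩, NDG.NDGModule.respectsHomotopy_sigma hN hq,
    NDG.NDGModule.respectsHomotopy_theta, NDG.NDGModule.nonempty_induced_sigma_sq_iso hN hq _ _⟩
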